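/- **Notation.** On $\mathbb R^{1+2}$ use the metric $\mathrm{diag}(1,-1,-1)$ to raise indices, sum over repeated indices in $\{0,1,2\}$, and let $\epsilon_{\mu\nu\rho}$ be skew-symmetric with $\epsilon_{012}=1$. Put $\langle\xi\rangle=(1+|\xi|^2)^{1/2}$, $\langle\nabla\rangle=(1-\Delta)^{1/2}$, $H^s=(1-\Delta)^{-s/2}L^2(\mathbb R^2)$. For an interval $I$, $C(I;H^s)$ is the space of bounded continuous maps $I\to H^s$ (boundedness is automatic if $I$ is compact). Let $V$ be a real polynomial. For complex-valued $A_{\mu,\pm}$ $(\mu=0,1,2)$ and $\phi_\pm$ write $$A_\mu=A_{\mu,+}+A_{\mu,-},\quad \partial_tA_\mu=i\langle\nabla\rangle(A_{\mu,+}-A_{\mu,-}),\quad \phi=\phi_++\phi_-,\quad \partial_t\phi=i\langle\nabla\rangle(\phi_+-\phi_-),$$ and, with these substitutions (time derivatives of products being expanded by the Leibniz rule), $$M_\mu=-\epsilon_{\mu\nu\rho}\,\mathrm{Im}\,Q^{\nu\rho}(\overline\phi,\phi)+2\epsilon_{\mu\nu\rho}\partial^\nu\big(A^\rho|\phi|^2\big)+A_\mu,\qquad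 Q^{\nu\rho}(u,v)=\partial^\nu u\,\partial^\rho v-\partial^\rho u\,\partial^\nu v,$$ $$N=2iA_\mu\partial^\mu\phi+A_\mu A^\mu\phi-\phi V'(|\phi|^2)+\phi.$$ Products of distributions on $\mathbb R^2$ at a fixed time are defined by convolution of their Fourier transforms. The half-wave system is $$(i\partial_t\pm\langle\nabla\rangle)A_{\mu,\pm}=\pm\tfrac12\langle\nabla\rangle^{-1}M_\mu,\qquad (i\partial_t\pm\langle\nabla\rangle)\phi_\pm=\pm\tfrac12\langle\nabla\rangle^{-1}N \qquad(\ast)$$ in the sense of distributions on (the interior of) $I\times\mathbb R^2$. For $s,b\in\mathbb R$, $X^{s,b}_\pm$ is the completion of the Schwartz space on $\mathbb R^{1+2}$ in the norm $\|\langle\xi\rangle^s\langle-\tau\pm|\xi|\rangle^b\,\widetilde u(\tau,\xi)\|_{L^2_{\tau,\xi}}$, where $\widetilde u(\tau,\xi)=\int e^{-i(t\tau+x\cdot\xi)}u(t,x)\,dt\,dx$; equivalently, the space of tempered distributions whose Fourier transform is a function for which this norm is finite. One writes $u\in X^{s,b}_\pm(I)$ if some $v\in X^{s,b}_\pm$ equals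 $u$ on (the interior of) $I\times\mathbb R^2$. **Proposition 3.4.** Let $I$ be a bounded interval. If $\phi_\pm\in C(I;H^1)$ and $A_{\mu,\pm}\in C(I;H^{1/2})$ $(\mu=0,1,2)$ satisfy $(\ast)$ on $I$, then $$\phi_\pm\in X_\pm^{\theta+\frac12(1-\theta),\,1-\theta}(I),\qquad A_{\mu,\pm}\in X_\pm^{\frac\theta2-\delta(1-\theta),\,1-\theta}(I)$$ for all $\theta\in[0,1]$, all $\delta>0$, all $\mu\in\{0,1,2\}$ and both signs. -/

import Mathlib

open MeasureTheory Polynomial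
open scoped SchwartzMap FourierTransform LineDeriv

namespace CSH

noncomputable section

/-- The space `ℝ²`. -/
abbrev Plane := EuclideanSpace ℝ (Fin 2)

/-- The space-time `ℝ × ℝ²`, with the Euclidean inner product `t τ + x · ξ` that defines the
space-time Fourier transform. -/
abbrev Spacetime := WithLp 2 (ℝ × Plane)

/-! ### Bessel potentials and curves in Sobolev spaces

Mathlib's Fourier transform is `𝓕 f ξ = ∫ exp (-2πi x·ξ) f x dx`, so the frequency variable of the
convention with `exp (-i x·ξ)` is `2π ξ`. -/

/-- The symbol `⟨ξ⟩ ^ s` of `(1 - Δ) ^ (s / 2)`, in Mathlib's normalization of frequencies. -/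
def besselSymbol (s : ℝ) (ξ : Plane) : ℂ :=
  (((1 + ‖(2 * Real.pi) • ξ‖ ^ 2) ^ (s / 2) : ℝ) : ℂ)

/-- The symbol is an admissible Fourier multiplier on tempered distributions. -/
theorem besselSymbol_hasTemperateGrowth (s : ℝ) : (besselSymbol s).HasTemperateGrowth := by
  have h := Function.hasTemperateGrowth_one_add_norm_sq_rpow Plane (s / 2)
  have h2 : (fun ξ : Plane ↦ (2 * Real.pi) • ξ).HasTemperateGrowth := by fun_prop
  have h3 := h.comp h2
  have h4 : (fun r : ℝ ↦ (r : ℂ)).HasTemperateGrowth := by fun_prop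
  exact h4.comp h3

/-- The operator `⟨∇⟩ ^ s = (1 - Δ) ^ (s / 2)` on tempered distributions on `ℝ²`. -/
def bessel (s : ℝ) : 𝓢'(Plane, ℂ) →L[ℂ] 𝓢'(Plane, ℂ) :=
  TemperedDistribution.fourierMultiplierCLM ℂ (besselSymbol s)

/-- `u ∈ C(I; H ^ s)`, with the supremum norm over `I`: `u` is a bounded continuous map from `I`
to `H ^ s = (1 - Δ) ^ (-s / 2) L²`, the norm of `f` in `H ^ s` being the `L²` norm of
`(1 - Δ) ^ (s / 2) f`. Boundedness is automatic if `I` is compact. -/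
def ContinuousSobolev (I : Set ℝ) (s : ℝ) (u : ℝ → 𝓢'(Plane, ℂ)) : Prop :=
  ∃ g : ℝ → Lp ℂ 2 (volume : Measure Plane),
    (∀ t ∈ I, bessel s (u t) = (g t : 𝓢'(Plane, ℂ))) ∧
    ContinuousOn g I ∧ ∃ C : ℝ, ∀ t ∈ I, ‖g t‖ ≤ C

/-! ### Products and conjugates of tempered distributions -/

/-- The Fourier transform of `u` is (integration against) the function `h`. -/
def HasFourierFunction {E : Type*} [NormedAddCommGroup E] [InnerProductSpace ℝ E]
    [FiniteDimensional ℝ E] [MeasurableSpace E] [BorelSpace E]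
    (u : 𝓢'(E, ℂ)) (h : E → ℂ) : Prop :=
  ∀ χ : 𝓢(E, ℂ), Integrable (fun ξ ↦ h ξ * χ ξ) ∧ 𝓕 u χ = ∫ ξ, h ξ * χ ξ

/-- `w` is the product of `u` and `v`: the Fourier transforms of `u` and `v` are functions, their
convolution converges absolutely almost everywhere, and it is the Fourier transform of `w`.
For example, if `u, v ∈ L²` this is the pointwise product, and if `u ∈ H ^ (-s)`, `v ∈ H ^ s`
it is the extension by continuity of the pointwise product. -/
def IsProduct (u v w : 𝓢'(Plane, ℂ)) : Prop :=
  ∃ f g : Plane → ℂ, HasFourierFunction u f ∧ HasFourierFunction v g ∧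
    (∀ᵐ ξ, Integrable fun η ↦ f η * g (ξ - η)) ∧
    HasFourierFunction w fun ξ ↦ ∫ η, f η * g (ξ - η)

theorem HasFourierFunction.locallyIntegrable {u : 𝓢'(Plane, ℂ)} {f : Plane → ℂ}
    (hf : HasFourierFunction u f) : LocallyIntegrable f := by
  intro x
  obtain ⟨χ, -, hc, hs, -, hx⟩ :=
    exists_contDiff_tsupport_subset (E := Plane) (n := ⊤) (x := x) Filter.univ_mem
  have hcs : HasCompactSupport (fun y ↦ (χ y : ℂ)) := hc.comp_left (g := Complex.ofReal) (by simp)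
  have hsm : ContDiff ℝ (⊤ : ℕ∞) (fun y ↦ (χ y : ℂ)) := Complex.ofRealCLM.contDiff.comp hs
  have hi := (hf (hcs.toSchwartzMap hsm)).1
  have hi : Integrable (fun y ↦ f y * (χ y : ℂ)) := hi
  have hopen : IsOpen {y | 1 / 2 < χ y} := isOpen_lt continuous_const hs.continuous
  refine ⟨{y | 1 / 2 < χ y}, hopen.mem_nhds (by simp [hx]; norm_num), ?_⟩
  have hinv : IntegrableOn (fun y ↦ (χ y : ℂ)⁻¹ * (f y * (χ y : ℂ))) {y | 1 / 2 < χ y} := by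
    refine Integrable.bdd_mul (c := 2) hi.integrableOn ?_ ?_
    · exact (Complex.measurable_ofReal.comp hs.continuous.measurable).inv.aestronglyMeasurable
    · filter_upwards [self_mem_ae_restrict hopen.measurableSet] with y hy
      have hy : 1 / 2 < χ y := hy
      rw [norm_inv, Complex.norm_real, Real.norm_of_nonneg (by linarith)]
      exact inv_le_of_inv_le₀ (by norm_num) (by linarith)
  refine hinv.congr_fun ?_ hopen.measurableSet
  intro y hy
  have hy : 1 / 2 < χ y := hy
  have : (χ y : ℂ) ≠ 0 := by
    norm_cast
    linarith
  field_simp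

/-- The function representing the Fourier transform is unique up to null sets. -/
theorem HasFourierFunction.ae_eq {u : 𝓢'(Plane, ℂ)} {f g : Plane → ℂ}
    (hf : HasFourierFunction u f) (hg : HasFourierFunction u g) : f =ᵐ[volume] g := by
  refine ae_eq_of_integral_contDiff_smul_eq hf.locallyIntegrable hg.locallyIntegrable ?_
  intro χ hs hc
  have hcs : HasCompactSupport (fun y ↦ (χ y : ℂ)) := hc.comp_left (g := Complex.ofReal) (by simp)
  have hsm : ContDiff ℝ (⊤ : ℕ∞) (fun y ↦ (χ y : ℂ)) := Complex.ofRealCLM.contDiff.comp hs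
  have h : ∫ y, f y * (χ y : ℂ) = ∫ y, g y * (χ y : ℂ) :=
    (hf (hcs.toSchwartzMap hsm)).2.symm.trans (hg (hcs.toSchwartzMap hsm)).2
  simpa [mul_comm] using h

/-- Two tempered distributions have at most one product. -/
theorem IsProduct.unique {u v w w' : 𝓢'(Plane, ℂ)} (h : IsProduct u v w)
    (h' : IsProduct u v w') : w = w' := by
  obtain ⟨f, g, hf, hg, -, hw⟩ := h
  obtain ⟨f', g', hf', hg', -, hw'⟩ := h'
  have hff := hf.ae_eq hf'
  have hgg := hg.ae_eq hg'
  have hconv : (fun ξ ↦ ∫ η, f η * g (ξ - η)) = fun ξ ↦ ∫ η, f' η * g' (ξ - η) := by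
    funext ξ
    refine integral_congr_ae ?_
    have h2 := 
      (Measure.measurePreserving_sub_left (volume : Measure Plane) ξ).quasiMeasurePreserving.ae_eq_comp
        hgg
    filter_upwards [hff, h2] with η h1 h2
    have h2 : g (ξ - η) = g' (ξ - η) := h2
    rw [h1, h2]
  have hF : 𝓕 w = 𝓕 w' := by
    ext χ
    rw [(hw χ).2, (hw' χ).2, hconv]
  have h3 := congrArg (fun z : 𝓢'(Plane, ℂ) ↦ (𝓕⁻ z : 𝓢'(Plane, ℂ))) hF
  simpa using h3

open Classical in
/-- The product `u v` of two tempered distributions (zero if they have no product). -/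
def prod (u v : 𝓢'(Plane, ℂ)) : 𝓢'(Plane, ℂ) :=
  if h : ∃ w, IsProduct u v w then h.choose else 0

/-- Complex conjugation of Schwartz functions. -/
def conjSchwartz : 𝓢(Plane, ℂ) →L[ℝ] 𝓢(Plane, ℂ) :=
  SchwartzMap.postcompCLM (𝕜 := ℝ) (Complex.conjCLE : ℂ →L[ℝ] ℂ)

theorem conjSchwartz_apply (χ : 𝓢(Plane, ℂ)) (x : Plane) :
    conjSchwartz χ x = (starRingEnd ℂ) (χ x) := rfl

/-- The complex conjugate of a tempered distribution, `ū(χ) = conj (u (conj χ))`. -/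
def conj (u : 𝓢'(Plane, ℂ)) : 𝓢'(Plane, ℂ) :=
  ContinuousLinearMap.toPointwiseConvergenceCLM _ _ _ _
    { toFun := fun χ ↦ (starRingEnd ℂ) (u (conjSchwartz χ))
      map_add' := fun χ₁ χ₂ ↦ by simp
      map_smul' := fun c χ ↦ by
        have h : conjSchwartz (c • χ) = (starRingEnd ℂ) c • conjSchwartz χ := by
          ext x
          simp [conjSchwartz_apply]
        simp [h]
      cont := Complex.continuous_conj.comp (u.continuous.comp conjSchwartz.continuous) }

theorem conj_apply (u : 𝓢'(Plane, ℂ)) (χ : 𝓢(Plane, ℂ)) :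
    conj u χ = (starRingEnd ℂ) (u (conjSchwartz χ)) := rfl

/-- The imaginary part `(u - ū) / (2i)` of a tempered distribution. -/
def imPart (u : 𝓢'(Plane, ℂ)) : 𝓢'(Plane, ℂ) :=
  (1 / (2 * Complex.I)) • (u - conj u)

/-! ### The nonlinearities of the Chern-Simons-Higgs system at a fixed time

A sign `±` is an element of `ℤˣ`, a pair `(u₊, u₋)` is a function on `ℤˣ`, and a space-time index
`μ` is an element of `Fin 3`. -/

/-- A sign as a complex number. -/
def sgn (σ : ℤˣ) : ℂ := ((σ : ℤ) : ℂ)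

/-- `u = u₊ + u₋`. -/
def total (u : ℤˣ → 𝓢'(Plane, ℂ)) : 𝓢'(Plane, ℂ) := u 1 + u (-1)

/-- `∂_t u = i ⟨∇⟩ (u₊ - u₋)`. -/
def totalDt (u : ℤˣ → 𝓢'(Plane, ℂ)) : 𝓢'(Plane, ℂ) := Complex.I • bessel 1 (u 1 - u (-1))

/-- The spatial derivative `∂_{j + 1}`, for `j = 0, 1`. -/
def dSpace (j : Fin 2) (u : 𝓢'(Plane, ℂ)) : 𝓢'(Plane, ℂ) :=
  ∂_{(EuclideanSpace.single j 1 : Plane)} u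

/-- `∂_μ u`, with `∂_0 = ∂_t` expressed through the half-waves. -/
def dLow (μ : Fin 3) (u : ℤˣ → 𝓢'(Plane, ℂ)) : 𝓢'(Plane, ℂ) :=
  Fin.cases (totalDt u) (fun j ↦ dSpace j (total u)) μ

/-- The diagonal of the Minkowski metric `diag (1, -1, -1)`. -/
def metric (μ : Fin 3) : ℂ := if μ = 0 then 1 else -1

/-- `∂^μ u`. -/
def dUp (μ : Fin 3) (u : ℤˣ → 𝓢'(Plane, ℂ)) : 𝓢'(Plane, ℂ) := metric μ • dLow μ u

/-- The skew-symmetric symbol `ε_{μνρ}` with `ε_{012} = 1`. -/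
def eps (μ ν ρ : Fin 3) : ℂ :=
  (((ν : ℕ) : ℂ) - ((μ : ℕ) : ℂ)) * (((ρ : ℕ) : ℂ) - ((μ : ℕ) : ℂ)) *
    (((ρ : ℕ) : ℂ) - ((ν : ℕ) : ℂ)) / 2

/-- `|φ|² = φ̄ φ`. -/
def absSq (φ : ℤˣ → 𝓢'(Plane, ℂ)) : 𝓢'(Plane, ℂ) := prod (conj (total φ)) (total φ)

/-- `∂_t |φ|² = (∂_t φ̄) φ + φ̄ ∂_t φ`. -/
def absSqDt (φ : ℤˣ → 𝓢'(Plane, ℂ)) : 𝓢'(Plane, ℂ) :=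
  prod (conj (totalDt φ)) (total φ) + prod (conj (total φ)) (totalDt φ)

/-- The null form `Q^{νρ}(φ̄, φ) = ∂^ν φ̄ ∂^ρ φ - ∂^ρ φ̄ ∂^ν φ`. -/
def nullForm (ν ρ : Fin 3) (φ : ℤˣ → 𝓢'(Plane, ℂ)) : 𝓢'(Plane, ℂ) :=
  prod (conj (dUp ν φ)) (dUp ρ φ) - prod (conj (dUp ρ φ)) (dUp ν φ)

/-- `∂_ν (a |φ|²)`; the time derivative is expanded by the Leibniz rule, so that it can be
expressed through the half-waves. -/
def dLowCubic (ν : Fin 3) (a φ : ℤˣ → 𝓢'(Plane, ℂ)) : 𝓢'(Plane, ℂ) :=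
  Fin.cases (prod (totalDt a) (absSq φ) + prod (total a) (absSqDt φ))
    (fun j ↦ dSpace j (prod (total a) (absSq φ))) ν

/-- `M_μ(A, φ) = -ε_{μνρ} Im Q^{νρ}(φ̄, φ) + 2 ε_{μνρ} ∂^ν (A^ρ |φ|²) + A_μ`, where
`A^ρ` and `∂^ν` are obtained by raising the index with the Minkowski metric. -/
def nonlinM (A : Fin 3 → ℤˣ → 𝓢'(Plane, ℂ)) (φ : ℤˣ → 𝓢'(Plane, ℂ)) (μ : Fin 3) :
    𝓢'(Plane, ℂ) :=
  -(∑ ν, ∑ ρ, eps μ ν ρ • imPart (nullForm ν ρ φ)) +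
    (2 : ℂ) • (∑ ν, ∑ ρ, (eps μ ν ρ * metric ν * metric ρ) • dLowCubic ν (A ρ) φ) +
    total (A μ)

/-- `|φ|^{2k} φ`. -/
def powTerm (φ : ℤˣ → 𝓢'(Plane, ℂ)) : ℕ → 𝓢'(Plane, ℂ)
  | 0 => total φ
  | k + 1 => prod (absSq φ) (powTerm φ k)

/-- `φ V'(|φ|²)` for a polynomial `V`. -/
def potentialTerm (V : ℝ[X]) (φ : ℤˣ → 𝓢'(Plane, ℂ)) : 𝓢'(Plane, ℂ) :=
  (derivative V).sum fun k c ↦ (c : ℂ) • powTerm φ k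

/-- `N(A, φ) = 2i A_μ ∂^μ φ + A_μ A^μ φ - φ V'(|φ|²) + φ`. -/
def nonlinN (V : ℝ[X]) (A : Fin 3 → ℤˣ → 𝓢'(Plane, ℂ)) (φ : ℤˣ → 𝓢'(Plane, ℂ)) :
    𝓢'(Plane, ℂ) :=
  (2 * Complex.I) • (∑ μ, prod (total (A μ)) (dUp μ φ)) +
    (∑ μ, metric μ • prod (total (A μ)) (prod (total (A μ)) (total φ))) -
    potentialTerm V φ + total φ

/-! ### Curves of distributions as space-time distributions -/

/-- The point `(t, x)` of space-time. -/
def pt (t : ℝ) (x : Plane) : Spacetime := WithLp.toLp 2 (t, x)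

theorem pt_isometry (t : ℝ) : Isometry (pt t) := by
  refine Isometry.of_dist_eq fun x y ↦ ?_
  simp [pt, WithLp.prod_dist_eq_of_L2, Real.sqrt_sq dist_nonneg]

theorem pt_hasTemperateGrowth (t : ℝ) : (pt t).HasTemperateGrowth := by
  have h : pt t = fun x ↦
      ((WithLp.prodContinuousLinearEquiv 2 ℝ ℝ Plane).symm.toContinuousLinearMap.comp
        (ContinuousLinearMap.inr ℝ ℝ Plane)) x + pt t 0 := by
    funext x
    simp [pt, ← WithLp.toLp_add]
  rw [h]
  fun_prop

/-- The restriction `x ↦ Φ (t, x)` of a Schwartz function to the time `t`. -/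
def slice (t : ℝ) : 𝓢(Spacetime, ℂ) →L[ℂ] 𝓢(Plane, ℂ) :=
  SchwartzMap.compCLMOfAntilipschitz ℂ (pt_hasTemperateGrowth t) (pt_isometry t).antilipschitz

theorem slice_apply (t : ℝ) (Φ : 𝓢(Spacetime, ℂ)) (x : Plane) : slice t Φ x = Φ (pt t x) := rfl

/-- `Φ` is a test function on the interior of `I × ℝ²`: smooth and compactly supported there. -/
def IsTest (I : Set ℝ) (Φ : 𝓢(Spacetime, ℂ)) : Prop :=
  HasCompactSupport Φ ∧ tsupport Φ ⊆ {z | z.fst ∈ interior I}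

/-- The curve `u`, as a distribution on `I × ℝ²`, applied to `Φ`. -/
def pair (I : Set ℝ) (u : ℝ → 𝓢'(Plane, ℂ)) (Φ : 𝓢(Spacetime, ℂ)) : ℂ :=
  ∫ t in I, u t (slice t Φ)

/-- `(i ∂_t ± ⟨∇⟩) u = F` in the sense of distributions on `I × ℝ²`. -/
def SolvesHalfWave (I : Set ℝ) (σ : ℤˣ) (u F : ℝ → 𝓢'(Plane, ℂ)) : Prop :=
  ∀ Φ : 𝓢(Spacetime, ℂ), IsTest I Φ →
    pair I u (-Complex.I • ∂_{pt 1 0} Φ) + sgn σ * pair I (fun t ↦ bessel 1 (u t)) Φ =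
      pair I F Φ

/-- The half-wave form of the Chern-Simons-Higgs system on `I × ℝ²`,
`(i ∂_t ± ⟨∇⟩) A_{μ,±} = ± (1/2) ⟨∇⟩⁻¹ M_μ(A, φ)` and
`(i ∂_t ± ⟨∇⟩) φ_± = ± (1/2) ⟨∇⟩⁻¹ N(A, φ)`, in the sense of distributions. -/
def SolvesCSH (I : Set ℝ) (V : ℝ[X]) (A : Fin 3 → ℤˣ → ℝ → 𝓢'(Plane, ℂ))
    (φ : ℤˣ → ℝ → 𝓢'(Plane, ℂ)) : Prop :=
  (∀ μ σ, SolvesHalfWave I σ (A μ σ) fun t ↦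
    (sgn σ / 2) • bessel (-1) (nonlinM (fun ν τ ↦ A ν τ t) (fun τ ↦ φ τ t) μ)) ∧
  (∀ σ, SolvesHalfWave I σ (φ σ) fun t ↦
    (sgn σ / 2) • bessel (-1) (nonlinN V (fun ν τ ↦ A ν τ t) (fun τ ↦ φ τ t)))

/-! ### The spaces `X_±^{s,b}` -/

/-- `⟨r⟩ = (1 + r²) ^ (1/2)`. -/
def bracket (r : ℝ) : ℝ := Real.sqrt (1 + r ^ 2)

/-- The weight `⟨ξ⟩ ^ s ⟨-τ ± |ξ|⟩ ^ b`, at the frequency `(2πτ, 2πξ)`. -/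
def xWeight (σ : ℤˣ) (s b : ℝ) (ζ : Spacetime) : ℝ :=
  bracket (2 * Real.pi * ‖ζ.snd‖) ^ s *
    bracket (-(2 * Real.pi * ζ.fst) + ((σ : ℤ) : ℝ) * (2 * Real.pi * ‖ζ.snd‖)) ^ b

/-- `v ∈ X_±^{s,b}`: the space-time Fourier transform of the tempered distribution `v` is a
function `h` with `⟨ξ⟩ ^ s ⟨-τ ± |ξ|⟩ ^ b h ∈ L²`. These are the elements of the completion of the
Schwartz space in the norm `‖⟨ξ⟩ ^ s ⟨-τ ± |ξ|⟩ ^ b h‖_{L²}`. -/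
def MemX (σ : ℤˣ) (s b : ℝ) (v : 𝓢'(Spacetime, ℂ)) : Prop :=
  ∃ h : Spacetime → ℂ, HasFourierFunction v h ∧
    MemLp (fun ζ ↦ (xWeight σ s b ζ : ℂ) * h ζ) 2

/-- `u ∈ X_±^{s,b}(I)`: some `v ∈ X_±^{s,b}` agrees with `u` on `I × ℝ²`. -/
def MemXOn (I : Set ℝ) (σ : ℤˣ) (s b : ℝ) (u : ℝ → 𝓢'(Plane, ℂ)) : Prop :=
  ∃ v : 𝓢'(Spacetime, ℂ), MemX σ s b v ∧
    ∀ Φ : 𝓢(Spacetime, ℂ), IsTest I Φ → v Φ = pair I u Φ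

end

end CSH

namespace CSH

/-! ### The weights `⟨ξ⟩ ^ s` -/

/-! The result is linear once the nonlinearities have been placed in Sobolev spaces. Suppose `(i∂_t
+ σ⟨∇⟩) u = F` on a bounded interval, with `u` bounded in `H ^ s₁`, `F` bounded in `H ^ s₀` and `s₀
≤ s₁`. Then `u` has an extension lying both in `X^{s₁,0}` and in `X^{s₀,1}`, hence in the
interpolated space with exponents `θ s₁ + (1 - θ) s₀` and `1 - θ` (`memXOn_of_solvesHalfWave`). For
`φ` one takes `s₁ = 1`, `s₀ = 1/2`; for `A` one takes `s₁ = 1/2`, `s₀ = -δ`.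

It remains to see that `N` is in `H ^ (-1/2)` and `M` in `H ^ (-1-δ)` (`fourierSobolev_nonlinN`,
`fourierSobolev_nonlinM`). Products are convolutions on the Fourier side, and by duality `H ^ a · H
^ b ⊂ H ^ (-c)` is an `L²` bound for a trilinear form, `TrilinBound a b c`. All cases come from two:
exponents `a, 0, c` with `a, c > 0` and `a + c = 1`, and `0, 0, c` with `c > 1`. The second one is
the source of `δ`: both terms of the null form are treated as products of two `L²` functions, and
its cancellation plays no role.

For the linear statement, undo the free evolution. The profile `exp (-iσt⟨∇⟩) u(t)` has time
derivative `-i exp (-iσt⟨∇⟩) F(t)`, so it is bounded in `H ^ s₁` and Lipschitz in `H ^ s₀`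
(`exists_norm_sub_le`). Such a curve extends to the whole line, with compact support in time, by
freezing it at the endpoints and cutting off (`exists_lipschitzCurve`). Restoring the evolution and
transforming in time turns the bound into `⟨ξ⟩ ^ s₁ ṽ ∈ L²` and the Lipschitz condition, through
difference quotients, into `⟨ξ⟩ ^ s₀ (-τ + σ⟨ξ⟩) ṽ ∈ L²` (`LipschitzCurve.exists_lp`). Replacing
`⟨ξ⟩` by `|ξ|` in the last weight changes it by at most `1`, and interpolation is a pointwise
inequality between weights.

The curves are handled throughout as functionals on Schwartz functions of frequency, so only scalar
calculus is needed in time. -/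

/-- The weight `⟨2πξ⟩ ^ s`. -/
noncomputable def wt (s : ℝ) (ξ : Plane) : ℝ := (1 + ‖(2 * Real.pi) • ξ‖ ^ 2) ^ (s / 2)

theorem besselSymbol_eq (s : ℝ) (ξ : Plane) : besselSymbol s ξ = (wt s ξ : ℂ) := rfl

theorem wt_pos (s : ℝ) (ξ : Plane) : 0 < wt s ξ := by
  unfold wt; positivity

theorem wt_add (s t : ℝ) (ξ : Plane) : wt (s + t) ξ = wt s ξ * wt t ξ := by
  unfold wt
  rw [← Real.rpow_add (by positivity)]
  ring_nf

theorem wt_zero (ξ : Plane) : wt 0 ξ = 1 := by simp [wt]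

theorem wt_neg_mul (s : ℝ) (ξ : Plane) : wt (-s) ξ * wt s ξ = 1 := by
  rw [← wt_add, neg_add_cancel, wt_zero]

theorem wt_mono {s t : ℝ} (h : s ≤ t) (ξ : Plane) : wt s ξ ≤ wt t ξ := by
  unfold wt
  apply Real.rpow_le_rpow_of_exponent_le
  · nlinarith [sq_nonneg ‖(2 * Real.pi) • ξ‖]
  · linarith

theorem wt_neg (s : ℝ) (ξ : Plane) : wt s (-ξ) = wt s ξ := by simp [wt]

theorem wt_sq (s : ℝ) (ξ : Plane) : wt s ξ ^ 2 = wt (2 * s) ξ := by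
  rw [sq, ← wt_add]; ring_nf

theorem wt_one_sq (ξ : Plane) : wt 1 ξ ^ 2 = 1 + ‖(2 * Real.pi) • ξ‖ ^ 2 := by
  rw [wt_sq, wt]; norm_num

theorem wt_rpow (s t : ℝ) (ξ : Plane) : wt s ξ ^ t = wt (s * t) ξ := by
  unfold wt
  rw [← Real.rpow_mul (by positivity)]
  ring_nf

theorem one_le_wt {s : ℝ} (hs : 0 ≤ s) (ξ : Plane) : 1 ≤ wt s ξ := by
  simpa [wt_zero] using wt_mono hs ξ

theorem wt_le_one {s : ℝ} (hs : s ≤ 0) (ξ : Plane) : wt s ξ ≤ 1 := by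
  simpa [wt_zero] using wt_mono hs ξ

theorem norm_le_wt_one (ξ : Plane) : 2 * Real.pi * ‖ξ‖ ≤ wt 1 ξ := by
  have h := wt_one_sq ξ
  have h1 : ‖(2 * Real.pi) • ξ‖ = 2 * Real.pi * ‖ξ‖ := by
    rw [norm_smul, Real.norm_of_nonneg (by positivity)]
  rw [h1] at h
  have := wt_pos 1 ξ
  have h2 : 0 ≤ 2 * Real.pi * ‖ξ‖ := by positivity
  nlinarith

theorem wt_one_le (ξ : Plane) : wt 1 ξ ≤ 1 + 2 * Real.pi * ‖ξ‖ := by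
  have h := wt_one_sq ξ
  have h1 : ‖(2 * Real.pi) • ξ‖ = 2 * Real.pi * ‖ξ‖ := by
    rw [norm_smul, Real.norm_of_nonneg (by positivity)]
  rw [h1] at h
  have := wt_pos 1 ξ
  have h2 : 0 ≤ 2 * Real.pi * ‖ξ‖ := by positivity
  nlinarith

theorem wt_continuous (s : ℝ) : Continuous (wt s) := by
  unfold wt
  refine Continuous.rpow_const (by fun_prop) fun ξ ↦ Or.inl ?_
  positivity

/-- `wt 1 ξ` is the Euclidean length of `(1, 2πξ)`. In the triangle inequality the first coordinate
doubles on the left, which only helps. -/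
theorem wt_one_sub_le (η ζ : Plane) : wt 1 (η + ζ) ≤ wt 1 η + wt 1 ζ := by
  have h1 := wt_one_sq η
  have h2 := wt_one_sq ζ
  have h3 := wt_one_sq (η + ζ)
  have p1 := wt_pos 1 η
  have p2 := wt_pos 1 ζ
  rw [smul_add] at h3
  have h4 := norm_add_le ((2 * Real.pi) • η) ((2 * Real.pi) • ζ)
  set x := ‖(2 * Real.pi) • η‖
  set y := ‖(2 * Real.pi) • ζ‖
  have hx : 0 ≤ x := norm_nonneg _
  have hy : 0 ≤ y := norm_nonneg _
  have hx' : x ≤ wt 1 η := by nlinarith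
  have hy' : y ≤ wt 1 ζ := by nlinarith
  have : wt 1 (η + ζ) ^ 2 ≤ (wt 1 η + wt 1 ζ) ^ 2 := by
    have hz : ‖(2 * Real.pi) • η + (2 * Real.pi) • ζ‖ ^ 2 ≤ (x + y) ^ 2 := by gcongr
    nlinarith [mul_le_mul hx' hy' hy p1.le]
  exact (sq_le_sq₀ (wt_pos _ _).le (by positivity)).1 this

/-- Peetre's inequality in additive form. -/
theorem wt_add_le {s : ℝ} (hs : 0 ≤ s) (η ζ : Plane) :
    wt s (η + ζ) ≤ 2 ^ s * (wt s η + wt s ζ) := by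
  have hr : ∀ ξ, wt s ξ = wt 1 ξ ^ s := fun ξ ↦ by rw [wt_rpow, one_mul]
  have h1 := wt_one_sub_le η ζ
  have p1 := wt_pos 1 η
  have p2 := wt_pos 1 ζ
  have h2 : wt 1 (η + ζ) ≤ 2 * max (wt 1 η) (wt 1 ζ) := by
    linarith [le_max_left (wt 1 η) (wt 1 ζ), le_max_right (wt 1 η) (wt 1 ζ)]
  calc wt s (η + ζ) ≤ (2 * max (wt 1 η) (wt 1 ζ)) ^ s := by
        rw [hr]
        exact Real.rpow_le_rpow (wt_pos _ _).le h2 hs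
    _ = 2 ^ s * max (wt 1 η) (wt 1 ζ) ^ s := Real.mul_rpow (by norm_num) (by positivity)
    _ ≤ 2 ^ s * (wt s η + wt s ζ) := by
        gcongr
        rw [hr, hr]
        rcases max_cases (wt 1 η) (wt 1 ζ) with ⟨h, -⟩ | ⟨h, -⟩ <;> rw [h]
        · linarith [Real.rpow_nonneg p2.le s]
        · linarith [Real.rpow_nonneg p1.le s]

/-! ### Multiplication operators on `L²` -/

section Multiplication

variable {X : Type*} [MeasurableSpace X] {μ : Measure X}

theorem memLp_top_of_norm_le {b : X → ℂ} (hb : Measurable b) {C : ℝ} (hC : ∀ x, ‖b x‖ ≤ C) :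
    MemLp b ⊤ μ :=
  memLp_top_of_bound hb.aestronglyMeasurable C (ae_of_all _ hC)

/-- Multiplication by a bounded measurable function, as an operator on `L²`. -/
noncomputable def mulL {b : X → ℂ} (hb : MemLp b ⊤ μ) : Lp ℂ 2 μ →L[ℂ] Lp ℂ 2 μ :=
  (ContinuousLinearMap.mul ℂ ℂ).holderL μ ⊤ 2 2 hb.toLp

theorem mulL_ae {b : X → ℂ} (hb : MemLp b ⊤ μ) (f : Lp ℂ 2 μ) :
    mulL hb f =ᵐ[μ] fun x ↦ b x * f x := by
  have h := (ContinuousLinearMap.mul ℂ ℂ).coeFn_holder (r := 2) hb.toLp f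
  filter_upwards [h, hb.coeFn_toLp] with x hx hy
  have : (mulL hb f) x = ((ContinuousLinearMap.mul ℂ ℂ).holder 2 hb.toLp f) x := rfl
  rw [this, hx, hy]
  rfl

end Multiplication

/-! ### Distributions whose Fourier transform is a function -/

section FourierFunction

variable {E : Type*} [NormedAddCommGroup E] [InnerProductSpace ℝ E]
  [FiniteDimensional ℝ E] [MeasurableSpace E] [BorelSpace E]

theorem HasFourierFunction.congr {u : 𝓢'(E, ℂ)} {h h' : E → ℂ} (hu : HasFourierFunction u h)
    (e : h =ᵐ[volume] h') : HasFourierFunction u h' := by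
  intro χ
  have e' : (fun ξ ↦ h ξ * χ ξ) =ᵐ[volume] fun ξ ↦ h' ξ * χ ξ := by
    filter_upwards [e] with ξ hξ
    rw [hξ]
  exact ⟨(hu χ).1.congr e', by rw [(hu χ).2, integral_congr_ae e']⟩

theorem HasFourierFunction.add {u v : 𝓢'(E, ℂ)} {f g : E → ℂ} (hu : HasFourierFunction u f)
    (hv : HasFourierFunction v g) : HasFourierFunction (u + v) fun ξ ↦ f ξ + g ξ := by
  intro χ
  have e : (fun ξ ↦ (f ξ + g ξ) * χ ξ) = fun ξ ↦ f ξ * χ ξ + g ξ * χ ξ := by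
    funext ξ; ring
  refine ⟨by rw [e]; exact (hu χ).1.add (hv χ).1, ?_⟩
  rw [e, integral_add (hu χ).1 (hv χ).1, ← (hu χ).2, ← (hv χ).2, FourierTransform.fourier_add]
  rfl

theorem HasFourierFunction.smul {u : 𝓢'(E, ℂ)} {f : E → ℂ} (hu : HasFourierFunction u f) (c : ℂ) :
    HasFourierFunction (c • u) fun ξ ↦ c * f ξ := by
  intro χ
  have e : (fun ξ ↦ (c * f ξ) * χ ξ) = fun ξ ↦ c * (f ξ * χ ξ) := by
    funext ξ; ring
  refine ⟨by rw [e]; exact (hu χ).1.const_mul c, ?_⟩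
  rw [e, integral_const_mul, ← (hu χ).2, FourierTransform.fourier_smul]
  rfl

/-- Stated through `𝓕 v` rather than through an operator, so that it serves both Fourier multipliers
and derivatives. -/
theorem HasFourierFunction.smulLeft {u v : 𝓢'(E, ℂ)} {f a : E → ℂ} (ha : a.HasTemperateGrowth)
    (hv : 𝓕 v = TemperedDistribution.smulLeftCLM ℂ a (𝓕 u)) (hu : HasFourierFunction u f) :
    HasFourierFunction v fun ξ ↦ a ξ * f ξ := by
  intro χ
  have h := hu (SchwartzMap.smulLeftCLM ℂ a χ)
  have e : (fun ξ ↦ f ξ * SchwartzMap.smulLeftCLM ℂ a χ ξ) = fun ξ ↦ a ξ * f ξ * χ ξ := by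
    funext ξ
    rw [SchwartzMap.smulLeftCLM_apply_apply ha, smul_eq_mul]
    ring
  rw [e] at h
  exact ⟨h.1, by rw [hv, TemperedDistribution.smulLeftCLM_apply_apply, h.2]⟩

theorem HasFourierFunction.multiplier {u : 𝓢'(E, ℂ)} {f a : E → ℂ} (ha : a.HasTemperateGrowth)
    (hu : HasFourierFunction u f) :
    HasFourierFunction (TemperedDistribution.fourierMultiplierCLM ℂ a u) fun ξ ↦ a ξ * f ξ :=
  hu.smulLeft ha (by
    rw [TemperedDistribution.fourierMultiplierCLM_apply]
    exact FourierTransform.fourier_fourierInv_eq _)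

theorem integrable_lp_mul_schwartz (G : Lp ℂ 2 (volume : Measure E)) (χ : 𝓢(E, ℂ)) :
    Integrable fun ξ ↦ G ξ * χ ξ :=
  (Lp.memLp G).integrable_mul (χ.memLp 2 volume)

theorem hasFourierFunction_of_fourier_eq {u : 𝓢'(E, ℂ)} {G : Lp ℂ 2 (volume : Measure E)}
    (h : 𝓕 u = (G : 𝓢'(E, ℂ))) : HasFourierFunction u G := by
  intro χ
  refine ⟨integrable_lp_mul_schwartz G χ, ?_⟩
  rw [h, Lp.toTemperedDistribution_apply]
  simp [mul_comm]

theorem HasFourierFunction.apply_eq {u : 𝓢'(E, ℂ)} {f : E → ℂ} (hu : HasFourierFunction u f)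
    (χ : 𝓢(E, ℂ)) : u χ = ∫ ξ, f ξ * (𝓕⁻ χ) ξ := by
  rw [← (hu _).2, TemperedDistribution.fourier_apply, FourierTransform.fourier_fourierInv_eq]

end FourierFunction

theorem HasFourierFunction.bessel {u : 𝓢'(Plane, ℂ)} {f : Plane → ℂ}
    (hu : HasFourierFunction u f) (s : ℝ) :
    HasFourierFunction (CSH.bessel s u) fun ξ ↦ besselSymbol s ξ * f ξ :=
  hu.multiplier (besselSymbol_hasTemperateGrowth s)

theorem HasFourierFunction.dSpace {u : 𝓢'(Plane, ℂ)} {f : Plane → ℂ}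
    (hu : HasFourierFunction u f) (j : Fin 2) :
    HasFourierFunction (CSH.dSpace j u) fun ξ ↦ (2 * Real.pi * Complex.I * (ξ j : ℂ)) * f ξ := by
  have ht : (fun ξ : Plane ↦ inner ℝ ξ (EuclideanSpace.single j (1 : ℝ))).HasTemperateGrowth := by
    fun_prop
  have ht2 : (fun ξ : Plane ↦
      ((inner ℝ ξ (EuclideanSpace.single j (1 : ℝ)) : ℝ) : ℂ)).HasTemperateGrowth :=
    (by fun_prop : (fun r : ℝ ↦ (r : ℂ)).HasTemperateGrowth).comp ht
  have ht3 : (fun ξ : Plane ↦ (2 * Real.pi * Complex.I : ℂ) •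
      ((inner ℝ ξ (EuclideanSpace.single j (1 : ℝ)) : ℝ) : ℂ)).HasTemperateGrowth := by
    fun_prop
  have h := hu.smulLeft (v := CSH.dSpace j u) ht3 (by
    rw [CSH.dSpace, TemperedDistribution.fourier_lineDerivOp_eq]
    have := TemperedDistribution.smulLeftCLM_smul (F := ℂ) ht2 (2 * Real.pi * Complex.I)
    erw [this]
    rfl)
  refine h.congr (ae_of_all _ fun ξ ↦ ?_)
  simp [EuclideanSpace.inner_single_right]

theorem HasFourierFunction.conj {u : 𝓢'(Plane, ℂ)} {f : Plane → ℂ}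
    (hu : HasFourierFunction u f) :
    HasFourierFunction (CSH.conj u) fun ξ ↦ (starRingEnd ℂ) (f (-ξ)) := by
  intro χ
  let ρ : 𝓢(Plane, ℂ) := SchwartzMap.compCLMOfContinuousLinearEquiv ℂ
    (ContinuousLinearEquiv.neg ℝ : Plane ≃L[ℝ] Plane) (conjSchwartz χ)
  have hρ : ∀ ξ, ρ ξ = (starRingEnd ℂ) (χ (-ξ)) := fun ξ ↦ rfl
  -- Conjugation turns the phase into its inverse, which a reflection of the frequency restores.
  have hF : conjSchwartz (𝓕 χ) = 𝓕 ρ := by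
    ext x
    rw [conjSchwartz_apply, SchwartzMap.fourier_coe, SchwartzMap.fourier_coe, Real.fourier_eq,
      Real.fourier_eq, ← integral_conj, ← integral_neg_eq_self]
    refine integral_congr_ae (ae_of_all _ fun v ↦ ?_)
    simp only [hρ, Circle.smul_def, smul_eq_mul, map_mul]
    congr 1
    rw [← Circle.coe_inv_eq_conj, ← AddChar.map_neg_eq_inv]
    simp
  have h := hu ρ
  have e : (fun ξ ↦ (starRingEnd ℂ) (f (-ξ)) * χ ξ) =
      fun ξ ↦ (fun ζ ↦ (starRingEnd ℂ) (f ζ * ρ ζ)) (-ξ) := by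
    funext ξ
    simp [hρ]
  rw [e]
  refine ⟨((Complex.conjCLE : ℂ →L[ℝ] ℂ).integrable_comp h.1).comp_neg, ?_⟩
  rw [integral_neg_eq_self (fun ζ ↦ (starRingEnd ℂ) (f ζ * ρ ζ)), integral_conj, ← h.2,
    TemperedDistribution.fourier_apply, conj_apply, hF, TemperedDistribution.fourier_apply]

/-! ### Curves in Sobolev spaces on the Fourier side -/

/-- `u ∈ C(I; H ^ s)`, expressed through the Fourier transform of `u`. -/
def FourierSobolev (I : Set ℝ) (s : ℝ) (u : ℝ → 𝓢'(Plane, ℂ)) : Prop :=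
  ∃ G : ℝ → Lp ℂ 2 (volume : Measure Plane),
    (∀ t ∈ I, HasFourierFunction (u t) fun ξ ↦ besselSymbol (-s) ξ * G t ξ) ∧
    ContinuousOn G I ∧ ∃ C : ℝ, ∀ t ∈ I, ‖G t‖ ≤ C

theorem besselSymbol_neg_mul (s : ℝ) (ξ : Plane) :
    besselSymbol (-s) ξ * besselSymbol s ξ = 1 := by
  rw [besselSymbol_eq, besselSymbol_eq, ← Complex.ofReal_mul, wt_neg_mul, Complex.ofReal_one]

theorem besselSymbol_add (s t : ℝ) (ξ : Plane) :
    besselSymbol (s + t) ξ = besselSymbol s ξ * besselSymbol t ξ := by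
  rw [besselSymbol_eq, besselSymbol_eq, besselSymbol_eq, ← Complex.ofReal_mul, wt_add]

theorem bessel_neg_bessel (s : ℝ) (u : 𝓢'(Plane, ℂ)) : bessel (-s) (bessel s u) = u := by
  rw [bessel, bessel, TemperedDistribution.fourierMultiplierCLM_fourierMultiplierCLM_apply
    (besselSymbol_hasTemperateGrowth s) (besselSymbol_hasTemperateGrowth (-s))]
  have : besselSymbol s * besselSymbol (-s) = fun _ ↦ (1 : ℂ) := by
    funext ξ
    rw [Pi.mul_apply, mul_comm, besselSymbol_neg_mul]
  rw [this, TemperedDistribution.fourierMultiplierCLM_const]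
  simp

theorem ContinuousSobolev.fourierSobolev {I : Set ℝ} {s : ℝ} {u : ℝ → 𝓢'(Plane, ℂ)}
    (h : ContinuousSobolev I s u) : FourierSobolev I s u := by
  obtain ⟨g, hg, hc, C, hC⟩ := h
  refine ⟨fun t ↦ 𝓕 (g t), fun t ht ↦ ?_, ?_, C, fun t ht ↦ ?_⟩
  · rw [← bessel_neg_bessel s (u t)]
    refine HasFourierFunction.bessel ?_ (-s)
    rw [hg t ht]
    exact hasFourierFunction_of_fourier_eq (Lp.fourier_toTemperedDistribution_eq _)
  · exact (FourierTransform.fourierCLM ℂ (Lp ℂ 2 (volume : Measure Plane))).continuous.comp_continuousOn hc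
  · rw [Lp.norm_fourier_eq]
    exact hC t ht

namespace FourierSobolev

variable {I : Set ℝ} {s r : ℝ} {u v : ℝ → 𝓢'(Plane, ℂ)}

theorem mono_set {J : Set ℝ} (h : FourierSobolev I s u) (hJ : J ⊆ I) : FourierSobolev J s u := by
  obtain ⟨G, hG, hc, C, hC⟩ := h
  exact ⟨G, fun t ht ↦ hG t (hJ ht), hc.mono hJ, C, fun t ht ↦ hC t (hJ ht)⟩

theorem add (hu : FourierSobolev I s u) (hv : FourierSobolev I s v) :
    FourierSobolev I s fun t ↦ u t + v t := by
  obtain ⟨G, hG, hc, C, hC⟩ := hu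
  obtain ⟨G', hG', hc', C', hC'⟩ := hv
  refine ⟨fun t ↦ G t + G' t, fun t ht ↦ ?_, hc.add hc', C + C', fun t ht ↦
    (norm_add_le _ _).trans (add_le_add (hC t ht) (hC' t ht))⟩
  refine ((hG t ht).add (hG' t ht)).congr ?_
  filter_upwards [Lp.coeFn_add (G t) (G' t)] with ξ hξ
  rw [hξ, Pi.add_apply]
  ring

/-- Fourier multipliers that are dominated by `⟨ξ⟩ ^ (s - r)` map `C(I; H ^ s)` to
`C(I; H ^ r)`. -/
theorem multiplier (hu : FourierSobolev I s u) {a : Plane → ℂ} (ha : Continuous a) {C : ℝ}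
    (hC : ∀ ξ, ‖a ξ‖ ≤ C * wt (s - r) ξ)
    (hv : ∀ t ∈ I, ∀ h, HasFourierFunction (u t) h → HasFourierFunction (v t) fun ξ ↦ a ξ * h ξ) :
    FourierSobolev I r v := by
  obtain ⟨G, hG, hc, D, hD⟩ := hu
  -- Once the weights are stripped off, the operator acts on the `L²` profile `G` as multiplication
  -- by this bounded symbol. Continuity in time then follows from boundedness of one operator on
  -- `L²`.
  have hb : ∀ ξ, ‖besselSymbol (r - s) ξ * a ξ‖ ≤ C := by
    intro ξ
    have h0 := wt_pos (r - s) ξ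
    rw [norm_mul, besselSymbol_eq, Complex.norm_real, Real.norm_of_nonneg h0.le]
    calc wt (r - s) ξ * ‖a ξ‖ ≤ wt (r - s) ξ * (C * wt (s - r) ξ) := by
          gcongr
          exact hC ξ
      _ = C * (wt (-(s - r)) ξ * wt (s - r) ξ) := by rw [neg_sub]; ring
      _ = C := by rw [wt_neg_mul, mul_one]
  have hm : Measurable fun ξ ↦ besselSymbol (r - s) ξ * a ξ :=
    ((besselSymbol_hasTemperateGrowth _).1.continuous.mul ha).measurable
  let B := mulL (μ := (volume : Measure Plane)) (memLp_top_of_norm_le hm hb)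
  refine ⟨fun t ↦ B (G t), fun t ht ↦ ?_, B.continuous.comp_continuousOn hc,
    ‖B‖ * D, fun t ht ↦ (B.le_opNorm _).trans (by gcongr; exact hD t ht)⟩
  refine (hv t ht _ (hG t ht)).congr ?_
  filter_upwards [mulL_ae (memLp_top_of_norm_le hm hb) (G t)] with ξ hξ
  rw [hξ]
  have : besselSymbol (-s) ξ = besselSymbol (-r) ξ * besselSymbol (r - s) ξ := by
    rw [← besselSymbol_add]; ring_nf
  rw [this]
  ring

theorem smul (hu : FourierSobolev I s u) (c : ℂ) : FourierSobolev I s fun t ↦ c • u t :=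
  hu.multiplier (a := fun _ ↦ c) continuous_const (C := ‖c‖)
    (fun ξ ↦ by rw [sub_self, wt_zero, mul_one]) fun _ _ _ h ↦ h.smul c

theorem mono (hu : FourierSobolev I s u) (h : r ≤ s) : FourierSobolev I r u :=
  hu.multiplier (a := fun _ ↦ 1) continuous_const (C := 1)
    (fun ξ ↦ by simpa using one_le_wt (sub_nonneg.2 h) ξ) fun _ _ _ h ↦ by simpa using h

theorem bessel (hu : FourierSobolev I s u) (a : ℝ) (h : r + a = s) :
    FourierSobolev I r fun t ↦ CSH.bessel a (u t) :=
  hu.multiplier (a := besselSymbol a) (besselSymbol_hasTemperateGrowth a).1.continuous (C := 1)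
    (fun ξ ↦ by
      rw [besselSymbol_eq, Complex.norm_real, Real.norm_of_nonneg (wt_pos _ _).le, one_mul, ← h,
        add_sub_cancel_left]) fun _ _ _ h ↦ h.bessel a

theorem dSpace (hu : FourierSobolev I s u) (j : Fin 2) (h : r + 1 = s) :
    FourierSobolev I r fun t ↦ CSH.dSpace j (u t) :=
  hu.multiplier (a := fun ξ ↦ 2 * Real.pi * Complex.I * (ξ j : ℂ)) (by fun_prop) (C := 1)
    (fun ξ ↦ by
      have h1 : ‖ξ j‖ ≤ ‖ξ‖ := PiLp.norm_apply_le ξ j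
      have h2 := norm_le_wt_one ξ
      rw [← h, add_sub_cancel_left, one_mul]
      refine le_trans ?_ h2
      simp only [norm_mul, Complex.norm_real, Complex.norm_I, Complex.norm_ofNat, mul_one,
        Real.norm_of_nonneg Real.pi_pos.le]
      gcongr) fun _ _ _ h ↦ h.dSpace j

theorem neg (hu : FourierSobolev I s u) : FourierSobolev I s fun t ↦ -u t := by
  have h := hu.smul (-1)
  have e : ∀ t, (-1 : ℂ) • u t = -u t := fun t ↦ by
    ext χ
    change (-1 : ℂ) * u t χ = -(u t χ)
    ring
  simpa only [e] using h

theorem sub (hu : FourierSobolev I s u) (hv : FourierSobolev I s v) :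
    FourierSobolev I s fun t ↦ u t - v t := by
  simpa [sub_eq_add_neg] using hu.add hv.neg

theorem zero : FourierSobolev I s fun _ ↦ 0 := by
  refine ⟨fun _ ↦ 0, fun t _ χ ↦ ?_, continuousOn_const, 0, fun t _ ↦ by simp⟩
  have e : (fun ξ ↦ besselSymbol (-s) ξ * (0 : Lp ℂ 2 (volume : Measure Plane)) ξ * χ ξ)
      =ᵐ[volume] fun _ ↦ 0 := by
    filter_upwards with ξ
    simp
  refine ⟨(integrable_zero _ _ _).congr e.symm, ?_⟩
  rw [integral_congr_ae e, integral_zero, TemperedDistribution.fourier_apply]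
  rfl

theorem sum {ι : Type*} (S : Finset ι) {u : ι → ℝ → 𝓢'(Plane, ℂ)}
    (hu : ∀ i ∈ S, FourierSobolev I s (u i)) : FourierSobolev I s fun t ↦ ∑ i ∈ S, u i t := by
  classical
  induction S using Finset.induction_on with
  | empty => simpa using zero
  | insert i S hi ih =>
    simp only [Finset.sum_insert hi]
    exact (hu i (by simp)).add (ih fun j hj ↦ hu j (by simp [hj]))

theorem conj (hu : FourierSobolev I s u) : FourierSobolev I s fun t ↦ CSH.conj (u t) := by
  obtain ⟨G, hG, hc, C, hC⟩ := hu
  let R : Lp ℂ 2 (volume : Measure Plane) →ₗᵢ[ℝ] Lp ℂ 2 (volume : Measure Plane) :=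
    Lp.compMeasurePreservingₗᵢ ℝ (fun ξ : Plane ↦ -ξ) (Measure.measurePreserving_neg _)
  let K : Lp ℂ 2 (volume : Measure Plane) →L[ℝ] Lp ℂ 2 (volume : Measure Plane) :=
    ContinuousLinearMap.compLpL 2 volume (Complex.conjCLE : ℂ →L[ℝ] ℂ)
  -- Only real linear, because of the conjugation; this is enough for continuity and boundedness.
  let B := K.comp R.toContinuousLinearMap
  refine ⟨fun t ↦ B (G t), fun t ht ↦ ?_, B.continuous.comp_continuousOn hc,
    ‖B‖ * C, fun t ht ↦ (B.le_opNorm _).trans (by gcongr; exact hC t ht)⟩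
  refine (hG t ht).conj.congr ?_
  have h1 : K (R (G t)) =ᵐ[volume] fun ξ ↦ (starRingEnd ℂ) (R (G t) ξ) :=
    ContinuousLinearMap.coeFn_compLpL _ _
  have h2 : R (G t) =ᵐ[volume] (G t) ∘ fun ξ : Plane ↦ -ξ :=
    Lp.coeFn_compMeasurePreserving _ (Measure.measurePreserving_neg _)
  filter_upwards [h1, h2] with ξ e1 e2
  have : B (G t) ξ = K (R (G t)) ξ := rfl
  rw [this, e1, e2, map_mul, besselSymbol_eq, besselSymbol_eq, wt_neg, Complex.conj_ofReal]
  rfl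

theorem imPart (hu : FourierSobolev I s u) : FourierSobolev I s fun t ↦ CSH.imPart (u t) :=
  (hu.sub hu.conj).smul _

end FourierSobolev

open scoped ENNReal

/-! ### Trilinear convolution estimates -/

/-- The weight `⟨2πξ⟩ ^ s` as an extended nonnegative number. -/
noncomputable def ewt (s : ℝ) (ξ : Plane) : ℝ≥0∞ := ENNReal.ofReal (wt s ξ)

theorem ewt_add (s t : ℝ) (ξ : Plane) : ewt (s + t) ξ = ewt s ξ * ewt t ξ := by
  rw [ewt, wt_add, ENNReal.ofReal_mul (wt_pos _ _).le]; rfl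

theorem ewt_zero (ξ : Plane) : ewt 0 ξ = 1 := by simp [ewt, wt_zero]

theorem ewt_mono {s t : ℝ} (h : s ≤ t) (ξ : Plane) : ewt s ξ ≤ ewt t ξ :=
  ENNReal.ofReal_le_ofReal (wt_mono h ξ)

theorem ewt_neg (s : ℝ) (ξ : Plane) : ewt s (-ξ) = ewt s ξ := by rw [ewt, wt_neg, ewt]

theorem ewt_measurable (s : ℝ) : Measurable (ewt s) :=
  ENNReal.measurable_ofReal.comp (wt_continuous s).measurable

theorem ewt_rpow_two (s : ℝ) (ξ : Plane) : ewt s ξ ^ (2 : ℝ) = ewt (2 * s) ξ := by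
  rw [ENNReal.rpow_two, sq, ← ewt_add]; ring_nf

theorem ewt_le_of_norm_le {s : ℝ} (hs : 0 ≤ s) {ξ η : Plane} (h : ‖ξ‖ ≤ ‖η‖) :
    ewt s ξ ≤ ewt s η := by
  refine ENNReal.ofReal_le_ofReal ?_
  unfold wt
  rw [norm_smul, norm_smul]
  gcongr

/-- The `L²` norm of a nonnegative function. -/
noncomputable def nrm {X : Type*} [MeasurableSpace X] (μ : Measure X) (f : X → ℝ≥0∞) : ℝ≥0∞ :=
  (∫⁻ x, f x ^ (2 : ℝ) ∂μ) ^ (1 / 2 : ℝ)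

theorem lintegral_mul_le_nrm {X : Type*} [MeasurableSpace X] (μ : Measure X) {f g : X → ℝ≥0∞}
    (hf : AEMeasurable f μ) (hg : AEMeasurable g μ) :
    ∫⁻ x, f x * g x ∂μ ≤ nrm μ f * nrm μ g :=
  ENNReal.lintegral_mul_le_Lp_mul_Lq μ ⟨by norm_num, by norm_num, by norm_num⟩ hf hg

theorem nrm_mono {X : Type*} [MeasurableSpace X] {μ : Measure X} {f g : X → ℝ≥0∞}
    (h : ∀ x, f x ≤ g x) : nrm μ f ≤ nrm μ g := by
  unfold nrm
  gcongr
  exact h _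

theorem nrm_comp_neg (f : Plane → ℝ≥0∞) : nrm volume (fun x ↦ f (-x)) = nrm volume f := by
  unfold nrm
  rw [lintegral_neg_eq_self (fun x ↦ f x ^ (2 : ℝ))]

theorem nrm_comp_sub_left (f : Plane → ℝ≥0∞) (ξ : Plane) :
    nrm volume (fun x ↦ f (ξ - x)) = nrm volume f := by
  unfold nrm
  rw [lintegral_sub_left_eq_self (fun x ↦ f x ^ (2 : ℝ))]

/-- The trilinear form `∫∫ ⟨η⟩ ^ (-a) f(η) ⟨ξ - η⟩ ^ (-b) g(ξ - η) ⟨ξ⟩ ^ (-c) h(ξ)`. -/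
noncomputable def trilin (a b c : ℝ) (f g h : Plane → ℝ≥0∞) : ℝ≥0∞ :=
  ∫⁻ ξ, ∫⁻ η, (ewt (-a) η * f η) * (ewt (-b) (ξ - η) * g (ξ - η)) * (ewt (-c) ξ * h ξ)

/-- The trilinear form with exponents `a, b, c` is bounded on `L²`. -/
def TrilinBound (a b c : ℝ) : Prop :=
  ∃ C : ℝ≥0∞, C ≠ ⊤ ∧ ∀ f g h : Plane → ℝ≥0∞, Measurable f → Measurable g → Measurable h →
    trilin a b c f g h ≤ C * (nrm volume f * nrm volume g * nrm volume h)

/-- Substitution `η ↦ ξ - η`. Together with the exchange of `η` and `ξ`, which reflects `g` and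
leaves the even weights alone, it makes `TrilinBound` symmetric in its three exponents. -/
theorem trilin_swap_left (a b c : ℝ) (f g h : Plane → ℝ≥0∞) :
    trilin b a c g f h = trilin a b c f g h := by
  unfold trilin
  refine lintegral_congr fun ξ ↦ ?_
  rw [← lintegral_sub_left_eq_self _ ξ]
  refine lintegral_congr fun η ↦ ?_
  rw [sub_sub_cancel]
  ring

theorem trilin_swap_outer {a b c : ℝ} {f g h : Plane → ℝ≥0∞} (hf : Measurable f)
    (hg : Measurable g) (hh : Measurable h) :
    trilin c b a h (fun x ↦ g (-x)) f = trilin a b c f g h := by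
  unfold trilin
  rw [lintegral_lintegral_swap]
  · refine lintegral_congr fun ξ ↦ lintegral_congr fun η ↦ ?_
    have e1 : ewt (-b) (η - ξ) = ewt (-b) (ξ - η) := by rw [← ewt_neg, neg_sub]
    have e2 : (fun x ↦ g (-x)) (η - ξ) = g (ξ - η) := by simp only [neg_sub]
    rw [e1, e2]
    ring
  · have h1 := ewt_measurable (-a)
    have h2 := ewt_measurable (-b)
    have h3 := ewt_measurable (-c)
    unfold Function.uncurry
    fun_prop

namespace TrilinBound

variable {a b c d : ℝ}

theorem swap_left (h : TrilinBound a b c) : TrilinBound b a c := by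
  obtain ⟨C, hC, H⟩ := h
  refine ⟨C, hC, fun f g h hf hg hh ↦ ?_⟩
  rw [trilin_swap_left]
  exact (H g f h hg hf hh).trans_eq (by ring)

theorem swap_outer (h : TrilinBound a b c) : TrilinBound c b a := by
  obtain ⟨C, hC, H⟩ := h
  refine ⟨C, hC, fun f g h hf hg hh ↦ ?_⟩
  rw [← trilin_swap_outer hf hg hh]
  refine (H _ _ _ hh (hg.comp measurable_neg) hf).trans_eq ?_
  rw [show g ∘ Neg.neg = fun x ↦ g (-x) from rfl, nrm_comp_neg]
  ring

theorem mono {a' b' c' : ℝ} (h : TrilinBound a b c) (ha : a ≤ a') (hb : b ≤ b') (hc : c ≤ c') :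
    TrilinBound a' b' c' := by
  obtain ⟨C, hC, H⟩ := h
  refine ⟨C, hC, fun f g h hf hg hh ↦ le_trans ?_ (H f g h hf hg hh)⟩
  unfold trilin
  gcongr
  · exact ewt_mono (by linarith) _
  · exact ewt_mono (by linarith) _
  · exact ewt_mono (by linarith) _

/-- A positive power of `⟨ξ⟩` is distributed over the two factors. -/
theorem split (hc : 0 ≤ c) (h1 : TrilinBound (a - c) b d) (h2 : TrilinBound a (b - c) d) :
    TrilinBound a b (d - c) := by
  obtain ⟨C, hC, H⟩ := h1
  obtain ⟨C', hC', H'⟩ := h2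
  refine ⟨ENNReal.ofReal (2 ^ c) * (C + C'), by finiteness, fun f g h hf hg hh ↦ ?_⟩
  -- Peetre's inequality moves the factor `⟨ξ⟩ ^ c` onto `η` or onto `ξ - η`; each of the two
  -- resulting forms is bounded by assumption.
  have key : trilin a b (d - c) f g h ≤
      ENNReal.ofReal (2 ^ c) * (trilin (a - c) b d f g h + trilin a (b - c) d f g h) := by
    have m1 := ewt_measurable
    unfold trilin
    rw [← lintegral_add_left, ← lintegral_const_mul]
    · refine lintegral_mono fun ξ ↦ ?_
      rw [← lintegral_add_left, ← lintegral_const_mul]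
      · refine lintegral_mono fun η ↦ ?_
        have e1 : ewt (-(d - c)) ξ = ewt (-d) ξ * ewt c ξ := by rw [← ewt_add]; ring_nf
        have e2 : ewt (-(a - c)) η = ewt (-a) η * ewt c η := by rw [← ewt_add]; ring_nf
        have e3 : ewt (-(b - c)) (ξ - η) = ewt (-b) (ξ - η) * ewt c (ξ - η) := by
          rw [← ewt_add]; ring_nf
        have e4 : ewt c ξ ≤ ENNReal.ofReal (2 ^ c) * (ewt c η + ewt c (ξ - η)) := by
          unfold ewt
          rw [← ENNReal.ofReal_add (wt_pos _ _).le (wt_pos _ _).le,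
            ← ENNReal.ofReal_mul (by positivity)]
          apply ENNReal.ofReal_le_ofReal
          simpa using wt_add_le hc η (ξ - η)
        rw [e1, e2, e3]
        calc _ ≤ ewt (-a) η * f η * (ewt (-b) (ξ - η) * g (ξ - η)) *
              (ewt (-d) ξ * (ENNReal.ofReal (2 ^ c) * (ewt c η + ewt c (ξ - η))) * h ξ) := by
              gcongr
          _ = _ := by ring
      all_goals fun_prop
    · fun_prop
    · have := hf; have := hg; have := hh
      fun_prop
  refine key.trans ?_
  calc _ ≤ ENNReal.ofReal (2 ^ c) * (C * (nrm volume f * nrm volume g * nrm volume h) +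
        C' * (nrm volume f * nrm volume g * nrm volume h)) := by
        gcongr
        · exact H f g h hf hg hh
        · exact H' f g h hf hg hh
    _ = _ := by ring

end TrilinBound

/-- In polar coordinates the Jacobian `y` of the plane turns `y ^ (-(1 + c))` into `y ^ (-c)`, which
is integrable at `0` because `c < 1`. -/
theorem integral_Ioi_mul_indicator_rpow {c R : ℝ} (hc : c < 1) (hR : 0 ≤ R) :
    IntegrableOn (fun y : ℝ ↦ y ^ (Module.finrank ℝ Plane - 1) •
      (Set.Iic R).indicator (fun y ↦ y ^ (-(1 + c))) y) (Set.Ioi 0) ∧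
    ∫ y in Set.Ioi (0 : ℝ), y ^ (Module.finrank ℝ Plane - 1) •
      (Set.Iic R).indicator (fun y ↦ y ^ (-(1 + c))) y = R ^ (1 - c) / (1 - c) := by
  have hd : Module.finrank ℝ Plane - 1 = 1 := by simp
  have e : Set.EqOn (fun y : ℝ ↦ y ^ (Module.finrank ℝ Plane - 1) •
      (Set.Iic R).indicator (fun y ↦ y ^ (-(1 + c))) y)
      ((Set.Iic R).indicator fun y ↦ y ^ (-c)) (Set.Ioi 0) := by
    intro y hy
    have hy : 0 < y := hy
    simp only [hd, pow_one, smul_eq_mul]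
    by_cases h : y ∈ Set.Iic R
    · rw [Set.indicator_of_mem h, Set.indicator_of_mem h]
      nth_rewrite 1 [← Real.rpow_one y]
      rw [← Real.rpow_add hy]
      ring_nf
    · rw [Set.indicator_of_notMem h, Set.indicator_of_notMem h, mul_zero]
  have hi : IntervalIntegrable (fun y : ℝ ↦ y ^ (-c)) volume 0 R :=
    intervalIntegral.intervalIntegrable_rpow' (by linarith)
  have hI : Set.Ioi (0 : ℝ) ∩ Set.Iic R = Set.Ioc 0 R := Set.Ioi_inter_Iic
  constructor
  · rw [integrableOn_congr_fun e measurableSet_Ioi, IntegrableOn,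
      integrable_indicator_iff measurableSet_Iic, IntegrableOn,
      Measure.restrict_restrict measurableSet_Iic, Set.inter_comm, hI]
    exact (intervalIntegrable_iff_integrableOn_Ioc_of_le hR).1 hi
  · rw [setIntegral_congr_fun measurableSet_Ioi e, setIntegral_indicator measurableSet_Iic, hI,
      ← intervalIntegral.integral_of_le hR, integral_rpow (Or.inl (by linarith))]
    rw [show -c + 1 = 1 - c by ring, Real.zero_rpow (by linarith), sub_zero]

/-- Comparison of the weight with the homogeneous power `‖ξ‖ ^ (-(1 + c))`, whose integral over a
disc is computed radially. The homogeneous bound suffices for small `η` as well, since `1 - c > 0`.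
-/
theorem lintegral_ewt_le {c : ℝ} (h0 : 0 < c) (h1 : c < 1) :
    ∃ C : ℝ≥0∞, C ≠ ⊤ ∧ ∀ η : Plane,
      ∫⁻ ξ, {ξ : Plane | ‖ξ‖ ≤ ‖η‖}.indicator (ewt (-(1 + c))) ξ ≤ C * ewt (1 - c) η := by
  set K : ℝ := 2 * (volume : Measure Plane).real (Metric.ball 0 1) / (1 - c) with hK
  have hK0 : 0 ≤ K := by
    have : 0 < 1 - c := by linarith
    positivity
  refine ⟨ENNReal.ofReal K, by finiteness, fun η ↦ ?_⟩
  have hR := norm_nonneg η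
  obtain ⟨i1, i2⟩ := integral_Ioi_mul_indicator_rpow h1 hR
  have j1 := (integrable_fun_norm_addHaar (volume : Measure Plane)).2 i1
  have j2 := integral_fun_norm_addHaar (volume : Measure Plane)
    ((Set.Iic ‖η‖).indicator fun y : ℝ ↦ y ^ (-(1 + c)))
  rw [i2] at j2
  have hpi : 1 ≤ 2 * Real.pi := by linarith [Real.pi_gt_three]
  calc ∫⁻ ξ, {ξ : Plane | ‖ξ‖ ≤ ‖η‖}.indicator (ewt (-(1 + c))) ξ
      ≤ ∫⁻ ξ : Plane, ENNReal.ofReal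
          ((Set.Iic ‖η‖).indicator (fun y : ℝ ↦ y ^ (-(1 + c))) ‖ξ‖) := by
        refine lintegral_mono_ae ?_
        have : ∀ᵐ ξ : Plane, ξ ≠ 0 := by simp [ae_iff]
        filter_upwards [this] with ξ hξ
        by_cases h : ‖ξ‖ ≤ ‖η‖
        · rw [Set.indicator_of_mem (by exact h), Set.indicator_of_mem (by exact h)]
          apply ENNReal.ofReal_le_ofReal
          have hp : 0 < ‖ξ‖ := norm_pos_iff.2 hξ
          have e : wt (-(1 + c)) ξ = wt 1 ξ ^ (-(1 + c)) := by rw [wt_rpow, one_mul]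
          rw [e]
          refine Real.rpow_le_rpow_of_nonpos hp ?_ (by linarith)
          exact le_trans (by nlinarith) (norm_le_wt_one ξ)
        · rw [Set.indicator_of_notMem (by exact h)]
          exact zero_le
    _ = ENNReal.ofReal (∫ ξ : Plane,
          (Set.Iic ‖η‖).indicator (fun y : ℝ ↦ y ^ (-(1 + c))) ‖ξ‖) := by
        rw [ofReal_integral_eq_lintegral_ofReal j1]
        filter_upwards with ξ
        exact Set.indicator_apply_nonneg fun _ ↦ Real.rpow_nonneg (norm_nonneg _) _
    _ ≤ ENNReal.ofReal K * ewt (1 - c) η := by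
        rw [j2, ewt, ← ENNReal.ofReal_mul hK0]
        apply ENNReal.ofReal_le_ofReal
        have e : wt (1 - c) η = wt 1 η ^ (1 - c) := by rw [wt_rpow, one_mul]
        have : ‖η‖ ^ (1 - c) ≤ wt (1 - c) η := by
          rw [e]
          refine Real.rpow_le_rpow hR ?_ (by linarith)
          exact le_trans (by nlinarith) (norm_le_wt_one η)
        have hd : Module.finrank ℝ Plane = 2 := by simp
        rw [hd, hK]
        simp only [smul_eq_mul, nsmul_eq_mul]
        calc _ = 2 * (volume : Measure Plane).real (Metric.ball 0 1) / (1 - c) *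
              ‖η‖ ^ (1 - c) := by push_cast; ring
          _ ≤ _ := by gcongr

/-- The part `|ξ| ≤ |η|` of the endpoint estimate. -/
theorem trilin_region_le {a c : ℝ} (ha : 0 < a) (hc : 0 < c) (hac : a + c = 1) :
    ∃ C : ℝ≥0∞, C ≠ ⊤ ∧ ∀ f g h : Plane → ℝ≥0∞, Measurable f → Measurable g → Measurable h →
      ∫⁻ ξ, ∫⁻ η, {p : Plane × Plane | ‖p.1‖ ≤ ‖p.2‖}.indicator
        (fun p ↦ (ewt (-a) p.2 * f p.2) * g (p.1 - p.2) * (ewt (-c) p.1 * h p.1)) (ξ, η) ≤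
      C * (nrm volume f * nrm volume g * nrm volume h) := by
  obtain ⟨K, hK, HK⟩ := lintegral_ewt_le hc (by linarith)
  refine ⟨K ^ (1 / 2 : ℝ), by finiteness, fun f g h hf hg hh ↦ ?_⟩
  set S : Set (Plane × Plane) := {p | ‖p.1‖ ≤ ‖p.2‖} with hS
  have mS : MeasurableSet S := measurableSet_le (by fun_prop) (by fun_prop)
  have mw := ewt_measurable
  -- Cauchy-Schwarz on the region with `f` in one factor and `g`, `h` in the other. The weights are
  -- split so that integrating `P ^ 2` over `‖ξ‖ ≤ ‖η‖` produces exactly `⟨η⟩ ^ (1 - c) = ⟨η⟩ ^ a`,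
  -- while the weight left in `Q` is at most `1` there. The powers of `⟨ξ⟩` recombine to `-c`
  -- because `a + c = 1`.
  let P : Plane × Plane → ℝ≥0∞ := S.indicator fun p ↦
    f p.2 * ewt (-a / 2) p.2 * ewt (-(1 + c) / 2) p.1
  let Q : Plane × Plane → ℝ≥0∞ := S.indicator fun p ↦
    h p.1 * g (p.1 - p.2) * (ewt (a / 2) p.1 * ewt (-a / 2) p.2)
  have mP : Measurable P := Measurable.indicator (by fun_prop) mS
  have mQ : Measurable Q := Measurable.indicator (by fun_prop) mS
  have e1 : ∫⁻ ξ, ∫⁻ η, S.indicator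
      (fun p ↦ (ewt (-a) p.2 * f p.2) * g (p.1 - p.2) * (ewt (-c) p.1 * h p.1)) (ξ, η) =
      ∫⁻ p, P p * Q p ∂((volume : Measure Plane).prod volume) := by
    rw [lintegral_prod _ (by fun_prop)]
    refine lintegral_congr fun ξ ↦ lintegral_congr fun η ↦ ?_
    by_cases hp : (ξ, η) ∈ S
    · simp only [P, Q, Set.indicator_of_mem hp]
      have w1 : ewt (-a) η = ewt (-a / 2) η * ewt (-a / 2) η := by rw [← ewt_add]; ring_nf
      have w2 : ewt (-c) ξ = ewt (-(1 + c) / 2) ξ * ewt (a / 2) ξ := by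
        rw [← ewt_add]; congr 1; linarith
      rw [w1, w2]
      ring
    · simp only [P, Q, Set.indicator_of_notMem hp, mul_zero]
  have h2 : ∀ x y : ℝ≥0∞, (x * y) ^ (2 : ℝ) = x ^ (2 : ℝ) * y ^ (2 : ℝ) :=
    fun x y ↦ ENNReal.mul_rpow_of_nonneg x y (by norm_num)
  have bP : nrm (volume.prod volume) P ≤ K ^ (1 / 2 : ℝ) * nrm volume f := by
    unfold nrm
    rw [← ENNReal.mul_rpow_of_nonneg _ _ (by norm_num)]
    refine ENNReal.rpow_le_rpow ?_ (by norm_num)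
    rw [lintegral_prod_symm _ (by fun_prop), ← lintegral_const_mul _ (by fun_prop)]
    refine lintegral_mono fun η ↦ ?_
    have e : ∀ ξ, P (ξ, η) ^ (2 : ℝ) = f η ^ (2 : ℝ) * ewt (-a) η *
        {ξ : Plane | ‖ξ‖ ≤ ‖η‖}.indicator (ewt (-(1 + c))) ξ := by
      intro ξ
      by_cases hp : ‖ξ‖ ≤ ‖η‖
      · have hp' : (ξ, η) ∈ S := hp
        simp only [P, Set.indicator_of_mem hp']
        rw [Set.indicator_of_mem (by exact hp), h2, h2, ewt_rpow_two, ewt_rpow_two]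
        ring_nf
      · have hp' : (ξ, η) ∉ S := hp
        simp only [P, Set.indicator_of_notMem hp']
        rw [Set.indicator_of_notMem (by exact hp)]
        simp
    simp_rw [e]
    rw [lintegral_const_mul _ ((mw _).indicator (measurableSet_le (by fun_prop) (by fun_prop)))]
    calc _ ≤ f η ^ (2 : ℝ) * ewt (-a) η * (K * ewt (1 - c) η) := by
          gcongr
          exact HK η
      _ = K * f η ^ (2 : ℝ) * (ewt (-a) η * ewt (1 - c) η) := by ring
      _ = _ := by
          rw [← ewt_add, show -a + (1 - c) = 0 by linarith, ewt_zero, mul_one]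
  have bQ : nrm (volume.prod volume) Q ≤ nrm volume g * nrm volume h := by
    unfold nrm
    rw [← ENNReal.mul_rpow_of_nonneg _ _ (by norm_num)]
    refine ENNReal.rpow_le_rpow ?_ (by norm_num)
    rw [lintegral_prod _ (by fun_prop), ← lintegral_const_mul _ (by fun_prop)]
    refine lintegral_mono fun ξ ↦ ?_
    have e : ∀ η, Q (ξ, η) ^ (2 : ℝ) ≤ h ξ ^ (2 : ℝ) * g (ξ - η) ^ (2 : ℝ) := by
      intro η
      by_cases hp : ‖ξ‖ ≤ ‖η‖
      · have hp' : (ξ, η) ∈ S := hp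
        simp only [Q, Set.indicator_of_mem hp']
        rw [h2, h2, h2, ewt_rpow_two, ewt_rpow_two]
        have : ewt (2 * (a / 2)) ξ * ewt (2 * (-a / 2)) η ≤ 1 := by
          calc _ ≤ ewt (2 * (a / 2)) η * ewt (2 * (-a / 2)) η := by
                gcongr
                exact ewt_le_of_norm_le (by linarith) hp
            _ = 1 := by rw [← ewt_add, show 2 * (a / 2) + 2 * (-a / 2) = 0 by ring, ewt_zero]
        calc _ ≤ h ξ ^ (2 : ℝ) * g (ξ - η) ^ (2 : ℝ) * 1 := by gcongr
          _ = _ := mul_one _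
      · have hp' : (ξ, η) ∉ S := hp
        simp only [Q, Set.indicator_of_notMem hp']
        simp
    calc _ ≤ ∫⁻ η, h ξ ^ (2 : ℝ) * g (ξ - η) ^ (2 : ℝ) := lintegral_mono e
      _ = _ := by
          rw [lintegral_const_mul _ (by fun_prop),
            lintegral_sub_left_eq_self (fun x ↦ g x ^ (2 : ℝ)), mul_comm]
  rw [e1]
  calc _ ≤ nrm (volume.prod volume) P * nrm (volume.prod volume) Q :=
        lintegral_mul_le_nrm _ mP.aemeasurable mQ.aemeasurable
    _ ≤ (K ^ (1 / 2 : ℝ) * nrm volume f) * (nrm volume g * nrm volume h) := by gcongr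
    _ = _ := by ring

/-- The endpoint estimate with two positive exponents. -/
theorem TrilinBound.endpoint {a c : ℝ} (ha : 0 < a) (hc : 0 < c) (hac : a + c = 1) :
    TrilinBound a 0 c := by
  obtain ⟨C, hC, H⟩ := trilin_region_le ha hc hac
  obtain ⟨C', hC', H'⟩ := trilin_region_le hc ha (by linarith)
  refine ⟨C + C', by finiteness, fun f g h hf hg hh ↦ ?_⟩
  have mw := ewt_measurable
  have mS : MeasurableSet {p : Plane × Plane | ‖p.1‖ ≤ ‖p.2‖} :=
    measurableSet_le (by fun_prop) (by fun_prop)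
  let F : Plane × Plane → ℝ≥0∞ := {p : Plane × Plane | ‖p.1‖ ≤ ‖p.2‖}.indicator
    (fun p ↦ (ewt (-a) p.2 * f p.2) * g (p.1 - p.2) * (ewt (-c) p.1 * h p.1))
  let G : Plane × Plane → ℝ≥0∞ := {p : Plane × Plane | ‖p.1‖ ≤ ‖p.2‖}.indicator
    (fun p ↦ (ewt (-c) p.2 * h p.2) * g (-(p.1 - p.2)) * (ewt (-a) p.1 * f p.1))
  have mF : Measurable F := Measurable.indicator (by fun_prop) mS
  have mG : Measurable G := Measurable.indicator (by fun_prop) mS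
  -- The complementary region `‖η‖ ≤ ‖ξ‖` is the first one after exchanging `(f, a)` with `(h, c)`
  -- and reflecting `g`.
  have key : trilin a 0 c f g h ≤ (∫⁻ ξ, ∫⁻ η, F (ξ, η)) + ∫⁻ η, ∫⁻ ξ, G (η, ξ) := by
    rw [lintegral_lintegral_swap (f := fun η ξ ↦ G (η, ξ)) (by fun_prop), trilin,
      ← lintegral_add_left (by fun_prop)]
    refine lintegral_mono fun ξ ↦ ?_
    rw [← lintegral_add_left (by fun_prop)]
    refine lintegral_mono fun η ↦ ?_
    rw [neg_zero, ewt_zero, one_mul]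
    rcases le_total ‖ξ‖ ‖η‖ with hp | hp
    · refine le_trans ?_ (le_add_of_nonneg_right zero_le)
      simp only [F]
      rw [Set.indicator_of_mem (by exact hp)]
    · refine le_trans ?_ (le_add_of_nonneg_left zero_le)
      simp only [G]
      rw [Set.indicator_of_mem (by exact hp), neg_sub]
      exact le_of_eq (by ring)
  refine key.trans ?_
  have h1 := H f g h hf hg hh
  have h2 := H' h (fun x ↦ g (-x)) f hh (hg.comp measurable_neg) hf
  rw [nrm_comp_neg] at h2
  calc _ ≤ C * (nrm volume f * nrm volume g * nrm volume h) +
        C' * (nrm volume h * nrm volume g * nrm volume f) := add_le_add h1 h2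
    _ = _ := by ring

/-- The square of the weight decays with exponent `2c`, which exceeds the dimension `2`. -/
theorem nrm_ewt_ne_top {c : ℝ} (hc : 1 < c) : nrm volume (ewt (-c)) ≠ ⊤ := by
  unfold nrm
  refine ENNReal.rpow_ne_top_of_nonneg (by norm_num) ?_
  simp_rw [ewt_rpow_two]
  have hd : Module.finrank ℝ Plane = 2 := by simp
  have h1 : Integrable (fun x : Plane ↦ ((1 : ℝ) + ‖x‖ ^ 2) ^ (-(2 * c) / 2)) :=
    integrable_rpow_neg_one_add_norm_sq (by rw [hd]; push_cast; linarith)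
  have h2 := h1.comp_smul (R := (2 * Real.pi)) (by positivity)
  have h3 : (fun x : Plane ↦ ((1 : ℝ) + ‖(2 * Real.pi) • x‖ ^ 2) ^ (-(2 * c) / 2)) =
      wt (2 * -c) := by
    funext x
    rw [wt]
    ring_nf
  rw [h3] at h2
  exact h2.lintegral_lt_top.ne

/-- The estimate `L² · L² ⊂ L¹ ⊂ H ^ (-c)`. -/
theorem TrilinBound.of_one_lt {c : ℝ} (hc : 1 < c) : TrilinBound 0 0 c := by
  refine ⟨nrm volume (ewt (-c)), nrm_ewt_ne_top hc, fun f g h hf hg hh ↦ ?_⟩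
  have mw := ewt_measurable
  unfold trilin
  simp only [neg_zero, ewt_zero, one_mul]
  calc _ ≤ ∫⁻ ξ, nrm volume f * nrm volume g * (ewt (-c) ξ * h ξ) := by
        refine lintegral_mono fun ξ ↦ ?_
        rw [lintegral_mul_const _ (by fun_prop)]
        gcongr
        refine (lintegral_mul_le_nrm _ hf.aemeasurable (by fun_prop)).trans_eq ?_
        rw [nrm_comp_sub_left]
    _ = nrm volume f * nrm volume g * ∫⁻ ξ, (ewt (-c) ξ * h ξ) :=
        lintegral_const_mul _ (by fun_prop)
    _ ≤ nrm volume f * nrm volume g * (nrm volume (ewt (-c)) * nrm volume h) := by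
        gcongr
        exact lintegral_mul_le_nrm _ (mw _).aemeasurable hh.aemeasurable
    _ = _ := by ring

/-! ### Products in Sobolev spaces -/

/-- The converse of the Cauchy-Schwarz inequality. -/
theorem nrm_le_of_forall_lintegral_mul_le {J : Plane → ℝ≥0∞} (hJ : Measurable J) {D : ℝ≥0∞}
    (h : ∀ g : Plane → ℝ≥0∞, Measurable g → ∫⁻ ξ, J ξ * g ξ ≤ D * nrm volume g) :
    nrm volume J ≤ D := by
  -- The natural test function is `J` itself, but its norm may be infinite and could then not be
  -- cancelled. Truncation in size and space makes it finite, and Fatou's lemma removes the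
  -- truncation.
  let g : ℕ → Plane → ℝ≥0∞ := fun n ↦ (Metric.ball 0 (n : ℝ)).indicator fun ξ ↦ min (J ξ) n
  have mg : ∀ n, Measurable (g n) := fun n ↦
    (hJ.min measurable_const).indicator Metric.isOpen_ball.measurableSet
  have hgJ : ∀ n ξ, g n ξ ≤ J ξ := fun n ξ ↦
    Set.indicator_apply_le' (fun _ ↦ min_le_left _ _) fun _ ↦ zero_le
  have bound : ∀ n, ∫⁻ ξ, g n ξ ^ (2 : ℝ) ≤ D ^ (2 : ℝ) := by
    intro n
    set A := ∫⁻ ξ, g n ξ ^ (2 : ℝ) with hA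
    have fin : A ≠ ⊤ := by
      have : A ≤ ∫⁻ ξ, (Metric.ball (0 : Plane) (n : ℝ)).indicator (fun _ ↦ (n : ℝ≥0∞) ^ (2 : ℝ)) ξ := by
        refine lintegral_mono fun ξ ↦ ?_
        by_cases hξ : ξ ∈ Metric.ball (0 : Plane) (n : ℝ)
        · simp only [g, Set.indicator_of_mem hξ]
          gcongr
          exact min_le_right _ _
        · simp [g, Set.indicator_of_notMem hξ]
      refine ne_top_of_le_ne_top ?_ this
      rw [lintegral_indicator_const Metric.isOpen_ball.measurableSet]
      exact ENNReal.mul_ne_top (by finiteness) measure_ball_lt_top.ne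
    have h1 : A ≤ D * A ^ (1 / 2 : ℝ) := by
      refine le_trans ?_ (h (g n) (mg n))
      refine lintegral_mono fun ξ ↦ ?_
      rw [ENNReal.rpow_two, sq]
      gcongr
      exact hgJ n ξ
    by_cases hA0 : A = 0
    · rw [hA0]; exact zero_le
    have hs0 : A ^ (1 / 2 : ℝ) ≠ 0 := by simp [hA0]
    have hst : A ^ (1 / 2 : ℝ) ≠ ⊤ := by finiteness
    have e : A = A ^ (1 / 2 : ℝ) * A ^ (1 / 2 : ℝ) := by
      rw [← ENNReal.rpow_add _ _ hA0 fin]; norm_num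
    have h1' : A ^ (1 / 2 : ℝ) * A ^ (1 / 2 : ℝ) ≤ D * A ^ (1 / 2 : ℝ) := by rwa [← e]
    have h2 : A ^ (1 / 2 : ℝ) ≤ D := (ENNReal.mul_le_mul_iff_left hs0 hst).1 h1'
    calc A = (A ^ (1 / 2 : ℝ)) ^ (2 : ℝ) := by rw [← ENNReal.rpow_mul]; norm_num
      _ ≤ D ^ (2 : ℝ) := ENNReal.rpow_le_rpow h2 (by norm_num)
  have lim : ∀ ξ, Filter.Tendsto (fun n ↦ g n ξ ^ (2 : ℝ)) Filter.atTop (nhds (J ξ ^ (2 : ℝ))) := by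
    intro ξ
    have h1 : Filter.Tendsto (fun n : ℕ ↦ min (J ξ) (n : ℝ≥0∞)) Filter.atTop (nhds (min (J ξ) ⊤)) :=
      tendsto_const_nhds.min ENNReal.tendsto_nat_nhds_top
    rw [min_top_right] at h1
    have h2 : Filter.Tendsto (fun n ↦ g n ξ) Filter.atTop (nhds (J ξ)) := by
      refine h1.congr' ?_
      obtain ⟨N, hN⟩ := exists_nat_gt ‖ξ‖
      filter_upwards [Filter.eventually_ge_atTop N] with n hn
      have : ξ ∈ Metric.ball (0 : Plane) (n : ℝ) := by
        rw [mem_ball_zero_iff]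
        exact hN.trans_le (by exact_mod_cast hn)
      simp only [g, Set.indicator_of_mem this]
    exact (ENNReal.continuous_rpow_const.tendsto _).comp h2
  have h3 : ∫⁻ ξ, J ξ ^ (2 : ℝ) ≤ D ^ (2 : ℝ) := by
    calc _ = ∫⁻ ξ, Filter.liminf (fun n ↦ g n ξ ^ (2 : ℝ)) Filter.atTop :=
          lintegral_congr fun ξ ↦ (lim ξ).liminf_eq.symm
      _ ≤ Filter.liminf (fun n ↦ ∫⁻ ξ, g n ξ ^ (2 : ℝ)) Filter.atTop :=
          lintegral_liminf_le fun n ↦ (mg n).pow_const _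
      _ ≤ Filter.liminf (fun _ : ℕ ↦ D ^ (2 : ℝ)) Filter.atTop :=
          Filter.liminf_le_liminf (Filter.Eventually.of_forall bound)
      _ = D ^ (2 : ℝ) := Filter.liminf_const _
  calc nrm volume J ≤ (D ^ (2 : ℝ)) ^ (1 / 2 : ℝ) := ENNReal.rpow_le_rpow h3 (by norm_num)
    _ = D := by rw [← ENNReal.rpow_mul]; norm_num

theorem eLpNorm_two_eq_nrm {X : Type*} [MeasurableSpace X] {μ : Measure X} (f : X → ℂ) :
    eLpNorm f 2 μ = nrm μ fun x ↦ ‖f x‖ₑ := by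
  rw [eLpNorm_eq_lintegral_rpow_enorm_toReal (by norm_num) (by norm_num)]
  simp [nrm]

/-! ### Weighted convolution as a bounded bilinear operator on `L²` -/

/-- The integrand of the convolution of `⟨η⟩ ^ (-a) f` and `⟨η⟩ ^ (-b) g`. -/
noncomputable def convKernel (a b : ℝ) (f g : Plane → ℂ) (ξ η : Plane) : ℂ :=
  (besselSymbol (-a) η * f η) * (besselSymbol (-b) (ξ - η) * g (ξ - η))

/-- The weighted convolution `⟨ξ⟩ ^ c ((⟨·⟩ ^ (-a) f) * (⟨·⟩ ^ (-b) g))`. -/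
noncomputable def wconv (a b c : ℝ) (f g : Plane → ℂ) (ξ : Plane) : ℂ :=
  besselSymbol c ξ * ∫ η, convKernel a b f g ξ η

variable {a b c : ℝ}

theorem convKernel_swap (f g : Plane → ℂ) (ξ η : Plane) :
    convKernel a b f g ξ (ξ - η) = convKernel b a g f ξ η := by
  rw [convKernel, convKernel, sub_sub_cancel]
  ring

theorem wconv_swap (f g : Plane → ℂ) : wconv a b c f g = wconv b a c g f := by
  funext ξ
  rw [wconv, wconv, ← integral_sub_left_eq_self _ volume ξ]
  simp_rw [convKernel_swap]

theorem convKernel_congr_left {f f' : Plane → ℂ} (g : Plane → ℂ) (h : f =ᵐ[volume] f') (ξ : Plane) :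
    convKernel a b f g ξ =ᵐ[volume] convKernel a b f' g ξ := by
  filter_upwards [h] with η hη
  rw [convKernel, convKernel, hη]

theorem wconv_congr_left {f f' : Plane → ℂ} (g : Plane → ℂ) (h : f =ᵐ[volume] f') :
    wconv a b c f g = wconv a b c f' g := by
  funext ξ
  rw [wconv, wconv, integral_congr_ae (convKernel_congr_left g h ξ)]

theorem wconv_smul_left (z : ℂ) (f g : Plane → ℂ) (ξ : Plane) :
    wconv a b c (fun η ↦ z * f η) g ξ = z * wconv a b c f g ξ := by
  have : (fun η ↦ convKernel a b (fun η ↦ z * f η) g ξ η) =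
      fun η ↦ z * convKernel a b f g ξ η := by
    funext η; simp only [convKernel]; ring
  rw [wconv, this, integral_const_mul, wconv]
  ring

theorem enorm_besselSymbol (s : ℝ) (ξ : Plane) : ‖besselSymbol s ξ‖ₑ = ewt s ξ := by
  rw [besselSymbol_eq, ← ofReal_norm, Complex.norm_real,
    Real.norm_of_nonneg (wt_pos _ _).le, ewt]

theorem convKernel_measurable {f g : Plane → ℂ} (hf : Measurable f) (hg : Measurable g) :
    Measurable (Function.uncurry (convKernel a b f g)) := by
  have h : ∀ s, Measurable (besselSymbol s) := fun s ↦
    (besselSymbol_hasTemperateGrowth s).1.continuous.measurable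
  unfold convKernel Function.uncurry
  fun_prop

theorem lintegral_convKernel_mul {f g : Plane → ℂ} (hf : Measurable f) (hg : Measurable g)
    (h : Plane → ℝ≥0∞) :
    ∫⁻ ξ, (ewt c ξ * ∫⁻ η, ‖convKernel a b f g ξ η‖ₑ) * h ξ =
      trilin a b (-c) (fun η ↦ ‖f η‖ₑ) (fun η ↦ ‖g η‖ₑ) h := by
  unfold trilin
  refine lintegral_congr fun ξ ↦ ?_
  have mξ : Measurable fun η ↦ ‖convKernel a b f g ξ η‖ₑ :=
    ((convKernel_measurable hf hg).comp (measurable_prodMk_left (x := ξ))).enorm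
  have e : (ewt c ξ * ∫⁻ η, ‖convKernel a b f g ξ η‖ₑ) * h ξ =
      (∫⁻ η, ‖convKernel a b f g ξ η‖ₑ) * (ewt c ξ * h ξ) := by
    ring
  rw [neg_neg, e, ← lintegral_mul_const _ mξ]
  refine lintegral_congr fun η ↦ ?_
  rw [convKernel, enorm_mul, enorm_mul, enorm_mul, enorm_besselSymbol, enorm_besselSymbol]

theorem nrm_lintegral_convKernel_le (H : TrilinBound a b (-c)) :
    ∃ C : ℝ≥0∞, C ≠ ⊤ ∧ ∀ f g : Plane → ℂ, Measurable f → Measurable g →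
      nrm volume (fun ξ ↦ ewt c ξ * ∫⁻ η, ‖convKernel a b f g ξ η‖ₑ) ≤
        C * (eLpNorm f 2 volume * eLpNorm g 2 volume) := by
  obtain ⟨C, hC, H⟩ := H
  refine ⟨C, hC, fun f g hf hg ↦ ?_⟩
  have m1 : Measurable fun p : Plane × Plane ↦ ‖convKernel a b f g p.1 p.2‖ₑ :=
    (convKernel_measurable hf hg).enorm
  have mJ : Measurable fun ξ ↦ ewt c ξ * ∫⁻ η, ‖convKernel a b f g ξ η‖ₑ :=
    (ewt_measurable c).mul m1.lintegral_prod_right'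
  refine nrm_le_of_forall_lintegral_mul_le mJ fun h hh ↦ ?_
  have h1 := H _ _ h hf.enorm hg.enorm hh
  rw [lintegral_convKernel_mul hf hg, eLpNorm_two_eq_nrm f, eLpNorm_two_eq_nrm g, mul_assoc]
  exact h1

/-- The trilinear bound controls the convolution of absolute values, which is therefore finite
almost everywhere. This is the absolute convergence demanded by `IsProduct`. -/
theorem convKernel_integrable (H : TrilinBound a b (-c)) (f g : Lp ℂ 2 (volume : Measure Plane)) :
    ∀ᵐ ξ, Integrable (convKernel a b f g ξ) := by
  obtain ⟨C, hC, H⟩ := nrm_lintegral_convKernel_le H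
  have mf := (Lp.stronglyMeasurable f).measurable
  have mg := (Lp.stronglyMeasurable g).measurable
  have h := H f g mf mg
  have m1 : Measurable fun p : Plane × Plane ↦ ‖convKernel a b f g p.1 p.2‖ₑ :=
    (convKernel_measurable mf mg).enorm
  have mJ : Measurable fun ξ ↦ ∫⁻ η, ‖convKernel a b f g ξ η‖ₑ := m1.lintegral_prod_right'
  have hfin : nrm volume (fun ξ ↦ ewt c ξ * ∫⁻ η, ‖convKernel a b f g ξ η‖ₑ) ≠ ⊤ :=
    ne_top_of_le_ne_top
      (ENNReal.mul_ne_top hC (ENNReal.mul_ne_top (Lp.memLp f).2.ne (Lp.memLp g).2.ne)) h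
  have h2 : ∫⁻ ξ, (ewt c ξ * ∫⁻ η, ‖convKernel a b f g ξ η‖ₑ) ^ (2 : ℝ) ≠ ⊤ := by
    intro h3
    rw [nrm, h3] at hfin
    exact hfin (ENNReal.top_rpow_of_pos (by norm_num))
  have h4 := ae_lt_top (((ewt_measurable c).mul mJ).pow_const _) h2
  filter_upwards [h4] with ξ hξ
  refine ⟨((convKernel_measurable mf mg).comp measurable_prodMk_left).aestronglyMeasurable, ?_⟩
  by_contra hcon
  have h5 : ∫⁻ η, ‖convKernel a b f g ξ η‖ₑ = ⊤ := not_lt_top_iff.1 hcon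
  have h6 : ewt c ξ ≠ 0 := by simp [ewt, wt_pos]
  simp [h5, h6] at hξ

theorem wconv_memLp (H : TrilinBound a b (-c)) : ∃ C : ℝ, 0 ≤ C ∧
    ∀ f g : Lp ℂ 2 (volume : Measure Plane), ∃ h : MemLp (wconv a b c f g) 2 volume,
      ‖h.toLp‖ ≤ C * ‖f‖ * ‖g‖ := by
  obtain ⟨C, hC, H⟩ := nrm_lintegral_convKernel_le H
  refine ⟨C.toReal, ENNReal.toReal_nonneg, fun f g ↦ ?_⟩
  have mf := (Lp.stronglyMeasurable f).measurable
  have mg := (Lp.stronglyMeasurable g).measurable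
  have h := H f g mf mg
  have hm : AEStronglyMeasurable (wconv a b c f g) volume := by
    have h1 : StronglyMeasurable fun ξ ↦ ∫ η, convKernel a b f g ξ η :=
      (convKernel_measurable mf mg).stronglyMeasurable.integral_prod_right
    exact ((besselSymbol_hasTemperateGrowth c).1.continuous.stronglyMeasurable.mul
      h1).aestronglyMeasurable
  have hle : eLpNorm (wconv a b c f g) 2 volume ≤
      C * (eLpNorm f 2 volume * eLpNorm g 2 volume) := by
    rw [eLpNorm_two_eq_nrm (wconv a b c f g)]
    refine le_trans (nrm_mono fun ξ ↦ ?_) h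
    rw [wconv, enorm_mul, enorm_besselSymbol]
    gcongr
    exact enorm_integral_le_lintegral_enorm _
  have hfin : C * (eLpNorm f 2 volume * eLpNorm g 2 volume) ≠ ⊤ :=
    ENNReal.mul_ne_top hC (ENNReal.mul_ne_top (Lp.memLp f).2.ne (Lp.memLp g).2.ne)
  have hmem : MemLp (wconv a b c f g) 2 volume := ⟨hm, hle.trans_lt hfin.lt_top⟩
  refine ⟨hmem, ?_⟩
  rw [Lp.norm_toLp, Lp.norm_def, Lp.norm_def, mul_assoc, ← ENNReal.toReal_mul,
    ← ENNReal.toReal_mul]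
  exact ENNReal.toReal_mono hfin hle

/-- Only almost everywhere: splitting the integral requires both convolutions to converge at `ξ`.
Homogeneity, in contrast, needs no convergence. -/
theorem wconv_add_left (H : TrilinBound a b (-c)) (f f' g : Lp ℂ 2 (volume : Measure Plane)) :
    wconv a b c (f + f' : Lp ℂ 2 (volume : Measure Plane)) g =ᵐ[volume]
      fun ξ ↦ wconv a b c f g ξ + wconv a b c f' g ξ := by
  rw [wconv_congr_left (g : Plane → ℂ) (Lp.coeFn_add f f')]
  filter_upwards [convKernel_integrable H f g, convKernel_integrable H f' g] with ξ h1 h2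
  have : (fun η ↦ convKernel a b (f + f' : Plane → ℂ) g ξ η) =
      fun η ↦ convKernel a b f g ξ η + convKernel a b f' g ξ η := by
    funext η; simp only [convKernel, Pi.add_apply]; ring
  rw [wconv, this, integral_add h1 h2, wconv, wconv]
  ring

theorem wconv_lp_smul_left (z : ℂ) (f g : Lp ℂ 2 (volume : Measure Plane)) :
    wconv a b c (z • f : Lp ℂ 2 (volume : Measure Plane)) g =
      fun ξ ↦ z * wconv a b c f g ξ := by
  rw [wconv_congr_left (g : Plane → ℂ) (Lp.coeFn_smul z f)]
  funext ξ
  exact wconv_smul_left z _ _ ξ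

/-- The product `H ^ a × H ^ b → H ^ c`, on the Fourier side and without the weights. -/
theorem exists_wconv_clm (H : TrilinBound a b (-c)) :
    ∃ B : Lp ℂ 2 (volume : Measure Plane) →L[ℂ] Lp ℂ 2 (volume : Measure Plane) →L[ℂ]
      Lp ℂ 2 (volume : Measure Plane), ∀ f g, B f g =ᵐ[volume] wconv a b c f g := by
  obtain ⟨C, hC, HC⟩ := wconv_memLp H
  choose hm hb using HC
  have H' := H.swap_left
  let B₀ : Lp ℂ 2 (volume : Measure Plane) →ₗ[ℂ] Lp ℂ 2 (volume : Measure Plane) →ₗ[ℂ]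
      Lp ℂ 2 (volume : Measure Plane) := LinearMap.mk₂ ℂ (fun f g ↦ (hm f g).toLp)
    (fun f f' g ↦ by
      rw [← MemLp.toLp_add]
      exact MemLp.toLp_congr _ _ (wconv_add_left H f f' g))
    (fun z f g ↦ by
      rw [← MemLp.toLp_const_smul]
      refine MemLp.toLp_congr _ _ (ae_of_all _ fun ξ ↦ ?_)
      rw [wconv_lp_smul_left]
      rfl)
    (fun f g g' ↦ by
      rw [← MemLp.toLp_add]
      refine MemLp.toLp_congr _ _ ?_
      rw [wconv_swap, wconv_swap (f : Plane → ℂ) g, wconv_swap (f : Plane → ℂ) g']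
      exact wconv_add_left H' g g' f)
    (fun z f g ↦ by
      rw [← MemLp.toLp_const_smul]
      refine MemLp.toLp_congr _ _ (ae_of_all _ fun ξ ↦ ?_)
      rw [wconv_swap, wconv_lp_smul_left, wconv_swap]
      rfl)
  have hB₀ : ∀ f g, ‖B₀ f g‖ ≤ C * ‖f‖ * ‖g‖ := hb
  refine ⟨B₀.mkContinuous₂ C hB₀, fun f g ↦ ?_⟩
  rw [LinearMap.mkContinuous₂_apply]
  exact (hm f g).coeFn_toLp

/-- `prod` is defined by choice; uniqueness identifies it with any product that has been
constructed. -/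
theorem prod_eq_of_isProduct {u v w : 𝓢'(Plane, ℂ)} (h : IsProduct u v w) : prod u v = w := by
  have hex : ∃ w, IsProduct u v w := ⟨w, h⟩
  rw [prod, dif_pos hex]
  exact hex.choose_spec.unique h

theorem exists_hasFourierFunction (s : ℝ) (G : Lp ℂ 2 (volume : Measure Plane)) :
    ∃ w : 𝓢'(Plane, ℂ), HasFourierFunction w fun ξ ↦ besselSymbol (-s) ξ * G ξ := by
  refine ⟨bessel (-s) (𝓕⁻ (G : 𝓢'(Plane, ℂ))), HasFourierFunction.bessel ?_ (-s)⟩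
  exact hasFourierFunction_of_fourier_eq (FourierTransform.fourier_fourierInv_eq _)

/-- Products of curves in Sobolev spaces. -/
theorem FourierSobolev.prod {I : Set ℝ} {u v : ℝ → 𝓢'(Plane, ℂ)} (hu : FourierSobolev I a u)
    (hv : FourierSobolev I b v) (H : TrilinBound a b (-c)) :
    FourierSobolev I c fun t ↦ CSH.prod (u t) (v t) := by
  obtain ⟨F, hF, hFc, C, hC⟩ := hu
  obtain ⟨G, hG, hGc, D, hD⟩ := hv
  obtain ⟨B, hB⟩ := exists_wconv_clm H
  refine ⟨fun t ↦ B (F t) (G t), fun t ht ↦ ?_,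
    B.continuous₂.comp_continuousOn (hFc.prodMk hGc), ‖B‖ * C * D, fun t ht ↦ ?_⟩
  · obtain ⟨w, hw⟩ := exists_hasFourierFunction c (B (F t) (G t))
    have hp : IsProduct (u t) (v t) w := by
      refine ⟨_, _, hF t ht, hG t ht, convKernel_integrable H (F t) (G t), hw.congr ?_⟩
      filter_upwards [hB (F t) (G t)] with ξ hξ
      rw [hξ, wconv, ← mul_assoc, besselSymbol_neg_mul, one_mul]
      rfl
    simp only [prod_eq_of_isProduct hp]
    exact hw
  · have h1 := hC t ht
    have h2 := hD t ht
    calc _ ≤ ‖B‖ * ‖F t‖ * ‖G t‖ := B.le_opNorm₂ _ _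
      _ ≤ ‖B‖ * C * D := by
          have : 0 ≤ C := (norm_nonneg _).trans h1
          gcongr

/-! ### The nonlinearities in Sobolev spaces -/

namespace TrilinBound

variable {a b c : ℝ}

/-- Dividing by `a + c ≥ 1` gives smaller exponents of sum exactly `1`, to which the endpoint
estimate applies. -/
theorem of_first_third (ha : 0 < a) (hc : 0 < c) (h : 1 ≤ a + c) : TrilinBound a 0 c := by
  have hs : 0 < a + c := by linarith
  refine (endpoint (a := a / (a + c)) (c := c / (a + c)) (by positivity) (by positivity)
    (by field_simp)).mono ?_ le_rfl ?_
  · rw [div_le_iff₀ hs]; nlinarith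
  · rw [div_le_iff₀ hs]; nlinarith

theorem of_second_third (hb : 0 < b) (hc : 0 < c) (h : 1 ≤ b + c) : TrilinBound 0 b c :=
  (of_first_third hb hc h).swap_left

theorem of_first_second (ha : 0 < a) (hb : 0 < b) (h : 1 ≤ a + b) : TrilinBound a b 0 :=
  (of_second_third hb ha (by linarith)).swap_outer

/-- Products of two factors of positive regularity. -/
theorem of_pos (hc : 0 ≤ c) (ha : c < a) (hb : c < b) (h : 1 ≤ a + b - c) :
    TrilinBound a b (-c) := by
  rw [← zero_sub]
  exact split hc (of_first_second (by linarith) (by linarith) (by linarith))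
    (of_first_second (by linarith) (by linarith) (by linarith))

theorem swap_right (h : TrilinBound a b c) : TrilinBound a c b := h.swap_left.swap_outer.swap_left

end TrilinBound

variable {I : Set ℝ} {s : ℝ} {u : ℤˣ → ℝ → 𝓢'(Plane, ℂ)} {φ : ℤˣ → ℝ → 𝓢'(Plane, ℂ)}

theorem FourierSobolev.congr_exponent {r : ℝ} {v : ℝ → 𝓢'(Plane, ℂ)} (h : FourierSobolev I s v)
    (e : s = r) : FourierSobolev I r v := e ▸ h

theorem fourierSobolev_total (hu : ∀ σ, FourierSobolev I s (u σ)) :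
    FourierSobolev I s fun t ↦ total fun τ ↦ u τ t :=
  (hu 1).add (hu (-1))

theorem fourierSobolev_totalDt (hu : ∀ σ, FourierSobolev I s (u σ)) :
    FourierSobolev I (s - 1) fun t ↦ totalDt fun τ ↦ u τ t :=
  (((hu 1).sub (hu (-1))).bessel 1 (by ring)).smul _

/-- The time derivative costs one derivative exactly like the spatial ones, because it is expressed
by `⟨∇⟩` acting on the half-waves. -/
theorem fourierSobolev_dUp (hu : ∀ σ, FourierSobolev I s (u σ)) (μ : Fin 3) :
    FourierSobolev I (s - 1) fun t ↦ dUp μ fun τ ↦ u τ t := by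
  refine FourierSobolev.smul (u := fun t ↦ dLow μ fun τ ↦ u τ t) ?_ _
  refine Fin.cases ?_ (fun j ↦ ?_) μ
  · exact fourierSobolev_totalDt hu
  · exact (fourierSobolev_total hu).dSpace j (by ring)

/-- `H ^ 1` of the plane just fails to be an algebra, hence the strict inequality `s < 1`. -/
theorem fourierSobolev_absSq (hφ : ∀ σ, FourierSobolev I 1 (φ σ)) {s : ℝ} (h0 : 0 ≤ s)
    (h1 : s < 1) : FourierSobolev I s fun t ↦ absSq fun τ ↦ φ τ t :=
  (fourierSobolev_total hφ).conj.prod (fourierSobolev_total hφ)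
    (TrilinBound.of_pos h0 h1 h1 (by linarith))

theorem fourierSobolev_absSqDt (hφ : ∀ σ, FourierSobolev I 1 (φ σ)) :
    FourierSobolev I (-(1 / 4)) fun t ↦ absSqDt fun τ ↦ φ τ t := by
  have h0 := fourierSobolev_total hφ
  have h1 := (fourierSobolev_totalDt hφ).congr_exponent (r := 0) (by norm_num)
  refine (h1.conj.prod h0 ?_).add (h0.conj.prod h1 ?_)
  · rw [neg_neg]
    exact TrilinBound.of_second_third (by norm_num) (by norm_num) (by norm_num)
  · rw [neg_neg]
    exact TrilinBound.of_first_third (by norm_num) (by norm_num) (by norm_num)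

/-- The derivatives of `φ` are in `L²`, so each of the two products is of the form `L² · L² ⊂ H ^
(-1-δ)`. -/
theorem fourierSobolev_nullForm (hφ : ∀ σ, FourierSobolev I 1 (φ σ)) {δ : ℝ} (hδ : 0 < δ)
    (ν ρ : Fin 3) : FourierSobolev I (-1 - δ) fun t ↦ nullForm ν ρ fun τ ↦ φ τ t := by
  have h := fun μ ↦ (fourierSobolev_dUp hφ μ).congr_exponent (r := 0) (by norm_num)
  have H : TrilinBound 0 0 (-(-1 - δ)) := TrilinBound.of_one_lt (by linarith)
  exact ((h ν).conj.prod (h ρ) H).sub ((h ρ).conj.prod (h ν) H)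

/-- For a spatial derivative, `A |φ|²` is in `L²` and one derivative is lost. For the time
derivative the two Leibniz terms are products `H ^ (-1/2) · H ^ (3/4)` and `H ^ (1/2) · H ^ (-1/4)`;
moving the negative exponent to the output side by symmetry reduces them to products of positive
regularity. -/
theorem fourierSobolev_dLowCubic {A : ℤˣ → ℝ → 𝓢'(Plane, ℂ)}
    (hA : ∀ σ, FourierSobolev I (1 / 2) (A σ)) (hφ : ∀ σ, FourierSobolev I 1 (φ σ)) (ν : Fin 3) :
    FourierSobolev I (-1) fun t ↦ dLowCubic ν (fun τ ↦ A τ t) fun τ ↦ φ τ t := by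
  have hA0 := fourierSobolev_total hA
  have hA1 := (fourierSobolev_totalDt hA).congr_exponent (r := -(1 / 2)) (by norm_num)
  have hq := fourierSobolev_absSq hφ (s := 3 / 4) (by norm_num) (by norm_num)
  refine Fin.cases ?_ (fun j ↦ ?_) ν
  · refine (hA1.prod hq ?_).add (hA0.prod (fourierSobolev_absSqDt hφ) ?_)
    · rw [neg_neg]
      refine TrilinBound.swap_outer (TrilinBound.of_pos ?_ ?_ ?_ ?_) <;> norm_num
    · rw [neg_neg]
      refine TrilinBound.swap_right (TrilinBound.of_pos ?_ ?_ ?_ ?_) <;> norm_num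
  · refine FourierSobolev.dSpace (s := 0) (hA0.prod hq ?_) j (by norm_num)
    rw [neg_zero]
    exact TrilinBound.of_first_second (by norm_num) (by norm_num) (by norm_num)

theorem fourierSobolev_nonlinM {A : Fin 3 → ℤˣ → ℝ → 𝓢'(Plane, ℂ)}
    (hA : ∀ μ σ, FourierSobolev I (1 / 2) (A μ σ)) (hφ : ∀ σ, FourierSobolev I 1 (φ σ))
    {δ : ℝ} (hδ : 0 < δ) (μ : Fin 3) :
    FourierSobolev I (-1 - δ) fun t ↦ nonlinM (fun ν τ ↦ A ν τ t) (fun τ ↦ φ τ t) μ := by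
  refine FourierSobolev.add (FourierSobolev.add (FourierSobolev.neg ?_)
    (FourierSobolev.smul ?_ _)) ?_
  · refine FourierSobolev.sum _ fun ν _ ↦ FourierSobolev.sum _ fun ρ _ ↦ ?_
    exact ((fourierSobolev_nullForm hφ hδ ν ρ).imPart).smul _
  · refine FourierSobolev.sum _ fun ν _ ↦ FourierSobolev.sum _ fun ρ _ ↦ ?_
    exact ((fourierSobolev_dLowCubic (hA ρ) hφ ν).mono (by linarith)).smul _
  · exact (fourierSobolev_total (hA μ)).mono (by linarith)

/-- Each multiplication by `|φ|²` loses arbitrarily little. Quantifying over all `ε` lets the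
induction start from a quarter of the allowed loss. -/
theorem fourierSobolev_powTerm (hφ : ∀ σ, FourierSobolev I 1 (φ σ)) (k : ℕ) {ε : ℝ} (h0 : 0 < ε)
    (h1 : ε ≤ 1) : FourierSobolev I (1 - ε) fun t ↦ powTerm (fun τ ↦ φ τ t) k := by
  induction k generalizing ε with
  | zero => exact (fourierSobolev_total hφ).mono (by linarith)
  | succ k ih =>
    refine (fourierSobolev_absSq hφ (s := 1 - ε / 4) (by linarith) (by linarith)).prod
      (ih (ε := ε / 4) (by linarith) (by linarith)) ?_
    exact TrilinBound.of_pos (by linarith) (by linarith) (by linarith) (by linarith)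

/-- The exponent is dictated by `A ∂φ`, a product `H ^ (1/2) · L² ⊂ H ^ (-1/2)` at the endpoint. In
`A A φ` the inner product is in `L²`, so the same estimate applies; the remaining terms are
smoother. -/
theorem fourierSobolev_nonlinN (V : ℝ[X]) {A : Fin 3 → ℤˣ → ℝ → 𝓢'(Plane, ℂ)}
    (hA : ∀ μ σ, FourierSobolev I (1 / 2) (A μ σ)) (hφ : ∀ σ, FourierSobolev I 1 (φ σ)) :
    FourierSobolev I (-(1 / 2)) fun t ↦ nonlinN V (fun ν τ ↦ A ν τ t) (fun τ ↦ φ τ t) := by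
  have H : TrilinBound (1 / 2) 0 (-(-(1 / 2))) := by
    rw [neg_neg]
    exact TrilinBound.of_first_third (by norm_num) (by norm_num) (by norm_num)
  have hA0 := fun μ ↦ fourierSobolev_total (hA μ)
  have hφ0 := fourierSobolev_total hφ
  refine FourierSobolev.add (FourierSobolev.sub (FourierSobolev.add (FourierSobolev.smul ?_ _) ?_)
    ?_) (hφ0.mono (by norm_num))
  · refine FourierSobolev.sum _ fun μ _ ↦ ?_
    exact (hA0 μ).prod ((fourierSobolev_dUp hφ μ).congr_exponent (by norm_num)) H
  · refine FourierSobolev.sum _ fun μ _ ↦ FourierSobolev.smul ?_ _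
    refine (hA0 μ).prod ((hA0 μ).prod hφ0 ?_) H
    rw [neg_zero]
    exact TrilinBound.of_first_second (by norm_num) (by norm_num) (by norm_num)
  · refine FourierSobolev.sum (u := fun k t ↦ _ • powTerm (fun τ ↦ φ τ t) k) _ fun k _ ↦
      FourierSobolev.smul ?_ _
    exact (fourierSobolev_powTerm hφ k one_pos le_rfl).mono (by norm_num)

/-! ### Compactly supported functions are dense in the Schwartz space -/

section Density

variable {E : Type*} [NormedAddCommGroup E] [InnerProductSpace ℝ E]

/-- A smooth function that vanishes on the unit ball and equals `-1` far away. -/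
theorem exists_cutoff_sub_one (E : Type*) [NormedAddCommGroup E] [InnerProductSpace ℝ E]
    [FiniteDimensional ℝ E] : ∃ ω : E → ℂ, ContDiff ℝ (⊤ : ℕ∞) ω ∧ (∀ x ∈ Metric.ball (0 : E) 1,
      ω x = 0) ∧ HasCompactSupport (fun x ↦ ω x + 1) := by
  let θ : ContDiffBump (0 : E) := ⟨1, 2, one_pos, one_lt_two⟩
  refine ⟨fun x ↦ (θ x : ℂ) - 1, ?_, fun x hx ↦ ?_, ?_⟩
  · exact (Complex.ofRealCLM.contDiff.comp θ.contDiff).sub contDiff_const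
  · have h : θ x = 1 := θ.one_of_mem_closedBall (Metric.ball_subset_closedBall hx)
    simp [h]
  · simp only [sub_add_cancel]
    exact θ.hasCompactSupport.comp_left (g := Complex.ofReal) (by simp)

/-- The derivative vanishes unless `r‖x‖ ≥ 1`, so the constant bound `B` may be multiplied by
`r‖x‖`. The factor `r` yields convergence, and `‖x‖` is absorbed by the decay of a Schwartz
function. -/
theorem norm_iteratedFDeriv_comp_smul_le {ω : E → ℂ} (hω : ContDiff ℝ (⊤ : ℕ∞) ω)
    (h0 : ∀ x ∈ Metric.ball (0 : E) 1, ω x = 0) {i : ℕ} {B : ℝ}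
    (hB : ∀ x, ‖iteratedFDeriv ℝ i ω x‖ ≤ B) {r : ℝ} (hr : 0 < r) (hr1 : r ≤ 1) (x : E) :
    ‖iteratedFDeriv ℝ i (fun x ↦ ω (r • x)) x‖ ≤ B * (r * ‖x‖) := by
  have hB0 : 0 ≤ B := (norm_nonneg _).trans (hB 0)
  let L : E →L[ℝ] E := r • ContinuousLinearMap.id ℝ E
  have e : (fun x ↦ ω (r • x)) = ω ∘ L := rfl
  rw [e, L.iteratedFDeriv_comp_right hω x (by exact_mod_cast le_top)]
  have hL : ‖L‖ ≤ 1 := by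
    refine L.opNorm_le_bound zero_le_one fun y ↦ ?_
    change ‖r • y‖ ≤ 1 * ‖y‖
    rw [norm_smul, Real.norm_of_nonneg hr.le]
    gcongr
  have hLx : L x = r • x := rfl
  by_cases hx : r * ‖x‖ < 1
  · have hmem : L x ∈ Metric.ball (0 : E) 1 := by
      rw [hLx, mem_ball_zero_iff, norm_smul, Real.norm_of_nonneg hr.le]
      exact hx
    have hev : ω =ᶠ[nhds (L x)] fun _ ↦ 0 := by
      filter_upwards [Metric.isOpen_ball.mem_nhds hmem] with y hy using h0 y hy
    have : iteratedFDeriv ℝ i ω (L x) = 0 := by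
      rw [(hev.iteratedFDeriv ℝ i).eq_of_nhds]
      simp
    rw [this]
    refine ((ContinuousMultilinearMap.norm_compContinuousLinearMap_le _ _).trans ?_)
    rw [norm_zero, zero_mul]
    positivity
  · refine ((ContinuousMultilinearMap.norm_compContinuousLinearMap_le _ _).trans ?_)
    have h1 : ∏ _j : Fin i, ‖L‖ ≤ 1 := Finset.prod_le_one (fun _ _ ↦ norm_nonneg _) fun _ _ ↦ hL
    calc _ ≤ B * 1 := mul_le_mul (hB _) h1 (Finset.prod_nonneg fun _ _ ↦ norm_nonneg _) hB0
      _ ≤ B * (r * ‖x‖) := by gcongr; exact not_lt.1 hx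

theorem exists_hasCompactSupport_tendsto [FiniteDimensional ℝ E] (f : 𝓢(E, ℂ)) :
    ∃ g : ℕ → 𝓢(E, ℂ), (∀ n, HasCompactSupport (g n)) ∧
      Filter.Tendsto g Filter.atTop (nhds f) := by
  obtain ⟨ω, hω, h0, hc⟩ := exists_cutoff_sub_one E
  let r : ℕ → ℝ := fun n ↦ 1 / ((n : ℝ) + 1)
  have hr : ∀ n, 0 < r n := fun n ↦ by positivity
  have hr1 : ∀ n, r n ≤ 1 := fun n ↦ by
    rw [div_le_one (by positivity)]
    linarith [n.cast_nonneg (α := ℝ)]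
  have hs : ∀ n, ContDiff ℝ (⊤ : ℕ∞) fun x : E ↦ ω (r n • x) := fun n ↦
    hω.comp (contDiff_const_smul (r n))
  have hcs : ∀ n, HasCompactSupport fun x : E ↦ ω (r n • x) + 1 := fun n ↦ by
    have := hc.comp_homeomorph (Homeomorph.smulOfNeZero (r n) (hr n).ne')
    exact this
  have hcs' : ∀ n, HasCompactSupport fun x : E ↦ (ω (r n • x) + 1) * f x := fun n ↦
    (hcs n).mul_right
  have hsm : ∀ n, ContDiff ℝ (⊤ : ℕ∞) fun x : E ↦ (ω (r n • x) + 1) * f x := fun n ↦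
    ((hs n).add contDiff_const).mul (f.smooth _)
  refine ⟨fun n ↦ (hcs' n).toSchwartzMap (hsm n), hcs', ?_⟩
  rw [(schwartz_withSeminorms ℝ E ℂ).tendsto_nhds]
  rintro ⟨k, l⟩ ε hε
  have hbd : ∃ B : ℝ, 0 ≤ B ∧ ∀ i ≤ l, ∀ x, ‖iteratedFDeriv ℝ i ω x‖ ≤ B := by
    have : ∀ i, ∃ B : ℝ, ∀ x, ‖iteratedFDeriv ℝ i ω x‖ ≤ B := by
      intro i
      have e : ω = fun x ↦ (ω x + 1) + (-1) := by funext x; ring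
      have hcont : Continuous fun x ↦ ‖iteratedFDeriv ℝ i (fun x ↦ ω x + 1) x‖ :=
        ((hω.add contDiff_const).continuous_iteratedFDeriv (by exact_mod_cast le_top)).norm
      obtain ⟨x₀, hx₀⟩ := hcont.exists_forall_ge_of_hasCompactSupport (hc.iteratedFDeriv i).norm
      refine ⟨‖iteratedFDeriv ℝ i (fun x ↦ ω x + 1) x₀‖ +
        ‖iteratedFDeriv ℝ i (fun _ : E ↦ (-1 : ℂ)) 0‖, fun x ↦ ?_⟩
      have e' : iteratedFDeriv ℝ i ω x = iteratedFDeriv ℝ i (fun x ↦ (ω x + 1) + (-1)) x := by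
        rw [← e]
      rw [e', fun_iteratedFDeriv_add_apply
        (hω.add contDiff_const |>.contDiffAt.of_le (by exact_mod_cast le_top)) contDiffAt_const]
      refine (norm_add_le _ _).trans (add_le_add (hx₀ x) (le_of_eq ?_))
      rcases i with _ | i
      · simp
      · simp [iteratedFDeriv_succ_const]
    choose B hB using this
    refine ⟨∑ i ∈ Finset.range (l + 1), |B i|, Finset.sum_nonneg fun _ _ ↦ abs_nonneg _,
      fun i hi x ↦ (hB i x).trans ((le_abs_self _).trans ?_)⟩
    exact Finset.single_le_sum (f := fun i ↦ |B i|) (fun _ _ ↦ abs_nonneg _)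
      (Finset.mem_range.2 (by omega))
  obtain ⟨B, hB0, hB⟩ := hbd
  set M : ℝ := ∑ i ∈ Finset.range (l + 1),
    (l.choose i : ℝ) * B * SchwartzMap.seminorm ℝ (k + 1) (l - i) f with hM
  have hM0 : 0 ≤ M := Finset.sum_nonneg fun i _ ↦ by positivity
  -- The error is `ω (r n • x) * f x`. By the Leibniz rule its `(k, l)` seminorm is `r n` times
  -- seminorms of `f` with one more power of `‖x‖`.
  have key : ∀ n, SchwartzMap.seminorm ℝ k l ((hcs' n).toSchwartzMap (hsm n) - f) ≤ r n * M := by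
    intro n
    refine SchwartzMap.seminorm_le_bound ℝ k l _ (mul_nonneg (hr n).le hM0) fun x ↦ ?_
    have e : (((hcs' n).toSchwartzMap (hsm n) - f : 𝓢(E, ℂ)) : E → ℂ) =
        fun x ↦ ω (r n • x) * f x := by
      funext x
      change (ω (r n • x) + 1) * f x - f x = _
      ring
    rw [e]
    have h1 := norm_iteratedFDeriv_mul_le (hs n) (f.smooth ⊤) x (n := l) (by exact_mod_cast le_top)
    calc _ ≤ ‖x‖ ^ k * ∑ i ∈ Finset.range (l + 1), (l.choose i : ℝ) *
          ‖iteratedFDeriv ℝ i (fun x ↦ ω (r n • x)) x‖ * ‖iteratedFDeriv ℝ (l - i) f x‖ := by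
          gcongr
      _ ≤ ∑ i ∈ Finset.range (l + 1),
          r n * ((l.choose i : ℝ) * B * SchwartzMap.seminorm ℝ (k + 1) (l - i) f) := by
          rw [Finset.mul_sum]
          refine Finset.sum_le_sum fun i hi ↦ ?_
          have h2 := norm_iteratedFDeriv_comp_smul_le hω h0
            (hB i (by have := Finset.mem_range.1 hi; omega)) (hr n) (hr1 n) x
          have h3 := SchwartzMap.le_seminorm ℝ (k + 1) (l - i) f x
          calc _ ≤ ‖x‖ ^ k * ((l.choose i : ℝ) * (B * (r n * ‖x‖)) *
                ‖iteratedFDeriv ℝ (l - i) f x‖) := by gcongr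
            _ = r n * ((l.choose i : ℝ) * B *
                (‖x‖ ^ (k + 1) * ‖iteratedFDeriv ℝ (l - i) f x‖)) := by ring
            _ ≤ _ := by
                have := (hr n).le
                gcongr
      _ = r n * M := by rw [hM, Finset.mul_sum]
  have hlim : Filter.Tendsto (fun n ↦ r n * M) Filter.atTop (nhds 0) := by
    simpa [r] using (tendsto_one_div_add_atTop_nhds_zero_nat (𝕜 := ℝ)).mul_const M
  filter_upwards [hlim.eventually_lt_const hε] with n hn
  exact (key n).trans_lt hn

end Density

/-! ### The free evolution on the Fourier side -/

/-- All derivatives are `I ^ n` times the function, hence of modulus `1`. -/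
theorem hasTemperateGrowth_cexp_I : (fun r : ℝ ↦ Complex.exp (Complex.I * r)).HasTemperateGrowth := by
  have hc : ContDiff ℝ (⊤ : ℕ∞) fun r : ℝ ↦ Complex.exp (Complex.I * r) :=
    (contDiff_const.mul Complex.ofRealCLM.contDiff).cexp
  have hd : ∀ n : ℕ, iteratedDeriv n (fun r : ℝ ↦ Complex.exp (Complex.I * r)) =
      fun r : ℝ ↦ Complex.I ^ n * Complex.exp (Complex.I * r) := by
    intro n
    induction n with
    | zero => simp
    | succ n ih =>
      rw [iteratedDeriv_succ, ih]
      funext r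
      have h1 : HasDerivAt (fun r : ℝ ↦ Complex.I * (r : ℂ)) Complex.I r := by
        simpa using (Complex.ofRealCLM.hasDerivAt (x := r)).const_mul Complex.I
      rw [(h1.cexp.const_mul (Complex.I ^ n)).deriv]
      ring
  refine ⟨hc, fun n ↦ ⟨0, 1, fun r ↦ ?_⟩⟩
  rw [norm_iteratedFDeriv_eq_norm_iteratedDeriv, hd]
  simp [Complex.norm_exp]

theorem wt_hasTemperateGrowth (s : ℝ) : (wt s).HasTemperateGrowth := by
  have h := Function.hasTemperateGrowth_one_add_norm_sq_rpow Plane (s / 2)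
  have h2 : (fun ξ : Plane ↦ (2 * Real.pi) • ξ).HasTemperateGrowth := by fun_prop
  exact h.comp h2

/-- The symbol `exp (i k ⟨2πξ⟩)`. -/
noncomputable def evoSymbol (k : ℝ) (ξ : Plane) : ℂ := Complex.exp (Complex.I * (k * wt 1 ξ : ℝ))

theorem evoSymbol_hasTemperateGrowth (k : ℝ) : (evoSymbol k).HasTemperateGrowth := by
  have h : (fun ξ : Plane ↦ k * wt 1 ξ).HasTemperateGrowth :=
    (Function.HasTemperateGrowth.const k).mul (wt_hasTemperateGrowth 1)
  exact hasTemperateGrowth_cexp_I.comp h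

theorem norm_evoSymbol (k : ℝ) (ξ : Plane) : ‖evoSymbol k ξ‖ = 1 := by
  rw [evoSymbol, mul_comm, Complex.norm_exp_ofReal_mul_I]

theorem evoSymbol_add (k l : ℝ) (ξ : Plane) :
    evoSymbol (k + l) ξ = evoSymbol k ξ * evoSymbol l ξ := by
  rw [evoSymbol, evoSymbol, evoSymbol, ← Complex.exp_add]
  push_cast
  ring_nf

theorem evoSymbol_zero (ξ : Plane) : evoSymbol 0 ξ = 1 := by simp [evoSymbol]

/-- The evolution `exp (i k ⟨2πξ⟩)` acting on Schwartz functions of frequency. -/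
noncomputable def evo (k : ℝ) : 𝓢(Plane, ℂ) →L[ℂ] 𝓢(Plane, ℂ) :=
  SchwartzMap.smulLeftCLM ℂ (evoSymbol k)

theorem evo_apply (k : ℝ) (p : 𝓢(Plane, ℂ)) (ξ : Plane) : evo k p ξ = evoSymbol k ξ * p ξ := by
  rw [evo, SchwartzMap.smulLeftCLM_apply_apply (evoSymbol_hasTemperateGrowth k), smul_eq_mul]

theorem evo_add (k l : ℝ) (p : 𝓢(Plane, ℂ)) : evo (k + l) p = evo k (evo l p) := by
  ext ξ
  rw [evo_apply, evo_apply, evo_apply, evoSymbol_add, mul_assoc]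

theorem evo_zero (p : 𝓢(Plane, ℂ)) : evo 0 p = p := by
  ext ξ
  rw [evo_apply, evoSymbol_zero, one_mul]

/-- Multiplication of Schwartz functions of frequency by `⟨2πξ⟩ ^ s`. -/
noncomputable def wmul (s : ℝ) : 𝓢(Plane, ℂ) →L[ℂ] 𝓢(Plane, ℂ) :=
  SchwartzMap.smulLeftCLM ℂ (besselSymbol s)

theorem wmul_apply (s : ℝ) (p : 𝓢(Plane, ℂ)) (ξ : Plane) :
    wmul s p ξ = besselSymbol s ξ * p ξ := by
  rw [wmul, SchwartzMap.smulLeftCLM_apply_apply (besselSymbol_hasTemperateGrowth s), smul_eq_mul]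

/-- The norm `‖⟨2πξ⟩ ^ s p‖_{L²}`. -/
noncomputable def wnorm (s : ℝ) (p : 𝓢(Plane, ℂ)) : ℝ := ‖(wmul s p).toLp 2 volume‖

theorem wnorm_nonneg (s : ℝ) (p : 𝓢(Plane, ℂ)) : 0 ≤ wnorm s p := norm_nonneg _

theorem wnorm_continuous (s : ℝ) : Continuous (wnorm s) :=
  (SchwartzMap.continuous_toLp.comp (wmul s).continuous).norm

theorem norm_wmul_apply (s : ℝ) (p : 𝓢(Plane, ℂ)) (ξ : Plane) :
    ‖wmul s p ξ‖ = wt s ξ * ‖p ξ‖ := by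
  rw [wmul_apply, norm_mul, besselSymbol_eq, Complex.norm_real, Real.norm_of_nonneg (wt_pos _ _).le]

theorem wnorm_le_of_le {s r C : ℝ} {p q : 𝓢(Plane, ℂ)}
    (h : ∀ ξ, wt s ξ * ‖p ξ‖ ≤ C * (wt r ξ * ‖q ξ‖)) : wnorm s p ≤ C * wnorm r q := by
  refine Lp.norm_le_mul_norm_of_ae_le_mul ?_
  filter_upwards [(wmul s p).coeFn_toLp 2 volume, (wmul r q).coeFn_toLp 2 volume] with ξ h1 h2
  rw [h1, h2, norm_wmul_apply, norm_wmul_apply]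
  exact h ξ

theorem wnorm_evo (s k : ℝ) (p : 𝓢(Plane, ℂ)) : wnorm s (evo k p) = wnorm s p := by
  apply le_antisymm
  · rw [← one_mul (wnorm s p)]
    refine wnorm_le_of_le fun ξ ↦ ?_
    rw [evo_apply, norm_mul, norm_evoSymbol, one_mul, one_mul]
  · rw [← one_mul (wnorm s (evo k p))]
    refine wnorm_le_of_le fun ξ ↦ ?_
    rw [evo_apply, norm_mul, norm_evoSymbol, one_mul, one_mul]

theorem wnorm_mono {s r : ℝ} (h : s ≤ r) (p : 𝓢(Plane, ℂ)) : wnorm s p ≤ wnorm r p := by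
  rw [← one_mul (wnorm r p)]
  refine wnorm_le_of_le fun ξ ↦ ?_
  rw [one_mul]
  gcongr
  exact wt_mono h ξ

/-- The bilinear pairing of `L²` functions. -/
noncomputable def pairL {X : Type*} [MeasurableSpace X] (μ : Measure X) :
    Lp ℂ 2 μ →L[ℂ] Lp ℂ 2 μ →L[ℂ] ℂ :=
  (ContinuousLinearMap.mul ℂ ℂ).lpPairing μ 2 2

theorem pairL_apply {X : Type*} [MeasurableSpace X] {μ : Measure X} (f g : Lp ℂ 2 μ) :
    pairL μ f g = ∫ x, f x * g x ∂μ :=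
  ContinuousLinearMap.lpPairing_eq_integral _ f g

/-- A curve of distributions whose Fourier transforms are bounded in the dual of the `L²` space
with weight `⟨ξ⟩ ^ (-s)` and weakly continuous. -/
structure WeakSobolev (I : Set ℝ) (s : ℝ) (u : ℝ → 𝓢'(Plane, ℂ)) : Prop where
  bound : ∃ C : ℝ, 0 ≤ C ∧ ∀ t ∈ I, ∀ p : 𝓢(Plane, ℂ), ‖𝓕 (u t) p‖ ≤ C * wnorm (-s) p
  cont : ∀ p : 𝓢(Plane, ℂ), ContinuousOn (fun t ↦ 𝓕 (u t) p) I

/-- Pairing the `L²` profile with `⟨ξ⟩ ^ (-s) p` gives the bound by Cauchy-Schwarz and continuity by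
that of the profile. From here on only these scalar pairings enter. -/
theorem FourierSobolev.weakSobolev {I : Set ℝ} {s : ℝ} {u : ℝ → 𝓢'(Plane, ℂ)}
    (hu : FourierSobolev I s u) : WeakSobolev I s u := by
  obtain ⟨G, hG, hc, C, hC⟩ := hu
  have e : ∀ t ∈ I, ∀ p : 𝓢(Plane, ℂ),
      𝓕 (u t) p = pairL volume (G t) ((wmul (-s) p).toLp 2 volume) := by
    intro t ht p
    rw [(hG t ht p).2, pairL_apply]
    refine integral_congr_ae ?_
    filter_upwards [(wmul (-s) p).coeFn_toLp 2 volume] with ξ hξ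
    rw [hξ, wmul_apply]
    ring
  refine ⟨⟨‖pairL (volume : Measure Plane)‖ * |C|, by positivity, fun t ht p ↦ ?_⟩, fun p ↦ ?_⟩
  · rw [e t ht p]
    refine (ContinuousLinearMap.le_opNorm₂ _ _ _).trans ?_
    rw [wnorm]
    gcongr
    exact (hC t ht).trans (le_abs_self _)
  · have h1 : ContinuousOn (fun t ↦ pairL volume (G t) ((wmul (-s) p).toLp 2 volume)) I :=
      ((pairL volume).flip ((wmul (-s) p).toLp 2 volume)).continuous.comp_continuousOn hc
    exact h1.congr fun t ht ↦ e t ht p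

/-! ### The lemma of du Bois-Reymond -/

theorem exists_Icc_of_isCompact {K : Set ℝ} {a b : ℝ} (hab : a < b) (hK : IsCompact K)
    (h : K ⊆ Set.Ioo a b) : ∃ a' b', a < a' ∧ b' < b ∧ a' ≤ b' ∧ K ⊆ Set.Ioo a' b' := by
  rcases K.eq_empty_or_nonempty with rfl | hne
  · exact ⟨(a + b) / 2, (a + b) / 2, by linarith, by linarith, le_rfl, Set.empty_subset _⟩
  obtain ⟨x, hx, hxm⟩ := hK.exists_isLeast hne
  obtain ⟨y, hy, hym⟩ := hK.exists_isGreatest hne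
  have h1 := h hx
  have h2 := h hy
  have h3 : x ≤ y := hxm hy
  refine ⟨(a + x) / 2, (y + b) / 2, by linarith [h1.1], by linarith [h2.2],
    by linarith [h1.1, h2.2], fun z hz ↦ ⟨?_, ?_⟩⟩
  · linarith [h1.1, hxm hz]
  · linarith [h2.2, hym hz]

/-- The mean zero condition makes the primitive vanish again to the right of the support. -/
theorem exists_primitive_of_integral_eq_zero {γ : ℝ → ℝ} {a b : ℝ} (hab : a < b)
    (hγ : ContDiff ℝ (⊤ : ℕ∞) γ) (hc : HasCompactSupport γ) (hs : tsupport γ ⊆ Set.Ioo a b)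
    (h0 : ∫ t, γ t = 0) : ∃ α : ℝ → ℝ, ContDiff ℝ (⊤ : ℕ∞) α ∧ HasCompactSupport α ∧
      tsupport α ⊆ Set.Ioo a b ∧ deriv α = γ := by
  obtain ⟨a', b', ha, hb, hab', hK⟩ := exists_Icc_of_isCompact hab hc hs
  have hγ0 : ∀ t, t ∉ Set.Ioo a' b' → γ t = 0 := fun t ht ↦
    image_eq_zero_of_notMem_tsupport fun h ↦ ht (hK h)
  let α : ℝ → ℝ := fun t ↦ ∫ r in a'..t, γ r
  have hd : ∀ t, HasDerivAt α (γ t) t := fun t ↦ hγ.continuous.integral_hasStrictDerivAt a' t |>.hasDerivAt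
  have hda : deriv α = γ := funext fun t ↦ (hd t).deriv
  have hz : ∀ t, t ∉ Set.Icc a' b' → α t = 0 := by
    intro t ht
    rw [Set.mem_Icc, not_and_or, not_le, not_le] at ht
    rcases ht with ht | ht
    · refine intervalIntegral.integral_zero_ae (ae_of_all _ fun r hr ↦ hγ0 r fun hr' ↦ ?_)
      rw [Set.uIoc_of_ge ht.le] at hr
      exact absurd hr.2 (not_le.2 hr'.1)
    · rw [← h0]
      refine intervalIntegral.integral_eq_integral_of_support_subset fun r hr ↦ ?_
      have : r ∈ Set.Ioo a' b' := by
        by_contra h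
        exact hr (hγ0 r h)
      exact ⟨this.1, (this.2.trans ht).le⟩
  have hts : tsupport α ⊆ Set.Icc a' b' := closure_minimal (fun t ht ↦ by
    by_contra h
    exact ht (hz t h)) isClosed_Icc
  refine ⟨α, ?_, HasCompactSupport.intro isCompact_Icc hz, fun t ht ↦ ?_, hda⟩
  · rw [contDiff_infty_iff_deriv, hda]
    exact ⟨fun t ↦ (hd t).differentiableAt, hγ⟩
  · have := hts ht
    exact ⟨ha.trans_le this.1, this.2.trans_lt hb⟩

theorem exists_integral_eq_one {a b : ℝ} (hab : a < b) : ∃ ρ : ℝ → ℝ, ContDiff ℝ (⊤ : ℕ∞) ρ ∧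
    HasCompactSupport ρ ∧ tsupport ρ ⊆ Set.Ioo a b ∧ ∫ t, ρ t = 1 := by
  let θ : ContDiffBump ((a + b) / 2) :=
    ⟨(b - a) / 8, (b - a) / 4, by linarith, by linarith⟩
  refine ⟨θ.normed volume, θ.contDiff_normed, θ.hasCompactSupport_normed, ?_, θ.integral_normed⟩
  rw [θ.tsupport_normed_eq, Real.closedBall_eq_Icc]
  intro t ht
  have h1 := ht.1
  have h2 := ht.2
  change (a + b) / 2 - (b - a) / 4 ≤ t at h1
  change t ≤ (a + b) / 2 + (b - a) / 4 at h2
  exact ⟨by linarith, by linarith⟩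

theorem integrable_smul_of_tsupport_subset {α : ℝ → ℝ} {f : ℝ → ℂ} {U : Set ℝ} (hU : IsOpen U)
    (hα : Continuous α) (hc : HasCompactSupport α) (hs : tsupport α ⊆ U) (hf : ContinuousOn f U) :
    Integrable fun t ↦ α t • f t := by
  have h1 : Continuous fun t ↦ α t • f t :=
    (hα.continuousOn.smul hf).continuous_of_tsupport_subset hU
      ((closure_mono (Function.support_smul_subset_left α f)).trans hs)
  exact h1.integrable_of_hasCompactSupport hc.smul_right

theorem setIntegral_smul_of_tsupport_subset {α : ℝ → ℝ} {f : ℝ → ℂ} {U : Set ℝ}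
    (hs : tsupport α ⊆ U) : ∫ t in U, α t • f t = ∫ t, α t • f t :=
  setIntegral_eq_integral_of_forall_compl_eq_zero fun t ht ↦ by
    rw [image_eq_zero_of_notMem_tsupport fun h ↦ ht (hs h), zero_smul]

theorem integral_deriv_smul_eq_neg {α : ℝ → ℝ} {f f' : ℝ → ℂ} {U : Set ℝ} (hU : IsOpen U)
    (hα : ContDiff ℝ (⊤ : ℕ∞) α) (hc : HasCompactSupport α) (hs : tsupport α ⊆ U)
    (hf : ∀ t ∈ U, HasDerivAt f (f' t) t) (hf' : ContinuousOn f' U) :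
    ∫ t, deriv α t • f t = -∫ t, α t • f' t := by
  have hfc : ContinuousOn f U := fun t ht ↦ (hf t ht).continuousAt.continuousWithinAt
  have hs' : tsupport (deriv α) ⊆ U := (tsupport_deriv_subset (𝕜 := ℝ)).trans hs
  have i1 := integrable_smul_of_tsupport_subset hU (hα.continuous_deriv (by simp)) hc.deriv hs' hfc
  have i2 := integrable_smul_of_tsupport_subset hU hα.continuous hc hs hf'
  have i3 := integrable_smul_of_tsupport_subset hU hα.continuous hc hs hfc
  have hd : ∀ t, HasDerivAt (fun t ↦ α t • f t) (α t • f' t + deriv α t • f t) t := by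
    intro t
    have hαt : HasDerivAt α (deriv α t) t :=
      ((hα.differentiable (by simp)) t).hasDerivAt
    by_cases ht : t ∈ U
    · exact hαt.smul (hf t ht)
    · have h1 : t ∉ tsupport α := fun h ↦ ht (hs h)
      have h2 : α =ᶠ[nhds t] 0 := notMem_tsupport_iff_eventuallyEq.1 h1
      have h3 : (fun t ↦ α t • f t) =ᶠ[nhds t] fun _ ↦ 0 := by
        filter_upwards [h2] with r hr
        rw [hr, Pi.zero_apply, zero_smul]
      rw [image_eq_zero_of_notMem_tsupport h1,
        image_eq_zero_of_notMem_tsupport fun h ↦ ht (hs' h), zero_smul, zero_smul, add_zero]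
      exact (hasDerivAt_const t 0).congr_of_eventuallyEq h3
  have h := integral_eq_zero_of_hasDerivAt_of_integrable hd (i2.add i1) i3
  rw [integral_add i2 i1] at h
  exact eq_neg_of_add_eq_zero_right h

/-- A continuous function with continuous weak derivative is a primitive of it. -/
theorem sub_eq_integral_of_weak_deriv {c k : ℝ → ℂ} {a b : ℝ} (hc : ContinuousOn c (Set.Ioo a b))
    (hk : ContinuousOn k (Set.Ioo a b))
    (H : ∀ α : ℝ → ℝ, ContDiff ℝ (⊤ : ℕ∞) α → HasCompactSupport α → tsupport α ⊆ Set.Ioo a b →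
      ∫ t in Set.Ioo a b, deriv α t • c t = -∫ t in Set.Ioo a b, α t • k t)
    {s t : ℝ} (hs : s ∈ Set.Ioo a b) (ht : t ∈ Set.Ioo a b) :
    c t - c s = ∫ r in s..t, k r := by
  have hab : a < b := hs.1.trans hs.2
  set U := Set.Ioo a b with hU
  have oU : IsOpen U := isOpen_Ioo
  let K : ℝ → ℂ := fun t ↦ ∫ r in s..t, k r
  have hKi : ∀ t ∈ U, IntervalIntegrable k volume s t := fun t ht ↦
    (hk.mono (Set.OrdConnected.uIcc_subset Set.ordConnected_Ioo hs ht)).intervalIntegrable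
  have hK : ∀ t ∈ U, HasDerivAt K (k t) t := fun t ht ↦
    intervalIntegral.integral_hasDerivAt_right (hKi t ht)
      (hk.stronglyMeasurableAtFilter oU t ht) (hk.continuousAt (oU.mem_nhds ht))
  have hKc : ContinuousOn K U := fun t ht ↦ (hK t ht).continuousAt.continuousWithinAt
  -- With a primitive of `k` removed, the weak derivative of `D` is zero, and it remains to see that
  -- `D` is constant.
  let D : ℝ → ℂ := fun t ↦ c t - K t
  have hD : ContinuousOn D U := hc.sub hKc
  have hD0 : ∀ α : ℝ → ℝ, ContDiff ℝ (⊤ : ℕ∞) α → HasCompactSupport α → tsupport α ⊆ U →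
      ∫ t, deriv α t • D t = 0 := by
    intro α h1 h2 h3
    have h3' : tsupport (deriv α) ⊆ U := (tsupport_deriv_subset (𝕜 := ℝ)).trans h3
    have e1 := H α h1 h2 h3
    rw [setIntegral_smul_of_tsupport_subset h3', setIntegral_smul_of_tsupport_subset h3] at e1
    have e2 := integral_deriv_smul_eq_neg oU h1 h2 h3 hK hk
    have cd := h1.continuous_deriv (by simp)
    simp only [D, smul_sub]
    rw [integral_sub (integrable_smul_of_tsupport_subset oU cd h2.deriv h3' hc)
      (integrable_smul_of_tsupport_subset oU cd h2.deriv h3' hKc), e1, e2, sub_self]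
  obtain ⟨ρ, r1, r2, r3, r4⟩ := exists_integral_eq_one hab
  let κ : ℂ := ∫ t, ρ t • D t
  have hzero : ∀ᵐ t, t ∈ U → D t - κ = 0 := by
    refine oU.ae_eq_zero_of_integral_contDiff_smul_eq_zero
      ((hD.sub continuousOn_const).locallyIntegrableOn oU.measurableSet) fun β b1 b2 b3 ↦ ?_
    have iβ : Integrable β := b1.continuous.integrable_of_hasCompactSupport b2
    have iρ : Integrable ρ := r1.continuous.integrable_of_hasCompactSupport r2
    set m : ℝ := ∫ t, β t with hm
    -- Subtracting the multiple `m` of `ρ` gives mean zero, so `γ` is the derivative of a test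
    -- function and is annihilated by `D`. Hence `D` and the constant `κ` have the same integral
    -- against `β`.
    let γ : ℝ → ℝ := fun t ↦ β t - m * ρ t
    have g1 : ContDiff ℝ (⊤ : ℕ∞) γ := b1.sub (contDiff_const.mul r1)
    have g2 : HasCompactSupport γ := b2.sub (r2.mul_left (f := fun _ ↦ m))
    have g3 : tsupport γ ⊆ U := by
      refine (tsupport_sub β fun t ↦ m * ρ t).trans (Set.union_subset b3 ?_)
      exact (tsupport_mul_subset_right (f := fun _ ↦ m)).trans r3
    have g4 : ∫ t, γ t = 0 := by
      rw [integral_sub iβ (iρ.const_mul m), integral_const_mul, r4, mul_one, sub_self]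
    obtain ⟨α, a1, a2, a3, a4⟩ := exists_primitive_of_integral_eq_zero hab g1 g2 g3 g4
    have e := hD0 α a1 a2 a3
    rw [a4] at e
    have j1 := integrable_smul_of_tsupport_subset oU b1.continuous b2 b3 hD
    have j2 := integrable_smul_of_tsupport_subset oU r1.continuous r2 r3 hD
    have e1 : ∀ t, γ t • D t = β t • D t - m • (ρ t • D t) := fun t ↦ by
      simp only [γ, sub_smul, smul_smul]
    simp_rw [e1] at e
    have j3 : Integrable fun t ↦ m • (ρ t • D t) := j2.smul m
    rw [integral_sub j1 j3, integral_smul] at e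
    simp_rw [smul_sub]
    rw [integral_sub j1 (iβ.smul_const κ), integral_smul_const]
    exact e
  have hae : D =ᵐ[volume.restrict U] fun _ ↦ κ := by
    rw [Filter.EventuallyEq, ae_restrict_iff' oU.measurableSet]
    filter_upwards [hzero] with t ht h
    exact sub_eq_zero.1 (ht h)
  have heq := Measure.eqOn_open_of_ae_eq hae oU hD continuousOn_const
  have h1 : D t = D s := (heq ht).trans (heq hs).symm
  have h2 : K s = 0 := intervalIntegral.integral_same
  simp only [D, h2, sub_zero] at h1
  rw [← h1]
  simp only [K]
  ring

/-! ### The half-wave equation at fixed frequency -/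

theorem exists_tensor {α : ℝ → ℝ} (hα : ContDiff ℝ (⊤ : ℕ∞) α) (hc : HasCompactSupport α)
    {χ : 𝓢(Plane, ℂ)} (hχ : HasCompactSupport χ) : ∃ Φ : 𝓢(Spacetime, ℂ),
      (∀ z, Φ z = (α z.fst : ℂ) * χ z.snd) ∧ HasCompactSupport Φ ∧
        tsupport Φ ⊆ {z | z.fst ∈ tsupport α} := by
  let L := WithLp.prodContinuousLinearEquiv 2 ℝ ℝ Plane
  have h1 : ContDiff ℝ (⊤ : ℕ∞) fun z : Spacetime ↦ z.fst :=
    contDiff_fst.comp L.contDiff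
  have h2 : ContDiff ℝ (⊤ : ℕ∞) fun z : Spacetime ↦ z.snd :=
    contDiff_snd.comp L.contDiff
  have hs : ContDiff ℝ (⊤ : ℕ∞) fun z : Spacetime ↦ (α z.fst : ℂ) * χ z.snd :=
    (Complex.ofRealCLM.contDiff.comp (hα.comp h1)).mul ((χ.smooth _).comp h2)
  have hcl : IsClosed {z : Spacetime | z.fst ∈ tsupport α} :=
    (isClosed_tsupport α).preimage h1.continuous
  have hsub : tsupport (fun z : Spacetime ↦ (α z.fst : ℂ) * χ z.snd) ⊆
      {z | z.fst ∈ tsupport α} := by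
    refine closure_minimal (fun z hz ↦ ?_) hcl
    by_contra h
    refine hz ?_
    change (α z.fst : ℂ) * χ z.snd = 0
    rw [image_eq_zero_of_notMem_tsupport h, Complex.ofReal_zero, zero_mul]
  have hcs : HasCompactSupport fun z : Spacetime ↦ (α z.fst : ℂ) * χ z.snd := by
    have hK : IsCompact (L.symm '' (tsupport α ×ˢ tsupport χ)) :=
      (IsCompact.prod hc hχ).image L.symm.continuous
    refine HasCompactSupport.intro hK fun z hz ↦ ?_
    by_contra h
    refine hz ⟨(z.fst, z.snd), ⟨subset_tsupport _ fun h0 ↦ h ?_, subset_tsupport _ fun h0 ↦ h ?_⟩, rfl⟩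
    · change α z.fst = 0 at h0
      rw [h0, Complex.ofReal_zero, zero_mul]
    · change χ z.snd = 0 at h0
      rw [h0, mul_zero]
  exact ⟨hcs.toSchwartzMap hs, fun z ↦ rfl, hcs, hsub⟩

theorem slice_lineDeriv_tensor {α : ℝ → ℝ} (hα : Differentiable ℝ α) {χ : 𝓢(Plane, ℂ)}
    {Φ : 𝓢(Spacetime, ℂ)} (hΦ : ∀ z, Φ z = (α z.fst : ℂ) * χ z.snd) (t : ℝ) :
    slice t (∂_{pt 1 0} Φ) = ((deriv α t : ℝ) : ℂ) • χ := by
  ext x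
  rw [slice_apply, SchwartzMap.lineDerivOp_apply, smul_apply, smul_eq_mul, lineDeriv]
  have e : (fun r : ℝ ↦ Φ (pt t x + r • pt 1 0)) = fun r : ℝ ↦ (α (t + r) : ℂ) * χ x := by
    funext r
    have : pt t x + r • pt 1 0 = pt (t + r) x := by
      simp [pt, ← WithLp.toLp_add, ← WithLp.toLp_smul]
    rw [this, hΦ]
    rfl
  rw [e]
  have h1 : HasDerivAt (fun r ↦ α (t + r)) (deriv α t) 0 := by
    have h2 : HasDerivAt α (deriv α t) (t + 0) := by
      rw [add_zero]
      exact (hα t).hasDerivAt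
    exact h2.comp_const_add t 0
  exact (h1.ofReal_comp.mul_const (χ x)).deriv

theorem slice_tensor {α : ℝ → ℝ} {χ : 𝓢(Plane, ℂ)} {Φ : 𝓢(Spacetime, ℂ)}
    (hΦ : ∀ z, Φ z = (α z.fst : ℂ) * χ z.snd) (t : ℝ) : slice t Φ = (α t : ℂ) • χ := by
  ext x
  rw [slice_apply, hΦ]
  rfl

theorem apply_fourier (u : 𝓢'(Plane, ℂ)) (p : 𝓢(Plane, ℂ)) : u (𝓕 p) = 𝓕 u p := rfl

theorem bessel_apply_fourier (s : ℝ) (u : 𝓢'(Plane, ℂ)) (p : 𝓢(Plane, ℂ)) :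
    bessel s u (𝓕 p) = 𝓕 u (wmul s p) := by
  rw [bessel, TemperedDistribution.fourierMultiplierCLM_apply_apply, FourierTransform.fourierInv_fourier_eq]
  rfl

/-- The time derivative of the Fourier transform of a solution of the half-wave equation. -/
noncomputable def halfWaveDeriv (σ : ℤˣ) (u F : ℝ → 𝓢'(Plane, ℂ)) (p : 𝓢(Plane, ℂ)) (t : ℝ) : ℂ :=
  -Complex.I * 𝓕 (F t) p + Complex.I * sgn σ * 𝓕 (u t) (wmul 1 p)

theorem norm_sgn (σ : ℤˣ) : ‖sgn σ‖ = 1 := by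
  rcases Int.units_eq_one_or σ with rfl | rfl <;> simp [sgn]

section Equation

variable {a b s₀ s₁ : ℝ} {σ : ℤˣ} {u F : ℝ → 𝓢'(Plane, ℂ)}

theorem halfWaveDeriv_continuousOn (hu : WeakSobolev (Set.Ioo a b) s₁ u)
    (hF : WeakSobolev (Set.Ioo a b) s₀ F) (p : 𝓢(Plane, ℂ)) :
    ContinuousOn (halfWaveDeriv σ u F p) (Set.Ioo a b) :=
  (continuousOn_const.mul (hF.cont p)).add (continuousOn_const.mul (hu.cont _))

/-- The weak equation is tested on products of a function of time with `𝓕 p`. The test functions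
must have compact support in space, hence the condition on `𝓕 p`. -/
theorem sub_eq_integral_of_hasCompactSupport (hu : WeakSobolev (Set.Ioo a b) s₁ u)
    (hF : WeakSobolev (Set.Ioo a b) s₀ F) (h : SolvesHalfWave (Set.Ioo a b) σ u F)
    {p : 𝓢(Plane, ℂ)} (hp : HasCompactSupport (𝓕 p : 𝓢(Plane, ℂ)))
    {s t : ℝ} (hs : s ∈ Set.Ioo a b) (ht : t ∈ Set.Ioo a b) :
    𝓕 (u t) p - 𝓕 (u s) p = ∫ r in s..t, halfWaveDeriv σ u F p r := by
  refine sub_eq_integral_of_weak_deriv (c := fun t ↦ 𝓕 (u t) p) (hu.cont p)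
    (halfWaveDeriv_continuousOn hu hF p) (fun α h1 h2 h3 ↦ ?_) hs ht
  obtain ⟨Φ, e1, e2, e3⟩ := exists_tensor h1 h2 hp
  have hT : IsTest (Set.Ioo a b) Φ := ⟨e2, fun z hz ↦ by
    rw [Set.mem_ofPred_eq, isOpen_Ioo.interior_eq]
    exact h3 (e3 hz)⟩
  have H := h Φ hT
  have i1 : IntegrableOn (fun t ↦ α t • 𝓕 (F t) p) (Set.Ioo a b) :=
    (integrable_smul_of_tsupport_subset isOpen_Ioo h1.continuous h2 h3 (hF.cont p)).integrableOn
  have i2 : IntegrableOn (fun t ↦ α t • 𝓕 (u t) (wmul 1 p)) (Set.Ioo a b) :=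
    (integrable_smul_of_tsupport_subset isOpen_Ioo h1.continuous h2 h3 (hu.cont _)).integrableOn
  have p1 : pair (Set.Ioo a b) u (-Complex.I • ∂_{pt 1 0} Φ) =
      -Complex.I * ∫ t in Set.Ioo a b, deriv α t • 𝓕 (u t) p := by
    rw [pair, ← integral_const_mul]
    refine integral_congr_ae (ae_of_all _ fun t ↦ ?_)
    change u t (slice t (-Complex.I • ∂_{pt 1 0} Φ)) = _
    rw [map_smul, slice_lineDeriv_tensor (h1.differentiable (by simp)) e1, map_smul, map_smul,
      apply_fourier]
    rfl
  have p2 : pair (Set.Ioo a b) (fun t ↦ bessel 1 (u t)) Φ =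
      ∫ t in Set.Ioo a b, α t • 𝓕 (u t) (wmul 1 p) := by
    refine integral_congr_ae (ae_of_all _ fun t ↦ ?_)
    change bessel 1 (u t) (slice t Φ) = _
    rw [slice_tensor e1, map_smul, bessel_apply_fourier]
    rfl
  have p3 : pair (Set.Ioo a b) F Φ = ∫ t in Set.Ioo a b, α t • 𝓕 (F t) p := by
    refine integral_congr_ae (ae_of_all _ fun t ↦ ?_)
    change F t (slice t Φ) = _
    rw [slice_tensor e1, map_smul, apply_fourier]
    rfl
  rw [p1, p2, p3] at H
  have e : ∀ t, α t • halfWaveDeriv σ u F p t = -Complex.I * (α t • 𝓕 (F t) p) +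
      Complex.I * sgn σ * (α t • 𝓕 (u t) (wmul 1 p)) := by
    intro t
    simp only [halfWaveDeriv, Complex.real_smul]
    ring
  simp_rw [e]
  rw [integral_add (i1.const_mul _) (i2.const_mul _), integral_const_mul, integral_const_mul, ← H]
  linear_combination
    (∫ t in Set.Ioo a b, deriv α t • 𝓕 (u t) p) * Complex.I_sq

theorem halfWaveDeriv_bound (hu : WeakSobolev (Set.Ioo a b) s₁ u)
    (hF : WeakSobolev (Set.Ioo a b) s₀ F) : ∃ C : ℝ, 0 ≤ C ∧ ∀ t ∈ Set.Ioo a b, ∀ p,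
      ‖halfWaveDeriv σ u F p t‖ ≤ C * (wnorm (-s₀) p + wnorm (-s₁) (wmul 1 p)) := by
  obtain ⟨C, hC, h⟩ := hu.bound
  obtain ⟨D, hD, h'⟩ := hF.bound
  refine ⟨C + D, by positivity, fun t ht p ↦ ?_⟩
  have n1 := wnorm_nonneg (-s₀) p
  have n2 := wnorm_nonneg (-s₁) (wmul 1 p)
  calc ‖halfWaveDeriv σ u F p t‖ ≤ ‖𝓕 (F t) p‖ + ‖𝓕 (u t) (wmul 1 p)‖ := by
        refine (norm_add_le _ _).trans (le_of_eq ?_)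
        rw [norm_mul, norm_mul, norm_mul, norm_sgn, norm_neg, Complex.norm_I, one_mul, one_mul,
          one_mul]
    _ ≤ D * wnorm (-s₀) p + C * wnorm (-s₁) (wmul 1 p) := add_le_add (h' t ht p) (h t ht _)
    _ ≤ _ := by nlinarith [mul_nonneg hC n1, mul_nonneg hD n2]

/-- Density of compactly supported functions removes the support condition. Both sides are
continuous in `p`; on the right this uses the bound of the integrand that is uniform in time. -/
theorem sub_eq_integral (hu : WeakSobolev (Set.Ioo a b) s₁ u)
    (hF : WeakSobolev (Set.Ioo a b) s₀ F) (h : SolvesHalfWave (Set.Ioo a b) σ u F)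
    (p : 𝓢(Plane, ℂ)) {s t : ℝ} (hs : s ∈ Set.Ioo a b) (ht : t ∈ Set.Ioo a b) :
    𝓕 (u t) p - 𝓕 (u s) p = ∫ r in s..t, halfWaveDeriv σ u F p r := by
  obtain ⟨g, hg, hlim⟩ := exists_hasCompactSupport_tendsto (𝓕 p : 𝓢(Plane, ℂ))
  let q : ℕ → 𝓢(Plane, ℂ) := fun n ↦ 𝓕⁻ (g n)
  have hq : Filter.Tendsto q Filter.atTop (nhds p) := by
    have h1 : Continuous fun f : 𝓢(Plane, ℂ) ↦ (𝓕⁻ f : 𝓢(Plane, ℂ)) :=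
      FourierTransform.continuous_fourierInv
    have h2 := (h1.tendsto (𝓕 p)).comp hlim
    rwa [FourierTransform.fourierInv_fourier_eq] at h2
  have hqc : ∀ n, HasCompactSupport (𝓕 (q n) : 𝓢(Plane, ℂ)) := fun n ↦ by
    simp only [q, FourierTransform.fourier_fourierInv_eq]
    exact hg n
  have hsub : Set.uIcc s t ⊆ Set.Ioo a b := Set.OrdConnected.uIcc_subset Set.ordConnected_Ioo hs ht
  obtain ⟨C, hC, hb⟩ := halfWaveDeriv_bound (σ := σ) hu hF
  have hw : Continuous fun p ↦ wnorm (-s₀) p + wnorm (-s₁) (wmul 1 p) :=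
    (wnorm_continuous _).add ((wnorm_continuous _).comp (wmul 1).continuous)
  -- Along the approximating sequence the controlling norms are eventually below their limit plus
  -- `1`, which provides a constant dominating function.
  have hev := ((hw.tendsto p).comp hq).eventually_lt_const (lt_add_one _)
  have l1 : Filter.Tendsto (fun n ↦ 𝓕 (u t) (q n) - 𝓕 (u s) (q n)) Filter.atTop
      (nhds (𝓕 (u t) p - 𝓕 (u s) p)) :=
    (((𝓕 (u t)).continuous.tendsto p).comp hq).sub (((𝓕 (u s)).continuous.tendsto p).comp hq)
  have l2 : Filter.Tendsto (fun n ↦ ∫ r in s..t, halfWaveDeriv σ u F (q n) r) Filter.atTop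
      (nhds (∫ r in s..t, halfWaveDeriv σ u F p r)) := by
    refine intervalIntegral.tendsto_integral_filter_of_dominated_convergence
      (fun _ ↦ C * (wnorm (-s₀) p + wnorm (-s₁) (wmul 1 p) + 1))
      (Filter.Eventually.of_forall fun n ↦ ?_) ?_ intervalIntegrable_const (ae_of_all _ fun r _ ↦ ?_)
    · exact ((halfWaveDeriv_continuousOn hu hF (q n)).mono
        (Set.uIoc_subset_uIcc.trans hsub)).aestronglyMeasurable measurableSet_uIoc
    · filter_upwards [hev] with n hn
      refine ae_of_all _ fun r hr ↦ (hb r (hsub (Set.uIoc_subset_uIcc hr)) _).trans ?_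
      exact mul_le_mul_of_nonneg_left hn.le hC
    · exact (tendsto_const_nhds.mul (((𝓕 (F r)).continuous.tendsto p).comp hq)).add
        (tendsto_const_nhds.mul
          (((𝓕 (u r)).continuous.tendsto _).comp (((wmul 1).continuous.tendsto p).comp hq)))
  refine tendsto_nhds_unique l1 (l2.congr fun n ↦ ?_)
  exact (sub_eq_integral_of_hasCompactSupport hu hF h (hqc n) hs ht).symm

theorem hasDerivAt_fourier (hu : WeakSobolev (Set.Ioo a b) s₁ u)
    (hF : WeakSobolev (Set.Ioo a b) s₀ F) (h : SolvesHalfWave (Set.Ioo a b) σ u F)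
    (p : 𝓢(Plane, ℂ)) {t : ℝ} (ht : t ∈ Set.Ioo a b) :
    HasDerivAt (fun t ↦ 𝓕 (u t) p) (halfWaveDeriv σ u F p t) t := by
  have hk := halfWaveDeriv_continuousOn (σ := σ) hu hF p
  have h1 : HasDerivAt (fun x ↦ ∫ r in t..x, halfWaveDeriv σ u F p r)
      (halfWaveDeriv σ u F p t) t :=
    intervalIntegral.integral_hasDerivAt_right IntervalIntegrable.refl
      (hk.stronglyMeasurableAtFilter isOpen_Ioo t ht) (hk.continuousAt (isOpen_Ioo.mem_nhds ht))
  refine (h1.add_const (𝓕 (u t) p)).congr_of_eventuallyEq ?_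
  filter_upwards [isOpen_Ioo.mem_nhds ht] with x hx
  rw [← sub_eq_integral hu hF h p ht hx, sub_add_cancel]

/-- A quadratic remainder bound for all real `x`: Taylor's formula for `|x| ≤ 1`, and the triangle
inequality, with `2|x| ≤ 3x²`, otherwise. -/
theorem norm_exp_I_sub_one_sub_le (x : ℝ) :
    ‖Complex.exp (Complex.I * x) - 1 - Complex.I * x‖ ≤ 3 * x ^ 2 := by
  have hn : ‖Complex.I * (x : ℂ)‖ = |x| := by simp
  rcases le_total |x| 1 with hx | hx
  · refine (Complex.norm_exp_sub_one_sub_id_le (hn.trans_le hx)).trans ?_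
    rw [hn, sq_abs]
    nlinarith [sq_nonneg x]
  · have h1 : ‖Complex.exp (Complex.I * x) - 1‖ ≤ |x| := Real.norm_exp_I_mul_ofReal_sub_one_le
    refine (norm_sub_le _ _).trans ?_
    rw [hn, ← sq_abs]
    nlinarith

/-- The derivative of the Fourier transform of a solution along the free evolution. -/
theorem hasDerivAt_fourier_evo (hu : WeakSobolev (Set.Ioo a b) s₁ u)
    (hF : WeakSobolev (Set.Ioo a b) s₀ F) (h : SolvesHalfWave (Set.Ioo a b) σ u F)
    (p : 𝓢(Plane, ℂ)) {r : ℝ} (hr : r ∈ Set.Ioo a b) :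
    HasDerivAt (fun t ↦ 𝓕 (u t) (evo (-(((σ : ℤ) : ℝ) * t)) p))
      (-Complex.I * 𝓕 (F r) (evo (-(((σ : ℤ) : ℝ) * r)) p)) r := by
  set ς : ℝ := ((σ : ℤ) : ℝ) with hς
  have hς2 : ς ^ 2 = 1 := by
    rw [hς]
    rcases Int.units_eq_one_or σ with rfl | rfl <;> simp
  have hsgn : sgn σ = (ς : ℂ) := by simp [sgn, hς]
  set q := evo (-(ς * r)) p with hq
  obtain ⟨C, hC, hb⟩ := hu.bound
  -- Both the distribution and its argument move with time. The argument is expanded to first order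
  -- at `r`: the zeroth order gives the derivative of `u`, the first order cancels its `⟨∇⟩` term,
  -- and the remainder `R` pairs to a quantity of order `(x - r)²` because `u` is bounded.
  let R : ℝ → 𝓢(Plane, ℂ) := fun x ↦
    evo (-(ς * (x - r))) q - q + (Complex.I * (ς * (x - r) : ℝ)) • wmul 1 q
  have hA := hasDerivAt_fourier hu hF h q hr
  have hB : HasDerivAt (fun x : ℝ ↦ (-(Complex.I * ς)) * (((x - r : ℝ) : ℂ) * 𝓕 (u x) (wmul 1 q)))
      ((-(Complex.I * ς)) * (𝓕 (u r) (wmul 1 q))) r := by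
    have h1 : HasDerivAt (fun x : ℝ ↦ ((x - r : ℝ) : ℂ)) 1 r := by
      exact_mod_cast ((hasDerivAt_id r).sub_const r).ofReal_comp
    have h2 := h1.mul (hasDerivAt_fourier hu hF h (wmul 1 q) hr)
    have h3 : ((r - r : ℝ) : ℂ) = 0 := by simp
    rw [h3, zero_mul, add_zero, one_mul] at h2
    exact h2.const_mul _
  have hR : HasDerivAt (fun x ↦ 𝓕 (u x) (R x)) 0 r := by
    have hO : (fun x ↦ 𝓕 (u x) (R x)) =O[nhds r] fun x ↦ ‖x - r‖ ^ 2 := by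
      refine Asymptotics.IsBigO.of_bound (C * (3 * wnorm (-s₁) (wmul 2 q))) ?_
      filter_upwards [isOpen_Ioo.mem_nhds hr] with x hx
      refine (hb x hx _).trans ?_
      rw [norm_pow, norm_norm, mul_assoc]
      refine mul_le_mul_of_nonneg_left ?_ hC
      have h1 : wnorm (-s₁) (R x) ≤ (3 * ‖x - r‖ ^ 2) * wnorm (-s₁) (wmul 2 q) := by
        refine wnorm_le_of_le fun ξ ↦ ?_
        have e : R x ξ = (Complex.exp (Complex.I * (-(ς * (x - r)) * wt 1 ξ : ℝ)) - 1 -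
            Complex.I * (-(ς * (x - r)) * wt 1 ξ : ℝ)) * q ξ := by
          change evo (-(ς * (x - r))) q ξ - q ξ + (Complex.I * (ς * (x - r) : ℝ)) * wmul 1 q ξ = _
          rw [evo_apply, wmul_apply, besselSymbol_eq, evoSymbol]
          push_cast
          ring
        rw [e, norm_mul, norm_wmul_apply]
        have h2 := norm_exp_I_sub_one_sub_le (-(ς * (x - r)) * wt 1 ξ)
        have h3 : (-(ς * (x - r)) * wt 1 ξ) ^ 2 = ‖x - r‖ ^ 2 * wt 2 ξ := by
          have : wt 2 ξ = wt 1 ξ ^ 2 := by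
            rw [wt_sq]
            norm_num
          rw [this, Real.norm_eq_abs, sq_abs]
          linear_combination (x - r) ^ 2 * wt 1 ξ ^ 2 * hς2
        rw [h3] at h2
        calc _ ≤ wt (-s₁) ξ * ((3 * (‖x - r‖ ^ 2 * wt 2 ξ)) * ‖q ξ‖) := by
              have := (wt_pos (-s₁) ξ).le
              gcongr
          _ = _ := by ring
      linarith
    rw [hasDerivAt_iff_hasFDerivAt]
    simpa using hO.hasFDerivAt one_lt_two
  have hsum := (hA.add hB).add hR
  have ed : halfWaveDeriv σ u F q r + (-(Complex.I * ς)) * (𝓕 (u r) (wmul 1 q)) + 0 =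
      -Complex.I * 𝓕 (F r) q := by
    rw [halfWaveDeriv, hsgn]
    ring
  rw [ed] at hsum
  refine hsum.congr_of_eventuallyEq (Filter.Eventually.of_forall fun x ↦ ?_)
  have e1 : evo (-(ς * x)) p = q + (-(Complex.I * ς * ((x - r : ℝ) : ℂ))) • wmul 1 q + R x := by
    have : -(ς * x) = -(ς * (x - r)) + -(ς * r) := by ring
    rw [this, evo_add, ← hq]
    simp only [R]
    push_cast
    module
  change 𝓕 (u x) (evo (-(ς * x)) p) = 𝓕 (u x) q + _ + 𝓕 (u x) (R x)
  rw [e1, map_add, map_add, map_smul, smul_eq_mul]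
  ring

/-- Along the free evolution a solution of the half-wave equation is Lipschitz, with values in the
space of the right hand side. -/
theorem exists_norm_sub_le (hu : WeakSobolev (Set.Ioo a b) s₁ u)
    (hF : WeakSobolev (Set.Ioo a b) s₀ F) (h : SolvesHalfWave (Set.Ioo a b) σ u F) :
    ∃ C : ℝ, 0 ≤ C ∧ ∀ p : 𝓢(Plane, ℂ), ∀ s ∈ Set.Ioo a b, ∀ t ∈ Set.Ioo a b,
      ‖𝓕 (u t) (evo (-(((σ : ℤ) : ℝ) * t)) p) - 𝓕 (u s) (evo (-(((σ : ℤ) : ℝ) * s)) p)‖ ≤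
        C * wnorm (-s₀) p * |t - s| := by
  obtain ⟨C, hC, hb⟩ := hF.bound
  refine ⟨C, hC, fun p s hs t ht ↦ ?_⟩
  refine Convex.norm_image_sub_le_of_norm_hasDerivWithin_le (𝕜 := ℝ)
    (fun r hr ↦ (hasDerivAt_fourier_evo hu hF h p hr).hasDerivWithinAt) (fun r hr ↦ ?_)
    (convex_Ioo a b) hs ht
  rw [norm_mul, norm_neg, Complex.norm_I, one_mul]
  refine (hb r hr _).trans (le_of_eq ?_)
  rw [wnorm_evo]

end Equation

/-! ### Extension in time -/

/-- A curve of linear forms on Schwartz functions of frequency, of compact support in time, bounded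
in the dual of the `L²` space with weight `⟨ξ⟩ ^ (-s₁)` and Lipschitz in the dual of the `L²` space
with weight `⟨ξ⟩ ^ (-s₀)`. -/
structure LipschitzCurve (s₀ s₁ C R : ℝ) (Z : ℝ → 𝓢(Plane, ℂ) →ₗ[ℂ] ℂ) : Prop where
  nonneg : 0 ≤ C
  bound : ∀ t p, ‖Z t p‖ ≤ C * wnorm (-s₁) p
  lipschitz : ∀ t s p, ‖Z t p - Z s p‖ ≤ C * wnorm (-s₀) p * |t - s|
  eq_zero : ∀ t, R < |t| → Z t = 0

/-- The contraction with factor `1 - 1 / (n + 2)` of the projection to `[a, b]`. -/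
noncomputable def innerPoint (a b : ℝ) (n : ℕ) (t : ℝ) : ℝ :=
  max a (min b t) + (1 / ((n : ℝ) + 2)) * ((a + b) / 2 - max a (min b t))

theorem abs_clamp_sub_le (a b s t : ℝ) : |max a (min b t) - max a (min b s)| ≤ |t - s| :=
  (abs_max_sub_max_le_max _ _ _ _).trans
    (max_le (by simp) ((abs_min_sub_min_le_max _ _ _ _).trans (max_le (by simp) le_rfl)))

theorem innerPoint_mem {a b : ℝ} (hab : a < b) (n : ℕ) (t : ℝ) :
    innerPoint a b n t ∈ Set.Ioo a b := by
  have h1 : (0 : ℝ) < 1 / ((n : ℝ) + 2) := by positivity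
  have h2 : 1 / ((n : ℝ) + 2) < 1 := by
    rw [div_lt_one (by positivity)]
    linarith [n.cast_nonneg (α := ℝ)]
  have h3 : a ≤ max a (min b t) := le_max_left _ _
  have h4 : max a (min b t) ≤ b := max_le hab.le (min_le_left _ _)
  rw [innerPoint]
  constructor <;> nlinarith

theorem abs_innerPoint_sub_le (a b : ℝ) (n : ℕ) (s t : ℝ) :
    |innerPoint a b n t - innerPoint a b n s| ≤ |t - s| := by
  have h1 : (0 : ℝ) ≤ 1 / ((n : ℝ) + 2) := by positivity
  have h2 : 1 / ((n : ℝ) + 2) ≤ 1 := by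
    rw [div_le_one (by positivity)]
    linarith [n.cast_nonneg (α := ℝ)]
  have e : innerPoint a b n t - innerPoint a b n s =
      (1 - 1 / ((n : ℝ) + 2)) * (max a (min b t) - max a (min b s)) := by
    rw [innerPoint, innerPoint]
    ring
  rw [e, abs_mul, abs_of_nonneg (by linarith)]
  refine (mul_le_of_le_one_left (abs_nonneg _) (by linarith)).trans (abs_clamp_sub_le a b s t)

theorem tendsto_innerPoint (a b t : ℝ) :
    Filter.Tendsto (fun n ↦ innerPoint a b n t) Filter.atTop (nhds (max a (min b t))) := by
  have h : Filter.Tendsto (fun n : ℕ ↦ 1 / ((n : ℝ) + 2)) Filter.atTop (nhds 0) := by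
    have := tendsto_const_div_atTop_nhds_zero_nat (1 : ℝ)
    have h2 := (Filter.tendsto_add_atTop_iff_nat 2).2 this
    refine h2.congr fun n ↦ ?_
    push_cast
    rfl
  simpa [innerPoint] using tendsto_const_nhds.add (h.mul_const ((a + b) / 2 - max a (min b t)))

/-! ### Cutoff and extension of the profile to the whole line -/

/-- A cutoff in time. -/
noncomputable def timeCutoff (a b t : ℝ) : ℝ := max (1 - |t - max a (min b t)|) 0

theorem timeCutoff_nonneg (a b t : ℝ) : 0 ≤ timeCutoff a b t := le_max_right _ _

theorem timeCutoff_le_one (a b t : ℝ) : timeCutoff a b t ≤ 1 :=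
  max_le (by linarith [abs_nonneg (t - max a (min b t))]) zero_le_one

theorem abs_timeCutoff_sub_le (a b s t : ℝ) :
    |timeCutoff a b t - timeCutoff a b s| ≤ 2 * |t - s| := by
  refine (abs_max_sub_max_le_abs _ _ _).trans ?_
  rw [sub_sub_sub_cancel_left, abs_sub_comm]
  refine (abs_abs_sub_abs_le_abs_sub _ _).trans ?_
  have e : t - max a (min b t) - (s - max a (min b s)) =
      (t - s) - (max a (min b t) - max a (min b s)) := by ring
  rw [e]
  refine (abs_sub _ _).trans ?_
  linarith [abs_clamp_sub_le a b s t]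

theorem timeCutoff_eq_one {a b t : ℝ} (ht : t ∈ Set.Ioo a b) : timeCutoff a b t = 1 := by
  simp [timeCutoff, min_eq_right ht.2.le, max_eq_right ht.1.le]

theorem timeCutoff_eq_zero {a b t : ℝ} (hab : a < b) (ht : |a| + |b| + 1 < |t|) :
    timeCutoff a b t = 0 := by
  refine max_eq_right ?_
  have h1 : |max a (min b t)| ≤ |a| + |b| := by
    have h3 : a ≤ max a (min b t) := le_max_left _ _
    have h4 : max a (min b t) ≤ b := max_le hab.le (min_le_left _ _)
    rw [abs_le]
    constructor
    · linarith [neg_abs_le a, abs_nonneg b]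
    · linarith [le_abs_self b, abs_nonneg a]
  have h2 := abs_sub_abs_le_abs_sub t (max a (min b t))
  linarith

/-- The Lipschitz condition provides limits at the endpoints, at which the curve is frozen outside
`(a, b)`; `innerPoint` approaches the clamped time from inside, so bounds and linearity pass to the
limit. The cutoff then gives compact support. -/
theorem exists_lipschitzCurve {a b s₀ s₁ C₀ C₁ : ℝ} (hab : a < b) (hs : s₀ ≤ s₁)
    {g : ℝ → 𝓢(Plane, ℂ) →ₗ[ℂ] ℂ} (hC₀ : 0 ≤ C₀) (hC₁ : 0 ≤ C₁)
    (hb : ∀ t ∈ Set.Ioo a b, ∀ p, ‖g t p‖ ≤ C₁ * wnorm (-s₁) p)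
    (hl : ∀ p, ∀ s ∈ Set.Ioo a b, ∀ t ∈ Set.Ioo a b,
      ‖g t p - g s p‖ ≤ C₀ * wnorm (-s₀) p * |t - s|) :
    ∃ Z C R, LipschitzCurve s₀ s₁ C R Z ∧ ∀ t ∈ Set.Ioo a b, Z t = g t := by
  have hlim : ∀ t p, ∃ z, Filter.Tendsto (fun n ↦ g (innerPoint a b n t) p) Filter.atTop
      (nhds z) := by
    intro t p
    have hK : 0 ≤ C₀ * wnorm (-s₀) p := mul_nonneg hC₀ (wnorm_nonneg _ _)
    have hcs := (tendsto_innerPoint a b t).cauchySeq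
    have hcs' : CauchySeq fun n ↦ g (innerPoint a b n t) p := by
      rw [Metric.cauchySeq_iff] at hcs ⊢
      intro ε hε
      obtain ⟨N, hN⟩ := hcs (ε / (C₀ * wnorm (-s₀) p + 1)) (by positivity)
      refine ⟨N, fun m hm n hn ↦ ?_⟩
      have h1 := hN m hm n hn
      rw [lt_div_iff₀ (by positivity), Real.dist_eq] at h1
      rw [dist_eq_norm]
      refine (hl p _ (innerPoint_mem hab n t) _ (innerPoint_mem hab m t)).trans_lt ?_
      nlinarith [abs_nonneg (innerPoint a b m t - innerPoint a b n t)]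
    exact cauchySeq_tendsto_of_complete hcs'
  choose G hG using hlim
  have hGb : ∀ t p, ‖G t p‖ ≤ C₁ * wnorm (-s₁) p := fun t p ↦
    le_of_tendsto (hG t p).norm (Filter.Eventually.of_forall fun n ↦ hb _ (innerPoint_mem hab n t) p)
  have hGl : ∀ t s p, ‖G t p - G s p‖ ≤ C₀ * wnorm (-s₀) p * |t - s| := fun t s p ↦
    le_of_tendsto ((hG t p).sub (hG s p)).norm (Filter.Eventually.of_forall fun n ↦
      (hl p _ (innerPoint_mem hab n s) _ (innerPoint_mem hab n t)).trans
        (mul_le_mul_of_nonneg_left (abs_innerPoint_sub_le a b n s t)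
          (mul_nonneg hC₀ (wnorm_nonneg _ _))))
  have hadd : ∀ t p q, G t (p + q) = G t p + G t q := fun t p q ↦
    tendsto_nhds_unique (hG t (p + q)) (((hG t p).add (hG t q)).congr fun n ↦ (map_add _ _ _).symm)
  have hsmul : ∀ t (c : ℂ) p, G t (c • p) = c • G t p := fun t c p ↦
    tendsto_nhds_unique (hG t (c • p)) (((hG t p).const_smul c).congr fun n ↦ (map_smul _ _ _).symm)
  let Z : ℝ → 𝓢(Plane, ℂ) →ₗ[ℂ] ℂ := fun t ↦
    (timeCutoff a b t : ℂ) • { toFun := G t, map_add' := hadd t, map_smul' := hsmul t }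
  have hZ : ∀ t p, Z t p = (timeCutoff a b t : ℂ) * G t p := fun t p ↦ rfl
  refine ⟨Z, C₀ + 2 * C₁, |a| + |b| + 1, ⟨by positivity, fun t p ↦ ?_, fun t s p ↦ ?_,
    fun t ht ↦ ?_⟩, fun t ht ↦ ?_⟩
  · rw [hZ, norm_mul, Complex.norm_real, Real.norm_of_nonneg (timeCutoff_nonneg a b t)]
    have h1 := hGb t p
    have h2 := wnorm_nonneg (-s₁) p
    calc _ ≤ 1 * ‖G t p‖ := by gcongr; exact timeCutoff_le_one a b t
      _ ≤ _ := by nlinarith [mul_nonneg hC₀ h2, mul_nonneg hC₁ h2]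
  · have e : Z t p - Z s p = (timeCutoff a b t : ℂ) * (G t p - G s p) +
        ((timeCutoff a b t - timeCutoff a b s : ℝ) : ℂ) * G s p := by
      rw [hZ, hZ]
      push_cast
      ring
    rw [e]
    refine (norm_add_le _ _).trans ?_
    rw [norm_mul, norm_mul, Complex.norm_real, Complex.norm_real,
      Real.norm_of_nonneg (timeCutoff_nonneg a b t), Real.norm_eq_abs]
    have h1 := (hGb s p).trans (mul_le_mul_of_nonneg_left
      (wnorm_mono (neg_le_neg hs) p) hC₁)
    -- Product rule: the Lipschitz constant `C₀` of the curve, plus the Lipschitz constant `2` of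
    -- the cutoff times the bound `C₁`. The latter is measured in the weaker dual norm, which is
    -- where `s₀ ≤ s₁` enters.
    calc _ ≤ 1 * (C₀ * wnorm (-s₀) p * |t - s|) + 2 * |t - s| * (C₁ * wnorm (-s₀) p) :=
          add_le_add (mul_le_mul (timeCutoff_le_one a b t) (hGl t s p) (norm_nonneg _) zero_le_one)
            (mul_le_mul (abs_timeCutoff_sub_le a b s t) h1 (norm_nonneg _) (by positivity))
      _ = _ := by ring
  · ext p
    rw [hZ, timeCutoff_eq_zero hab ht, Complex.ofReal_zero, zero_mul]
    rfl
  · ext p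
    rw [hZ, timeCutoff_eq_one ht, Complex.ofReal_one, one_mul]
    refine tendsto_nhds_unique (hG t p) ?_
    have h1 := tendsto_innerPoint a b t
    rw [min_eq_right ht.2.le, max_eq_right ht.1.le] at h1
    rw [tendsto_iff_norm_sub_tendsto_zero]
    have h2 : Filter.Tendsto (fun n ↦ C₀ * wnorm (-s₀) p * |innerPoint a b n t - t|)
        Filter.atTop (nhds 0) := by
      have := ((h1.sub_const t).abs).const_mul (C₀ * wnorm (-s₀) p)
      simpa using this
    exact squeeze_zero (fun _ ↦ norm_nonneg _)
      (fun n ↦ hl p _ ht _ (innerPoint_mem hab n t)) h2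

section Equation

variable {a b s₀ s₁ : ℝ} {σ : ℤˣ} {u F : ℝ → 𝓢'(Plane, ℂ)}

theorem exists_lipschitzCurve_of_solvesHalfWave (hab : a < b) (hs : s₀ ≤ s₁)
    (hu : WeakSobolev (Set.Ioo a b) s₁ u)
    (hF : WeakSobolev (Set.Ioo a b) s₀ F) (h : SolvesHalfWave (Set.Ioo a b) σ u F) :
    ∃ Z C R, LipschitzCurve s₀ s₁ C R Z ∧
      ∀ t ∈ Set.Ioo a b, ∀ p, Z t p = 𝓕 (u t) (evo (-(((σ : ℤ) : ℝ) * t)) p) := by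
  obtain ⟨C₁, hC₁, hb⟩ := hu.bound
  obtain ⟨C₀, hC₀, hl⟩ := exists_norm_sub_le hu hF h
  let g : ℝ → 𝓢(Plane, ℂ) →ₗ[ℂ] ℂ := fun t ↦
    { toFun := fun p ↦ 𝓕 (u t) (evo (-(((σ : ℤ) : ℝ) * t)) p)
      map_add' := fun p q ↦ by rw [map_add, map_add]
      map_smul' := fun c p ↦ by rw [map_smul, map_smul, RingHom.id_apply] }
  obtain ⟨Z, C, R, hZ, e⟩ := exists_lipschitzCurve (g := g) hab hs hC₀ hC₁
    (fun t ht p ↦ (hb t ht _).trans (by rw [wnorm_evo])) hl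
  exact ⟨Z, C, R, hZ, fun t ht p ↦ by rw [e t ht]; rfl⟩

end Equation

/-! ### Slices of Schwartz functions on space-time -/

theorem norm_le_norm_pt (t : ℝ) (x : Plane) : ‖x‖ ≤ ‖pt t x‖ := by
  refine (sq_le_sq₀ (by positivity) (norm_nonneg _)).1 ?_
  rw [WithLp.prod_norm_sq_eq_of_L2]
  exact le_add_of_nonneg_left (sq_nonneg _)

theorem abs_le_norm_pt (t : ℝ) (x : Plane) : |t| ≤ ‖pt t x‖ := by
  refine (sq_le_sq₀ (by positivity) (norm_nonneg _)).1 ?_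
  rw [WithLp.prod_norm_sq_eq_of_L2]
  exact le_add_of_nonneg_right (sq_nonneg _)

theorem inner_pt (t τ : ℝ) (x ξ : Plane) :
    inner ℝ (pt τ ξ) (pt t x) = τ * t + inner ℝ ξ x := by
  rw [WithLp.prod_inner_apply]
  simp [pt, mul_comm]

theorem exists_decay {E : Type*} [NormedAddCommGroup E] [NormedSpace ℝ E] (f : 𝓢(E, ℂ)) (k : ℕ) :
    ∃ C : ℝ, 0 ≤ C ∧ ∀ z, (1 + ‖z‖) ^ k * ‖f z‖ ≤ C := by
  refine ⟨2 ^ k * (Finset.Iic (k, 0)).sup (fun m ↦ SchwartzMap.seminorm ℝ m.1 m.2) f,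
    mul_nonneg (by positivity) (apply_nonneg _ _), fun z ↦ ?_⟩
  simpa using SchwartzMap.one_add_le_sup_seminorm_apply (𝕜 := ℝ) (m := (k, 0)) (k := k) (n := 0)
    le_rfl le_rfl f z

theorem norm_toLp_sq {E : Type*} [NormedAddCommGroup E] [InnerProductSpace ℝ E]
    [FiniteDimensional ℝ E] [MeasurableSpace E] [BorelSpace E] (f : 𝓢(E, ℂ)) :
    ‖f.toLp 2 volume‖ ^ 2 = ∫ x, ‖f x‖ ^ 2 := by
  apply Complex.ofRealLI.injective
  have h := SchwartzMap.inner_toL2_toL2_eq f f (volume : Measure E)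
  rw [inner_self_eq_norm_sq_to_K] at h
  simp only [inner_self_eq_norm_sq_to_K] at h
  rw [← LinearIsometry.integral_comp_comm]
  simpa using h

theorem integrable_norm_sq {E : Type*} [NormedAddCommGroup E] [InnerProductSpace ℝ E]
    [FiniteDimensional ℝ E] [MeasurableSpace E] [BorelSpace E] (f : 𝓢(E, ℂ)) :
    Integrable fun x ↦ ‖f x‖ ^ 2 :=
  (memLp_two_iff_integrable_sq_norm f.continuous.aestronglyMeasurable).1 (f.memLp 2)

theorem integrable_comp_toLp {G : Type*} [NormedAddCommGroup G] {f : Spacetime → G}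
    (hf : Integrable f) : Integrable (fun z : ℝ × Plane ↦ f (pt z.1 z.2)) := by
  rw [Measure.volume_eq_prod]
  exact (WithLp.volume_preserving_toLp ℝ Plane).integrable_comp_of_integrable hf

theorem integral_pt {G : Type*} [NormedAddCommGroup G] [NormedSpace ℝ G] (f : Spacetime → G) :
    ∫ z : ℝ × Plane, f (pt z.1 z.2) = ∫ z, f z := by
  rw [Measure.volume_eq_prod]
  exact (WithLp.volume_preserving_toLp ℝ Plane).integral_comp
    (MeasurableEquiv.toLp 2 (ℝ × Plane)).measurableEmbedding f

theorem integral_norm_sq_slice (Ψ : 𝓢(Spacetime, ℂ)) :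
    Integrable (fun t ↦ ‖(slice t Ψ).toLp 2 volume‖ ^ 2) ∧
      ∫ t, ‖(slice t Ψ).toLp 2 volume‖ ^ 2 = ‖Ψ.toLp 2 volume‖ ^ 2 := by
  have h := integrable_comp_toLp (integrable_norm_sq Ψ)
  rw [Measure.volume_eq_prod] at h
  simp_rw [norm_toLp_sq, slice_apply]
  refine ⟨h.integral_prod_left, ?_⟩
  rw [← integral_pt, Measure.volume_eq_prod, integral_prod _ h]

/-- Slices depend on time in a Lipschitz way. -/
theorem exists_norm_slice_sub_le (Ψ : 𝓢(Spacetime, ℂ)) : ∃ K : ℝ, 0 ≤ K ∧ ∀ r t,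
    ‖(slice t Ψ - slice r Ψ).toLp 2 volume‖ ≤ K * |t - r| := by
  obtain ⟨C, hC, h⟩ := exists_decay (∂_{pt 1 0} Ψ) 2
  -- The time derivative of `Ψ` is `O((1 + ‖x‖) ^ (-2))`; its square has decay exponent `4`,
  -- integrable in the plane.
  let w : Plane → ℝ := fun x ↦ C ^ 2 * (1 + ‖x‖) ^ (-(4 : ℝ))
  have hw : Integrable w := (integrable_one_add_norm (by simp; norm_num)).const_mul _
  have hw0 : 0 ≤ ∫ x, w x := integral_nonneg fun x ↦ by positivity
  have hd : ∀ r t x, ‖Ψ (pt t x) - Ψ (pt r x)‖ ≤ C / (1 + ‖x‖) ^ 2 * |t - r| := by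
    intro r t x
    have hder : ∀ s : ℝ, HasDerivAt (fun s ↦ Ψ (pt s x)) ((∂_{pt 1 0} Ψ) (pt s x)) s := by
      intro s
      have e : (fun s ↦ pt s x) = fun s : ℝ ↦ s • pt 1 0 + pt 0 x := by
        funext s
        simp [pt, ← WithLp.toLp_add, ← WithLp.toLp_smul]
      have h1 : HasDerivAt (fun s ↦ pt s x) (pt 1 0) s := by
        rw [e]
        simpa using ((hasDerivAt_id s).smul_const (pt 1 0)).add_const (pt 0 x)
      rw [SchwartzMap.lineDerivOp_apply_eq_fderiv]
      exact (Ψ.differentiableAt (x := pt s x)).hasFDerivAt.comp_hasDerivAt s h1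
    refine Convex.norm_image_sub_le_of_norm_hasDerivWithin_le (𝕜 := ℝ) (s := Set.univ)
      (fun s _ ↦ (hder s).hasDerivWithinAt) (fun s _ ↦ ?_) convex_univ (Set.mem_univ _)
      (Set.mem_univ _)
    rw [le_div_iff₀ (by positivity), mul_comm]
    refine le_trans ?_ (h (pt s x))
    gcongr
    exact norm_le_norm_pt s x
  refine ⟨Real.sqrt (∫ x, w x), Real.sqrt_nonneg _, fun r t ↦ ?_⟩
  refine (sq_le_sq₀ (norm_nonneg _) (by positivity)).1 ?_
  rw [norm_toLp_sq, mul_pow, Real.sq_sqrt hw0, ← integral_mul_const]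
  refine integral_mono (integrable_norm_sq _) (hw.mul_const _) fun x ↦ ?_
  change ‖Ψ (pt t x) - Ψ (pt r x)‖ ^ 2 ≤ _
  refine (pow_le_pow_left₀ (norm_nonneg _) (hd r t x) 2).trans (le_of_eq ?_)
  have : (1 + ‖x‖) ^ (-(4 : ℝ)) = ((1 + ‖x‖) ^ 4)⁻¹ := by
    rw [Real.rpow_neg (by positivity)]
    norm_cast
  simp only [w, this]
  field_simp

/-! ### The Fourier transform in time -/

/-- The inverse Fourier transform in space of the Fourier transform in space-time. -/
noncomputable def timeFourier (t : ℝ) : 𝓢(Spacetime, ℂ) →ₗ[ℂ] 𝓢(Plane, ℂ) where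
  toFun χ := 𝓕⁻ (slice t (𝓕 χ))
  map_add' χ₁ χ₂ := by rw [FourierTransform.fourier_add, map_add, FourierTransform.fourierInv_add]
  map_smul' c χ := by
    rw [FourierTransform.fourier_smul, map_smul, FourierTransform.fourierInv_smul, RingHom.id_apply]

theorem timeFourier_eq (t : ℝ) (χ : 𝓢(Spacetime, ℂ)) :
    timeFourier t χ = 𝓕⁻ (slice t (𝓕 χ)) := rfl

theorem fourier_timeFourier (t : ℝ) (χ : 𝓢(Spacetime, ℂ)) :
    𝓕 (timeFourier t χ) = slice t (𝓕 χ) := FourierTransform.fourier_fourierInv_eq _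

theorem norm_toLp_timeFourier (t : ℝ) (χ : 𝓢(Spacetime, ℂ)) :
    ‖(timeFourier t χ).toLp 2 volume‖ = ‖(slice t (𝓕 χ)).toLp 2 volume‖ := by
  rw [← SchwartzMap.norm_fourier_toL2_eq, fourier_timeFourier]

/-- Plancherel in time, obtained from Plancherel in space at each time, Fubini, and Plancherel in
space-time. -/
theorem integral_norm_sq_timeFourier (χ : 𝓢(Spacetime, ℂ)) :
    Integrable (fun t ↦ ‖(timeFourier t χ).toLp 2 volume‖ ^ 2) ∧
      ∫ t, ‖(timeFourier t χ).toLp 2 volume‖ ^ 2 = ‖χ.toLp 2 volume‖ ^ 2 := by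
  simp_rw [norm_toLp_timeFourier]
  rw [← SchwartzMap.norm_fourier_toL2_eq χ]
  exact integral_norm_sq_slice _

theorem exists_norm_timeFourier_sub_le (χ : 𝓢(Spacetime, ℂ)) : ∃ K : ℝ, 0 ≤ K ∧ ∀ r t,
    ‖(timeFourier t χ - timeFourier r χ).toLp 2 volume‖ ≤ K * |t - r| := by
  obtain ⟨K, hK, h⟩ := exists_norm_slice_sub_le (𝓕 χ)
  refine ⟨K, hK, fun r t ↦ ?_⟩
  rw [← SchwartzMap.norm_fourier_toL2_eq, sub_eq_add_neg, FourierTransform.fourier_add,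
    FourierTransform.fourier_neg, fourier_timeFourier, fourier_timeFourier, ← sub_eq_add_neg]
  exact h r t

/-- The partial transform `q` in time is continuous and integrable, and its spatial transform is the
slice of the full transform, so Fourier inversion in the plane applies. The formula shows how
`timeFourier` interacts with symbols in `ξ` and with modulations in `τ`. -/
theorem timeFourier_apply (t : ℝ) (χ : 𝓢(Spacetime, ℂ)) (ξ : Plane) :
    timeFourier t χ ξ = ∫ τ, 𝐞 (-(τ * t)) • χ (pt τ ξ) := by
  let q : Plane → ℂ := fun ξ ↦ ∫ τ, 𝐞 (-(τ * t)) • χ (pt τ ξ)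
  have hcont : ∀ x : Plane, Continuous fun z : Spacetime ↦ 𝐞 (-inner ℝ z (pt t x)) • χ z :=
    fun x ↦ (Real.continuous_fourierChar.comp (by fun_prop)).smul χ.continuous
  have hi : ∀ x : Plane, Integrable fun z : Spacetime ↦ 𝐞 (-inner ℝ z (pt t x)) • χ z := fun x ↦
    χ.integrable.norm.mono' (hcont x).aestronglyMeasurable
      (ae_of_all _ fun z ↦ by rw [Circle.norm_smul])
  have hqc : Continuous q := by
    obtain ⟨C, hC, h⟩ := exists_decay χ 2
    refine continuous_of_dominated (bound := fun τ : ℝ ↦ C * (1 + ‖τ‖) ^ (-(2 : ℝ))) (fun ξ ↦ ?_)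
      (fun ξ ↦ ae_of_all _ fun τ ↦ ?_) ((integrable_one_add_norm (by simp)).const_mul _)
      (ae_of_all _ fun τ ↦ ?_)
    · have : Continuous fun τ : ℝ ↦ pt τ ξ :=
        (WithLp.prodContinuousLinearEquiv 2 ℝ ℝ Plane).symm.continuous.comp
          (continuous_id.prodMk continuous_const)
      exact ((Real.continuous_fourierChar.comp (by fun_prop)).smul
        (χ.continuous.comp this)).aestronglyMeasurable
    · have e : (1 + ‖τ‖) ^ (-(2 : ℝ)) = ((1 + ‖τ‖) ^ 2)⁻¹ := by
        rw [Real.rpow_neg (by positivity)]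
        norm_cast
      rw [Circle.norm_smul, e, ← div_eq_mul_inv, le_div_iff₀ (by positivity), mul_comm]
      refine le_trans ?_ (h (pt τ ξ))
      gcongr
      exact abs_le_norm_pt τ ξ
    · exact (χ.continuous.comp (pt_isometry τ).continuous).const_smul _
  have hqi : Integrable q := by
    have h := integrable_comp_toLp (hi 0)
    rw [Measure.volume_eq_prod] at h
    refine h.integral_prod_right.congr (ae_of_all _ fun ξ ↦ ?_)
    simp only [q, inner_pt, inner_zero_right, add_zero]
  have hF : 𝓕 q = (slice t (𝓕 χ) : Plane → ℂ) := by
    funext x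
    have h := integrable_comp_toLp (hi x)
    rw [Measure.volume_eq_prod] at h
    rw [slice_apply, SchwartzMap.fourier_coe, Real.fourier_eq, Real.fourier_eq, ← integral_pt,
      Measure.volume_eq_prod, integral_prod_symm _ h]
    congr 1
    funext ξ
    simp only [q, Circle.smul_def]
    rw [← integral_smul]
    congr 1
    funext τ
    rw [inner_pt, neg_add, Real.fourierChar.map_add_eq_mul, Circle.coe_mul, smul_smul, mul_comm]
  have h := hqc.fourierInv_fourier_eq hqi (by rw [hF]; exact (slice t (𝓕 χ)).integrable)
  rw [timeFourier_eq, SchwartzMap.fourierInv_coe, ← hF, h]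

theorem timeFourier_of_eq_mul {χ χ' : 𝓢(Spacetime, ℂ)} {w : Plane → ℂ}
    (h : ∀ z, χ' z = w z.snd * χ z) (t : ℝ) (ξ : Plane) :
    timeFourier t χ' ξ = w ξ * timeFourier t χ ξ := by
  rw [timeFourier_apply, timeFourier_apply, ← integral_const_mul]
  congr 1
  funext τ
  rw [h, mul_smul_comm]
  rfl

/-- A modulation in `τ` is a translation in time. -/
theorem timeFourier_of_eq_mul_modulate {χ χ' : 𝓢(Spacetime, ℂ)} {w : Plane → ℂ} {k : ℝ}
    (h : ∀ z, χ' z = w z.snd * (𝐞 (-(z.fst * k)) * χ z)) (t : ℝ) (ξ : Plane) :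
    timeFourier t χ' ξ = w ξ * timeFourier (t + k) χ ξ := by
  rw [timeFourier_apply, timeFourier_apply, ← integral_const_mul]
  congr 1
  funext τ
  rw [h, mul_add, neg_add, Real.fourierChar.map_add_eq_mul, Circle.smul_def, Circle.smul_def,
    Circle.coe_mul, smul_eq_mul, smul_eq_mul]
  change _ * (w ξ * (↑(𝐞 (-(τ * k))) * χ (pt τ ξ))) = _
  ring

/-- Multiplication by `⟨2πξ⟩ ^ s` on space-time. -/
noncomputable def stmul (s : ℝ) : 𝓢(Spacetime, ℂ) →L[ℂ] 𝓢(Spacetime, ℂ) :=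
  SchwartzMap.smulLeftCLM ℂ fun z : Spacetime ↦ besselSymbol s z.snd

theorem snd_hasTemperateGrowth : (fun z : Spacetime ↦ z.snd).HasTemperateGrowth :=
  ((ContinuousLinearMap.snd ℝ ℝ Plane).comp
    (WithLp.prodContinuousLinearEquiv 2 ℝ ℝ Plane).toContinuousLinearMap).hasTemperateGrowth

theorem fst_hasTemperateGrowth : (fun z : Spacetime ↦ z.fst).HasTemperateGrowth :=
  ((ContinuousLinearMap.fst ℝ ℝ Plane).comp
    (WithLp.prodContinuousLinearEquiv 2 ℝ ℝ Plane).toContinuousLinearMap).hasTemperateGrowth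

theorem besselSymbol_snd_hasTemperateGrowth (s : ℝ) :
    (fun z : Spacetime ↦ besselSymbol s z.snd).HasTemperateGrowth :=
  (besselSymbol_hasTemperateGrowth s).comp snd_hasTemperateGrowth

theorem stmul_apply (s : ℝ) (χ : 𝓢(Spacetime, ℂ)) (z : Spacetime) :
    stmul s χ z = besselSymbol s z.snd * χ z := by
  rw [stmul, SchwartzMap.smulLeftCLM_apply_apply (besselSymbol_snd_hasTemperateGrowth s),
    smul_eq_mul]

theorem stmul_neg_stmul (s : ℝ) (χ : 𝓢(Spacetime, ℂ)) : stmul (-s) (stmul s χ) = χ := by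
  ext z
  rw [stmul_apply, stmul_apply, ← mul_assoc, mul_comm (besselSymbol _ _), ← besselSymbol_add,
    add_neg_cancel, besselSymbol_eq, wt_zero, Complex.ofReal_one, one_mul]

theorem wmul_timeFourier (s t : ℝ) (χ : 𝓢(Spacetime, ℂ)) :
    wmul s (timeFourier t χ) = timeFourier t (stmul s χ) := by
  ext ξ
  rw [wmul_apply, timeFourier_of_eq_mul (stmul_apply s χ)]

theorem wnorm_timeFourier (s t : ℝ) (χ : 𝓢(Spacetime, ℂ)) :
    wnorm s (timeFourier t χ) = ‖(timeFourier t (stmul s χ)).toLp 2 volume‖ := by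
  rw [wnorm, wmul_timeFourier]

theorem integral_wnorm_sq_timeFourier (s : ℝ) (χ : 𝓢(Spacetime, ℂ)) :
    Integrable (fun t ↦ wnorm s (timeFourier t χ) ^ 2) ∧
      ∫ t, wnorm s (timeFourier t χ) ^ 2 = ‖(stmul s χ).toLp 2 volume‖ ^ 2 := by
  simp_rw [wnorm_timeFourier]
  exact integral_norm_sq_timeFourier _

theorem exists_wnorm_timeFourier_sub_le (s : ℝ) (χ : 𝓢(Spacetime, ℂ)) : ∃ K : ℝ, 0 ≤ K ∧ ∀ r t,
    wnorm s (timeFourier t χ - timeFourier r χ) ≤ K * |t - r| := by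
  obtain ⟨K, hK, h⟩ := exists_norm_timeFourier_sub_le (stmul s χ)
  refine ⟨K, hK, fun r t ↦ ?_⟩
  rw [wnorm, map_sub, wmul_timeFourier, wmul_timeFourier]
  exact h r t

/-! ### Square integrable functions as functionals on Schwartz functions -/

section Riesz

variable {E : Type*} [NormedAddCommGroup E] [InnerProductSpace ℝ E] [FiniteDimensional ℝ E]
  [MeasurableSpace E] [BorelSpace E]

theorem norm_sq_eq_pairL_star {X : Type*} [MeasurableSpace X] {μ : Measure X} (f : Lp ℂ 2 μ) :
    ((‖f‖ ^ 2 : ℝ) : ℂ) = pairL μ f (star f) := by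
  have h : inner ℂ f f = ((‖f‖ ^ 2 : ℝ) : ℂ) := by
    rw [inner_self_eq_norm_sq_to_K]
    norm_cast
  rw [← h, L2.inner_def, pairL_apply]
  refine integral_congr_ae ?_
  filter_upwards [Lp.coeFn_star f] with x hx
  rw [hx]
  rfl

theorem pairL_toLp (f : Lp ℂ 2 (volume : Measure E)) (χ : 𝓢(E, ℂ)) :
    pairL volume f (χ.toLp 2 volume) = ∫ x, f x * χ x := by
  rw [pairL_apply]
  refine integral_congr_ae ?_
  filter_upwards [χ.coeFn_toLp 2 volume] with x hx
  rw [hx]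

/-- By density the bound extends from Schwartz functions to `L²`, where the complex conjugate of `f`
is an admissible test function. -/
theorem norm_le_of_forall_schwartz {f : Lp ℂ 2 (volume : Measure E)} {K : ℝ} (hK : 0 ≤ K)
    (h : ∀ χ : 𝓢(E, ℂ), ‖∫ x, f x * χ x‖ ≤ K * ‖χ.toLp 2 volume‖) : ‖f‖ ≤ K := by
  have hd : DenseRange (SchwartzMap.toLpCLM ℝ (E := E) ℂ 2 volume) :=
    SchwartzMap.denseRange_toLpCLM (by simp)
  have h1 : ∀ g : Lp ℂ 2 (volume : Measure E), ‖pairL volume f g‖ ≤ K * ‖g‖ := fun g ↦ by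
    refine hd.induction_on g (isClosed_le (by fun_prop) (by fun_prop)) fun χ ↦ ?_
    change ‖pairL volume f (χ.toLp 2 volume)‖ ≤ _
    rw [pairL_toLp]
    exact h χ
  have hstar : ‖star f‖ = ‖f‖ := by
    rw [Lp.norm_def, Lp.norm_def, eLpNorm_congr_ae (Lp.coeFn_star f), eLpNorm_star]
  rcases eq_or_ne f 0 with rfl | hf
  · rwa [norm_zero]
  · have h2 := h1 (star f)
    rw [← norm_sq_eq_pairL_star, Complex.norm_real, Real.norm_of_nonneg (sq_nonneg _), hstar,
      sq] at h2
    exact le_of_mul_le_mul_right h2 (norm_pos_iff.2 hf)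

/-- A functional on Schwartz functions that is bounded in `L²` is represented by an `L²` function. -/
theorem exists_lp_of_bound (ℓ : 𝓢(E, ℂ) →ₗ[ℂ] ℂ) {K : ℝ}
    (h : ∀ χ, ‖ℓ χ‖ ≤ K * ‖χ.toLp 2 volume‖) :
    ∃ H : Lp ℂ 2 (volume : Measure E), ∀ χ, ℓ χ = ∫ x, H x * χ x := by
  let e : 𝓢(E, ℂ) →ₗ[ℂ] Lp ℂ 2 (volume : Measure E) :=
    (SchwartzMap.toLpCLM ℂ (E := E) ℂ 2 volume).toLinearMap
  have hd' : DenseRange (SchwartzMap.toLpCLM ℝ (E := E) ℂ 2 volume) :=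
    SchwartzMap.denseRange_toLpCLM (by simp)
  have hd : DenseRange e := hd'
  let L := ℓ.extendOfNorm e
  refine ⟨star ((InnerProductSpace.toDual ℂ _).symm L), fun χ ↦ ?_⟩
  have h1 : L (χ.toLp 2 volume) = ℓ χ := LinearMap.extendOfNorm_eq hd ⟨K, h⟩ χ
  rw [← h1, ← pairL_toLp, ← InnerProductSpace.toDual_symm_apply, L2.inner_def, pairL_apply]
  refine integral_congr_ae ?_
  filter_upwards [Lp.coeFn_star ((InnerProductSpace.toDual ℂ _).symm L)] with x hx
  rw [hx, mul_comm]
  rfl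

end Riesz

/-! ### The space-time distribution defined by a curve -/

theorem wnorm_add_le (s : ℝ) (p q : 𝓢(Plane, ℂ)) : wnorm s (p + q) ≤ wnorm s p + wnorm s q := by
  have : (wmul s (p + q)).toLp 2 volume =
      (wmul s p).toLp 2 volume + (wmul s q).toLp 2 volume := by
    rw [map_add]
    exact map_add (SchwartzMap.toLpCLM ℂ ℂ 2 (volume : Measure Plane)) _ _
  rw [wnorm, this]
  exact norm_add_le _ _

/-- The free evolution is Lipschitz in time at the price of one derivative, harmless on a Schwartz
function. -/
theorem wnorm_evo_sub_le (s k l : ℝ) (p : 𝓢(Plane, ℂ)) :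
    wnorm s (evo k p - evo l p) ≤ |k - l| * wnorm (s + 1) p := by
  refine wnorm_le_of_le fun ξ ↦ ?_
  change wt s ξ * ‖evo k p ξ - evo l p ξ‖ ≤ _
  have e : evo k p ξ - evo l p ξ = evoSymbol l ξ * ((evoSymbol (k - l) ξ - 1) * p ξ) := by
    rw [evo_apply, evo_apply, sub_mul, mul_sub, ← mul_assoc, ← evoSymbol_add]
    simp
  have h1 : ‖evoSymbol (k - l) ξ - 1‖ ≤ |k - l| * wt 1 ξ := by
    refine Real.norm_exp_I_mul_ofReal_sub_one_le.trans (le_of_eq ?_)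
    rw [norm_mul, Real.norm_eq_abs, Real.norm_of_nonneg (wt_pos _ _).le]
  rw [e, norm_mul, norm_mul, norm_evoSymbol, one_mul, wt_add]
  have := (wt_pos s ξ).le
  calc _ ≤ wt s ξ * (|k - l| * wt 1 ξ * ‖p ξ‖) := by gcongr
    _ = _ := by ring

section Curve

variable {s₀ s₁ C R ς : ℝ} {Z : ℝ → 𝓢(Plane, ℂ) →ₗ[ℂ] ℂ}

theorem LipschitzCurve.shift (hZ : LipschitzCurve s₀ s₁ C R Z) (k : ℝ) :
    LipschitzCurve s₀ s₁ C (R + |k|) fun t ↦ Z (t - k) where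
  nonneg := hZ.nonneg
  bound t p := hZ.bound _ p
  lipschitz t s p := by simpa using hZ.lipschitz (t - k) (s - k) p
  eq_zero t ht := hZ.eq_zero _ (by linarith [abs_sub_abs_le_abs_sub t k])

theorem exists_wnorm_evo_timeFourier_sub_le (s ς : ℝ) (χ : 𝓢(Spacetime, ℂ)) (r : ℝ) :
    ∃ K : ℝ, ∀ t, wnorm s (evo (ς * t) (timeFourier t χ) - evo (ς * r) (timeFourier r χ)) ≤
      K * |t - r| := by
  obtain ⟨K, hK, h⟩ := exists_wnorm_timeFourier_sub_le s χ
  refine ⟨K + |ς| * wnorm (s + 1) (timeFourier r χ), fun t ↦ ?_⟩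
  have e : evo (ς * t) (timeFourier t χ) - evo (ς * r) (timeFourier r χ) =
      evo (ς * t) (timeFourier t χ - timeFourier r χ) +
        (evo (ς * t) (timeFourier r χ) - evo (ς * r) (timeFourier r χ)) := by
    rw [map_sub]
    abel
  rw [e]
  refine (wnorm_add_le _ _ _).trans ?_
  rw [wnorm_evo]
  have h1 := wnorm_evo_sub_le s (ς * t) (ς * r) (timeFourier r χ)
  rw [← mul_sub, abs_mul] at h1
  linarith [h r t]

theorem LipschitzCurve.continuous (hZ : LipschitzCurve s₀ s₁ C R Z) (ς : ℝ) (χ : 𝓢(Spacetime, ℂ)) :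
    Continuous fun t ↦ Z t (evo (ς * t) (timeFourier t χ)) := by
  rw [continuous_iff_continuousAt]
  intro r
  obtain ⟨K, hK⟩ := exists_wnorm_evo_timeFourier_sub_le (-s₁) ς χ r
  set q := evo (ς * r) (timeFourier r χ)
  rw [ContinuousAt, tendsto_iff_norm_sub_tendsto_zero]
  have hlim : Filter.Tendsto (fun t ↦ (C * K + C * wnorm (-s₀) q) * |t - r|) (nhds r) (nhds 0) := by
    have h1 : Continuous fun t : ℝ ↦ (C * K + C * wnorm (-s₀) q) * |t - r| := by fun_prop
    have h2 := h1.tendsto r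
    simpa using h2
  refine squeeze_zero (fun _ ↦ norm_nonneg _) (fun t ↦ ?_) hlim
  have e : Z t (evo (ς * t) (timeFourier t χ)) - Z r q =
      Z t (evo (ς * t) (timeFourier t χ) - q) + (Z t q - Z r q) := by
    rw [map_sub]
    ring
  rw [e]
  refine (norm_add_le _ _).trans ?_
  have h1 := (hZ.bound t _).trans (mul_le_mul_of_nonneg_left (hK t) hZ.nonneg)
  have h2 := hZ.lipschitz t r q
  linarith

theorem LipschitzCurve.integrable (hZ : LipschitzCurve s₀ s₁ C R Z) (ς : ℝ)
    (χ : 𝓢(Spacetime, ℂ)) : Integrable fun t ↦ Z t (evo (ς * t) (timeFourier t χ)) := by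
  refine (hZ.continuous ς χ).integrable_of_hasCompactSupport
    (HasCompactSupport.intro (isCompact_Icc (a := -R) (b := R)) fun t ht ↦ ?_)
  rw [hZ.eq_zero t]
  · rfl
  · by_contra h
    exact ht (abs_le.1 (not_lt.1 h))

/-- The functional on space-time Schwartz functions of frequency defined by a curve. -/
noncomputable def LipschitzCurve.functional (hZ : LipschitzCurve s₀ s₁ C R Z) (ς : ℝ) :
    𝓢(Spacetime, ℂ) →ₗ[ℂ] ℂ where
  toFun χ := ∫ t, Z t (evo (ς * t) (timeFourier t χ))
  map_add' χ₁ χ₂ := by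
    rw [← integral_add (hZ.integrable ς χ₁) (hZ.integrable ς χ₂)]
    simp only [map_add]
  map_smul' c χ := by
    rw [RingHom.id_apply, ← integral_smul]
    simp only [map_smul]

theorem LipschitzCurve.functional_apply (hZ : LipschitzCurve s₀ s₁ C R Z) (ς : ℝ)
    (χ : 𝓢(Spacetime, ℂ)) :
    hZ.functional ς χ = ∫ t, Z t (evo (ς * t) (timeFourier t χ)) := rfl

/-- Cauchy-Schwarz in time on the support, combined with Plancherel; the free evolution preserves
the weighted norms. -/
theorem norm_integral_timeFourier_le {W : ℝ → 𝓢(Plane, ℂ) → ℂ} {K s : ℝ} (hR : 0 ≤ R)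
    (hK : 0 ≤ K) (hb : ∀ t p, ‖W t p‖ ≤ K * wnorm s p) (h0 : ∀ t, R < |t| → ∀ p, W t p = 0)
    (ς : ℝ) (χ : 𝓢(Spacetime, ℂ)) :
    ‖∫ t, W t (evo (ς * t) (timeFourier t χ))‖ ≤
      K * (1 + 2 * R) * ‖(stmul s χ).toLp 2 volume‖ := by
  obtain ⟨hi, he⟩ := integral_wnorm_sq_timeFourier s χ
  set S := ‖(stmul s χ).toLp 2 volume‖
  have hS : 0 ≤ S := norm_nonneg _
  have key : ∀ ε : ℝ, 0 < ε → ‖∫ t, W t (evo (ς * t) (timeFourier t χ))‖ ≤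
      K * (1 + 2 * R) * (S + ε) := by
    intro ε hε
    -- Cauchy-Schwarz is replaced by `f ≤ f² / c + c` with `c` close to `S`; the positive `ε` covers
    -- `S = 0`.
    set c := S + ε
    have hc : 0 < c := by positivity
    have i1 : Integrable (Set.indicator (Set.Icc (-R) R) fun _ : ℝ ↦ c) :=
      (integrableOn_const (by simp)).integrable_indicator measurableSet_Icc
    have h1 := norm_integral_le_of_norm_le (f := fun t ↦ W t (evo (ς * t) (timeFourier t χ)))
      (((hi.const_mul c⁻¹).add i1).const_mul K) (ae_of_all _ fun t ↦ ?_)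
    · refine h1.trans ?_
      have e1 : ∫ t, Set.indicator (Set.Icc (-R) R) (fun _ : ℝ ↦ c) t = 2 * R * c := by
        rw [integral_indicator measurableSet_Icc, setIntegral_const, Real.volume_real_Icc_of_le
          (by linarith), smul_eq_mul]
        ring
      have e2 : c⁻¹ * S ^ 2 ≤ c := by
        rw [inv_mul_le_iff₀ hc]
        nlinarith
      rw [integral_const_mul]
      have e3 : ∫ t, ((fun t ↦ c⁻¹ * wnorm s (timeFourier t χ) ^ 2) +
          (Set.Icc (-R) R).indicator fun _ ↦ c) t = c⁻¹ * S ^ 2 + 2 * R * c := by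
        rw [← he, ← e1, ← integral_const_mul]
        exact integral_add (hi.const_mul c⁻¹) i1
      rw [e3, mul_assoc K]
      refine mul_le_mul_of_nonneg_left ?_ hK
      linarith
    · change _ ≤ K * (c⁻¹ * wnorm s (timeFourier t χ) ^ 2 +
        (Set.Icc (-R) R).indicator (fun _ ↦ c) t)
      by_cases ht : t ∈ Set.Icc (-R) R
      · rw [Set.indicator_of_mem ht]
        refine (hb t _).trans (mul_le_mul_of_nonneg_left ?_ hK)
        rw [wnorm_evo]
        set f := wnorm s (timeFourier t χ)
        have h2 : f * c ≤ f ^ 2 + c * c := by nlinarith [sq_nonneg (f - c), sq_nonneg f, sq_nonneg c]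
        have h3 : c⁻¹ * f ^ 2 + c = (f ^ 2 + c * c) / c := by field_simp
        rw [h3, le_div_iff₀ hc]
        exact h2
      · rw [Set.indicator_of_notMem ht, add_zero,
          h0 t (by by_contra h; exact ht (abs_le.1 (not_lt.1 h))), norm_zero]
        positivity
  refine le_of_forall_pos_le_add fun ε hε ↦ ?_
  have hM : 0 < K * (1 + 2 * R) + 1 := by positivity
  refine (key (ε / (K * (1 + 2 * R) + 1)) (by positivity)).trans ?_
  rw [mul_add]
  gcongr
  rw [← mul_div_assoc, div_le_iff₀ hM]
  nlinarith

end Curve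

/-- The symbol `-2πτ + ς ⟨2πξ⟩` of `i∂_t + ς⟨∇⟩`. -/
noncomputable def waveSymbol (ς : ℝ) (z : Spacetime) : ℝ :=
  -(2 * Real.pi * z.fst) + ς * wt 1 z.snd

theorem waveSymbol_hasTemperateGrowth (ς : ℝ) : (waveSymbol ς).HasTemperateGrowth := by
  have h1 := (wt_hasTemperateGrowth 1).comp snd_hasTemperateGrowth
  have h2 := (Function.HasTemperateGrowth.const (E := Spacetime) ς).mul h1
  have h3 := (Function.HasTemperateGrowth.const (E := Spacetime) (-(2 * Real.pi))).mul
    fst_hasTemperateGrowth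
  have e : waveSymbol ς = (fun _ ↦ -(2 * Real.pi)) * (fun z : Spacetime ↦ z.fst) +
      (fun _ ↦ ς) * (wt 1 ∘ fun z : Spacetime ↦ z.snd) := by
    funext z
    simp [waveSymbol]
  rw [e]
  exact h3.add h2

/-- The symbol `exp (ik(-2πτ + ς ⟨2πξ⟩)) - 1`. -/
noncomputable def diffSymbol (ς k : ℝ) (z : Spacetime) : ℂ :=
  Complex.exp (Complex.I * (k * waveSymbol ς z : ℝ)) - 1

theorem diffSymbol_hasTemperateGrowth (ς k : ℝ) : (diffSymbol ς k).HasTemperateGrowth := by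
  have h : (fun z ↦ k * waveSymbol ς z).HasTemperateGrowth :=
    (Function.HasTemperateGrowth.const k).mul (waveSymbol_hasTemperateGrowth ς)
  exact (hasTemperateGrowth_cexp_I.comp h).sub (Function.HasTemperateGrowth.const 1)

theorem diffSymbol_add_one (ς k : ℝ) (z : Spacetime) :
    diffSymbol ς k z + 1 = evoSymbol (ς * k) z.snd * 𝐞 (-(z.fst * k)) := by
  rw [diffSymbol, sub_add_cancel, evoSymbol, Real.fourierChar_apply, ← Complex.exp_add, waveSymbol]
  congr 1
  push_cast
  ring

theorem norm_diffSymbol_le (ς k : ℝ) (z : Spacetime) : ‖diffSymbol ς k z‖ ≤ 2 := by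
  refine (norm_sub_le _ _).trans (le_of_eq ?_)
  rw [mul_comm, Complex.norm_exp_ofReal_mul_I, norm_one]
  norm_num

theorem tendsto_diffSymbol (ς : ℝ) (z : Spacetime) :
    Filter.Tendsto (fun k : ℝ ↦ k⁻¹ • diffSymbol ς k z) (nhdsWithin 0 {0}ᶜ)
      (nhds (Complex.I * waveSymbol ς z)) := by
  have h1 : HasDerivAt (fun k : ℝ ↦ Complex.I * (k * waveSymbol ς z : ℝ))
      (Complex.I * waveSymbol ς z) 0 := by
    have := ((hasDerivAt_id (0 : ℝ)).mul_const (waveSymbol ς z)).ofReal_comp.const_mul Complex.I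
    simpa using this
  have h2 := h1.cexp.tendsto_slope_zero
  simpa [diffSymbol] using h2

section Curve

variable {s₀ s₁ C R ς : ℝ} {Z : ℝ → 𝓢(Plane, ℂ) →ₗ[ℂ] ℂ}

/-- The exponential in `diffSymbol` is a free evolution by `k` times a modulation that shifts time
by `k`. -/
theorem timeFourier_diff {χ χ' : 𝓢(Spacetime, ℂ)} {k : ℝ}
    (h : ∀ z, χ' z = diffSymbol ς k z * χ z) (t : ℝ) :
    timeFourier t χ' = evo (ς * k) (timeFourier (t + k) χ) - timeFourier t χ := by
  rw [eq_sub_iff_add_eq, ← map_add]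
  ext ξ
  rw [evo_apply]
  refine timeFourier_of_eq_mul_modulate (fun z ↦ ?_) t ξ
  rw [← mul_assoc, ← diffSymbol_add_one]
  change χ' z + χ z = _
  rw [h]
  ring

/-- After a translation of the time variable, multiplication by `diffSymbol` amounts to a difference
of the profile `Z`, with the evolution untouched: `-2πτ + ς⟨2πξ⟩` generates translations of the
profile. -/
theorem LipschitzCurve.functional_diff (hZ : LipschitzCurve s₀ s₁ C R Z) {χ χ' : 𝓢(Spacetime, ℂ)}
    {k : ℝ} (h : ∀ z, χ' z = diffSymbol ς k z * χ z) :
    hZ.functional ς χ' = ∫ t, (Z (t - k) - Z t) (evo (ς * t) (timeFourier t χ)) := by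
  have i1 := hZ.integrable ς χ
  have i2 := (hZ.shift k).integrable ς χ
  have i3 := i2.comp_add_right k
  simp only [add_sub_cancel_right] at i3
  have e : ∀ t, Z t (evo (ς * t) (timeFourier t χ')) =
      Z t (evo (ς * (t + k)) (timeFourier (t + k) χ)) - Z t (evo (ς * t) (timeFourier t χ)) := by
    intro t
    rw [timeFourier_diff h, map_sub, map_sub, ← evo_add, mul_add]
  have e2 := integral_add_right_eq_self (μ := (volume : Measure ℝ))
    (fun t ↦ Z (t - k) (evo (ς * t) (timeFourier t χ))) k
  simp only [add_sub_cancel_right] at e2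
  simp_rw [LipschitzCurve.functional_apply, e, LinearMap.sub_apply]
  rw [integral_sub i3 i1, integral_sub i2 i1, e2]

theorem LipschitzCurve.norm_functional_le (hZ : LipschitzCurve s₀ s₁ C R Z) (ς : ℝ)
    (χ : 𝓢(Spacetime, ℂ)) : ‖hZ.functional ς χ‖ ≤
      C * (1 + 2 * |R|) * ‖(stmul (-s₁) χ).toLp 2 volume‖ :=
  norm_integral_timeFourier_le (W := fun t ↦ Z t) (abs_nonneg R) hZ.nonneg hZ.bound
    (fun t ht p ↦ by rw [hZ.eq_zero t ((le_abs_self R).trans_lt ht)]; rfl) ς χ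

/-- The Lipschitz bound gains `|k|`, and `|k| ≤ 1` keeps the shifted curve supported within radius
`|R| + 1`. -/
theorem LipschitzCurve.norm_functional_diff_le (hZ : LipschitzCurve s₀ s₁ C R Z)
    {χ χ' : 𝓢(Spacetime, ℂ)} {k : ℝ} (hk : |k| ≤ 1) (h : ∀ z, χ' z = diffSymbol ς k z * χ z) :
    ‖hZ.functional ς χ'‖ ≤
      (C * (1 + 2 * (|R| + 1))) * |k| * ‖(stmul (-s₀) χ).toLp 2 volume‖ := by
  rw [hZ.functional_diff h]
  refine (norm_integral_timeFourier_le (W := fun t ↦ (Z (t - k) - Z t)) (R := |R| + 1)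
    (K := C * |k|) (s := -s₀) (by positivity) (mul_nonneg hZ.nonneg (abs_nonneg k)) (fun t p ↦ ?_)
    (fun t ht p ↦ ?_) ς χ).trans (le_of_eq (by ring))
  · refine (hZ.lipschitz (t - k) t p).trans (le_of_eq ?_)
    rw [sub_sub_cancel_left, abs_neg]
    ring
  · have h1 := le_abs_self R
    have h2 := abs_sub_abs_le_abs_sub t k
    change (Z (t - k) - Z t) p = 0
    rw [hZ.eq_zero t (by linarith), hZ.eq_zero (t - k) (by linarith), sub_zero]
    rfl

/-- The space-time Fourier transform of a curve. -/
theorem LipschitzCurve.exists_lp (hZ : LipschitzCurve s₀ s₁ C R Z) (hs : s₀ ≤ s₁) (ς : ℝ) :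
    ∃ H : Lp ℂ 2 (volume : Measure Spacetime),
      (∀ χ, hZ.functional ς χ = ∫ z, besselSymbol (-s₁) z.snd * H z * χ z) ∧
      MemLp (fun z ↦ besselSymbol (s₀ - s₁) z.snd * (waveSymbol ς z * H z)) 2 := by
  obtain ⟨H, hH⟩ := exists_lp_of_bound (hZ.functional ς ∘ₗ (stmul s₁).toLinearMap)
    (K := C * (1 + 2 * |R|)) fun χ ↦ by
      have := hZ.norm_functional_le ς (stmul s₁ χ)
      rwa [stmul_neg_stmul] at this
  have hH' : ∀ χ, hZ.functional ς χ = ∫ z, besselSymbol (-s₁) z.snd * H z * χ z := by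
    intro χ
    have h1 := hH (stmul (-s₁) χ)
    have h2 : stmul s₁ (stmul (-s₁) χ) = χ := by simpa using stmul_neg_stmul (-s₁) χ
    change hZ.functional ς (stmul s₁ (stmul (-s₁) χ)) = _ at h1
    rw [h2] at h1
    rw [h1]
    congr 1
    funext z
    rw [stmul_apply]
    ring
  refine ⟨H, hH', ?_⟩
  set K := C * (1 + 2 * (|R| + 1)) with hK
  have hK0 : 0 ≤ K := mul_nonneg hZ.nonneg (by positivity)
  -- The unbounded `waveSymbol` is approached through the bounded symbols `diffSymbol ς k / k`.
  have hb : ∀ k, MemLp (fun z : Spacetime ↦ besselSymbol (s₀ - s₁) z.snd * diffSymbol ς k z) ⊤ := by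
    intro k
    refine memLp_top_of_norm_le ?_ (C := 1 * 2) fun z ↦ ?_
    · exact ((besselSymbol_snd_hasTemperateGrowth _).1.continuous.mul
        (diffSymbol_hasTemperateGrowth ς k).1.continuous).measurable
    · rw [norm_mul, besselSymbol_eq, Complex.norm_real, Real.norm_of_nonneg (wt_pos _ _).le]
      exact mul_le_mul (wt_le_one (by linarith) _) (norm_diffSymbol_le ς k z) (norm_nonneg _)
        zero_le_one
  have hnorm : ∀ k, |k| ≤ 1 → ‖mulL (hb k) H‖ ≤ K * |k| := by
    intro k hk
    refine norm_le_of_forall_schwartz (by positivity) fun χ ↦ ?_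
    -- The factor `⟨ξ⟩ ^ s₀` is chosen to cancel the weight in the Lipschitz bound, leaving the
    -- plain `L²` norm of `χ`.
    let χ' := SchwartzMap.smulLeftCLM ℂ (diffSymbol ς k) (stmul s₀ χ)
    have hχ' : ∀ z, χ' z = diffSymbol ς k z * stmul s₀ χ z := fun z ↦ by
      simp only [χ']
      rw [SchwartzMap.smulLeftCLM_apply_apply (diffSymbol_hasTemperateGrowth ς k), smul_eq_mul]
    have h1 := hZ.norm_functional_diff_le hk hχ'
    rw [stmul_neg_stmul, hH'] at h1
    refine le_trans (le_of_eq ?_) h1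
    congr 1
    refine integral_congr_ae ?_
    filter_upwards [mulL_ae (hb k) H] with z hz
    rw [hz, hχ', stmul_apply, sub_eq_add_neg, besselSymbol_add]
    ring
  have hmeas : AEStronglyMeasurable
      (fun z ↦ besselSymbol (s₀ - s₁) z.snd * (waveSymbol ς z * H z)) :=
    (besselSymbol_snd_hasTemperateGrowth _).1.continuous.aestronglyMeasurable.mul
      ((Complex.continuous_ofReal.comp
        (waveSymbol_hasTemperateGrowth ς).1.continuous).aestronglyMeasurable.mul
        (Lp.aestronglyMeasurable H))
  let k : ℕ → ℝ := fun n ↦ 1 / ((n : ℝ) + 1)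
  have hk0 : ∀ n, 0 < k n := fun n ↦ by positivity
  have hk1 : ∀ n, |k n| ≤ 1 := fun n ↦ by
    rw [abs_of_pos (hk0 n), div_le_one (by positivity)]
    linarith [n.cast_nonneg (α := ℝ)]
  have hklim : Filter.Tendsto k Filter.atTop (nhdsWithin 0 {0}ᶜ) :=
    tendsto_nhdsWithin_iff.2 ⟨tendsto_one_div_add_atTop_nhds_zero_nat,
      Filter.Eventually.of_forall fun n ↦ (hk0 n).ne'⟩
  let f : ℕ → Lp ℂ 2 (volume : Measure Spacetime) := fun n ↦ (k n)⁻¹ • mulL (hb (k n)) H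
  have hf : ∀ n, eLpNorm (f n) 2 volume ≤ ENNReal.ofReal K := by
    intro n
    rw [← ENNReal.ofReal_toReal (Lp.eLpNorm_ne_top (f n)), ← Lp.norm_def]
    refine ENNReal.ofReal_le_ofReal ?_
    simp only [f]
    rw [norm_smul, norm_inv, Real.norm_eq_abs, inv_mul_le_iff₀ (abs_pos.2 (hk0 n).ne')]
    exact (hnorm _ (hk1 n)).trans (le_of_eq (mul_comm _ _))
  have hlim : ∀ᵐ z, Filter.Tendsto (fun n ↦ f n z) Filter.atTop
      (nhds (Complex.I * (besselSymbol (s₀ - s₁) z.snd * (waveSymbol ς z * H z)))) := by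
    have h1 : ∀ᵐ z, ∀ n, f n z = (k n)⁻¹ • (besselSymbol (s₀ - s₁) z.snd * diffSymbol ς (k n) z * H z) := by
      rw [ae_all_iff]
      intro n
      filter_upwards [Lp.coeFn_smul (k n)⁻¹ (mulL (hb (k n)) H), mulL_ae (hb (k n)) H] with z h1 h2
      simp only [f]
      rw [h1, Pi.smul_apply, h2]
    filter_upwards [h1] with z hz
    have h2 := (((tendsto_diffSymbol ς z).comp hklim).const_mul
      (besselSymbol (s₀ - s₁) z.snd)).mul_const (H z)
    have e : besselSymbol (s₀ - s₁) z.snd * (Complex.I * waveSymbol ς z) * H z =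
        Complex.I * (besselSymbol (s₀ - s₁) z.snd * (waveSymbol ς z * H z)) := by ring
    rw [e] at h2
    refine h2.congr fun n ↦ ?_
    rw [hz, Function.comp_apply, Complex.real_smul, Complex.real_smul]
    ring
  -- Fatou: the quotients are bounded in `L²` uniformly in `n` and converge almost everywhere to `I`
  -- times the desired function.
  have hfin := Lp.eLpNorm_le_of_ae_tendsto (p := 2) (Filter.Eventually.of_forall hf)
    (fun n ↦ Lp.aestronglyMeasurable (f n)) hlim
  refine ⟨hmeas, lt_of_le_of_lt ?_ (hfin.trans_lt ENNReal.ofReal_lt_top)⟩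
  refine le_of_eq (eLpNorm_congr_norm_ae (ae_of_all _ fun z ↦ ?_))
  rw [norm_mul Complex.I, Complex.norm_I, one_mul]

end Curve

/-- A solution of the half-wave equation extends to space-time, with a control of its space-time
Fourier transform. -/
theorem exists_extension {a b s₀ s₁ : ℝ} {σ : ℤˣ} {u F : ℝ → 𝓢'(Plane, ℂ)} (hab : a < b)
    (hs : s₀ ≤ s₁) (hu : WeakSobolev (Set.Ioo a b) s₁ u) (hF : WeakSobolev (Set.Ioo a b) s₀ F)
    (h : SolvesHalfWave (Set.Ioo a b) σ u F) :
    ∃ (v : 𝓢'(Spacetime, ℂ)) (H : Lp ℂ 2 (volume : Measure Spacetime)),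
      HasFourierFunction v (fun z ↦ besselSymbol (-s₁) z.snd * H z) ∧
      MemLp (fun z ↦ besselSymbol (s₀ - s₁) z.snd * (waveSymbol ((σ : ℤ) : ℝ) z * H z)) 2 ∧
      ∀ Φ, IsTest (Set.Ioo a b) Φ → v Φ = pair (Set.Ioo a b) u Φ := by
  obtain ⟨Z, C, R, hZ, hZu⟩ := exists_lipschitzCurve_of_solvesHalfWave hab hs hu hF h
  obtain ⟨H, hH, hH2⟩ := hZ.exists_lp hs ((σ : ℤ) : ℝ)
  have hv := (hasFourierFunction_of_fourier_eq
    (u := (𝓕⁻ (H : 𝓢'(Spacetime, ℂ)) : 𝓢'(Spacetime, ℂ)))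
    (FourierTransform.fourier_fourierInv_eq _)).multiplier (besselSymbol_snd_hasTemperateGrowth (-s₁))
  refine ⟨_, H, hv, hH2, fun Φ hΦ ↦ ?_⟩
  rw [hv.apply_eq, ← hH, hZ.functional_apply, pair]
  -- On test functions the evolution in the functional cancels the one built into the profile, so
  -- the pairing with `u` is recovered.
  have e : ∀ t, timeFourier t (𝓕⁻ Φ) = 𝓕⁻ (slice t Φ) := fun t ↦ by
    rw [timeFourier_eq, FourierTransform.fourier_fourierInv_eq]
  simp_rw [e]
  rw [← setIntegral_eq_integral_of_forall_compl_eq_zero (s := Set.Ioo a b)]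
  · refine setIntegral_congr_fun measurableSet_Ioo fun t ht ↦ ?_
    rw [hZu t ht, ← evo_add, neg_add_cancel, evo_zero, ← apply_fourier,
      FourierTransform.fourier_fourierInv_eq]
  · intro t ht
    have h0 : slice t Φ = 0 := by
      ext x
      rw [slice_apply]
      refine image_eq_zero_of_notMem_tsupport fun hx ↦ ht ?_
      exact interior_subset (hΦ.2 hx)
    rw [h0]
    simp [FourierTransform.fourierInv_zero]

/-! ### Interpolation -/

theorem bracket_pos (r : ℝ) : 0 < bracket r := Real.sqrt_pos.2 (by positivity)

theorem bracket_continuous : Continuous bracket := by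
  unfold bracket
  fun_prop

theorem bracket_eq_wt_one (ξ : Plane) : bracket (2 * Real.pi * ‖ξ‖) = wt 1 ξ := by
  have h := wt_one_sq ξ
  rw [norm_smul, Real.norm_of_nonneg (by positivity)] at h
  rw [bracket, ← h, Real.sqrt_sq (wt_pos 1 ξ).le]

theorem bracket_le (r : ℝ) : bracket r ≤ 1 + |r| := by
  rw [bracket, Real.sqrt_le_left (by positivity)]
  nlinarith [abs_nonneg r, sq_abs r]

theorem abs_intCast_unit (σ : ℤˣ) : |((σ : ℤ) : ℝ)| = 1 := by
  rcases Int.units_eq_one_or σ with rfl | rfl <;> simp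

/-- Since `|ξ| ≤ ⟨ξ⟩ ≤ 1 + |ξ|`, the wave and Klein-Gordon symbols differ by at most `1`. -/
theorem bracket_le_waveSymbol (σ : ℤˣ) (z : Spacetime) :
    bracket (-(2 * Real.pi * z.fst) + ((σ : ℤ) : ℝ) * (2 * Real.pi * ‖z.snd‖)) ≤
      2 + |waveSymbol ((σ : ℤ) : ℝ) z| := by
  refine (bracket_le _).trans ?_
  have e : -(2 * Real.pi * z.fst) + ((σ : ℤ) : ℝ) * (2 * Real.pi * ‖z.snd‖) =
      waveSymbol ((σ : ℤ) : ℝ) z + ((σ : ℤ) : ℝ) * (2 * Real.pi * ‖z.snd‖ - wt 1 z.snd) := by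
    rw [waveSymbol]
    ring
  have h1 : |2 * Real.pi * ‖z.snd‖ - wt 1 z.snd| ≤ 1 :=
    abs_le.2 ⟨by linarith [wt_one_le z.snd], by linarith [norm_le_wt_one z.snd]⟩
  rw [e]
  have h2 := abs_add_le (waveSymbol ((σ : ℤ) : ℝ) z)
    (((σ : ℤ) : ℝ) * (2 * Real.pi * ‖z.snd‖ - wt 1 z.snd))
  rw [abs_mul, abs_intCast_unit, one_mul] at h2
  linarith

theorem xWeight_continuous (σ : ℤˣ) (s b : ℝ) : Continuous (xWeight σ s b) := by
  have h1 := fst_hasTemperateGrowth.1.continuous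
  have h2 := snd_hasTemperateGrowth.1.continuous
  have h3 : Continuous fun z : Spacetime ↦ 2 * Real.pi * ‖z.snd‖ := continuous_const.mul h2.norm
  have h4 : Continuous fun z : Spacetime ↦
      -(2 * Real.pi * z.fst) + ((σ : ℤ) : ℝ) * (2 * Real.pi * ‖z.snd‖) :=
    (continuous_const.mul h1).neg.add (continuous_const.mul h3)
  exact ((bracket_continuous.comp h3).rpow_const fun _ ↦ Or.inl (bracket_pos _).ne').mul
    ((bracket_continuous.comp h4).rpow_const fun _ ↦ Or.inl (bracket_pos _).ne')

theorem rpow_le_one_add {x b : ℝ} (hx : 0 ≤ x) (hb0 : 0 ≤ b) (hb1 : b ≤ 1) : x ^ b ≤ 1 + x := by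
  rcases le_total x 1 with h | h
  · exact (Real.rpow_le_one hx h hb0).trans (by linarith)
  · exact (Real.rpow_le_rpow_of_exponent_le h hb1).trans (by rw [Real.rpow_one]; linarith)

/-- The left side is exactly `(⟨ξ⟩ ^ (s₀ - s₁) B) ^ (1 - θ)`, and `x ^ b ≤ 1 + x` for `0 ≤ b ≤ 1`.
The constant is this `1` plus the `2` lost in comparing the symbols. -/
theorem xWeight_le {s₀ s₁ θ : ℝ} (hs : s₀ ≤ s₁) (hθ : θ ∈ Set.Icc (0 : ℝ) 1) (σ : ℤˣ)
    (z : Spacetime) : xWeight σ (θ * s₁ + (1 - θ) * s₀) (1 - θ) z * wt (-s₁) z.snd ≤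
      3 + wt (s₀ - s₁) z.snd * |waveSymbol ((σ : ℤ) : ℝ) z| := by
  have hw := wt_pos (s₀ - s₁) z.snd
  have hB := bracket_le_waveSymbol σ z
  rw [xWeight, bracket_eq_wt_one, wt_rpow, one_mul]
  set B := bracket (-(2 * Real.pi * z.fst) + ((σ : ℤ) : ℝ) * (2 * Real.pi * ‖z.snd‖))
  have hB0 : 0 < B := bracket_pos _
  have e : wt (θ * s₁ + (1 - θ) * s₀) z.snd * B ^ (1 - θ) * wt (-s₁) z.snd =
      (wt (s₀ - s₁) z.snd * B) ^ (1 - θ) := by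
    rw [Real.mul_rpow hw.le hB0.le, wt_rpow, mul_right_comm, ← wt_add]
    congr 2
    ring
  rw [e]
  refine (rpow_le_one_add (by positivity) (by linarith [hθ.2]) (by linarith [hθ.1])).trans ?_
  have h1 := wt_le_one (s := s₀ - s₁) (by linarith) z.snd
  have h2 := mul_le_mul_of_nonneg_left hB hw.le
  linarith

theorem memX_of_memLp {s₀ s₁ θ : ℝ} (hs : s₀ ≤ s₁) (hθ : θ ∈ Set.Icc (0 : ℝ) 1) {σ : ℤˣ}
    {v : 𝓢'(Spacetime, ℂ)} {H : Lp ℂ 2 (volume : Measure Spacetime)}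
    (hv : HasFourierFunction v (fun z ↦ besselSymbol (-s₁) z.snd * H z))
    (hH : MemLp (fun z ↦ besselSymbol (s₀ - s₁) z.snd * (waveSymbol ((σ : ℤ) : ℝ) z * H z)) 2) :
    MemX σ (θ * s₁ + (1 - θ) * s₀) (1 - θ) v := by
  refine ⟨_, hv, ?_⟩
  have hmeas : AEStronglyMeasurable (fun z : Spacetime ↦
      (xWeight σ (θ * s₁ + (1 - θ) * s₀) (1 - θ) z : ℂ) * (besselSymbol (-s₁) z.snd * H z)) :=
    (Complex.continuous_ofReal.comp (xWeight_continuous _ _ _)).aestronglyMeasurable.mul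
      ((besselSymbol_snd_hasTemperateGrowth _).1.continuous.aestronglyMeasurable.mul
        (Lp.aestronglyMeasurable H))
  refine (((Lp.memLp H).norm.const_mul 3).add hH.norm).mono hmeas (ae_of_all _ fun z ↦ ?_)
  have hx : 0 ≤ xWeight σ (θ * s₁ + (1 - θ) * s₀) (1 - θ) z :=
    mul_nonneg (Real.rpow_nonneg (bracket_pos _).le _) (Real.rpow_nonneg (bracket_pos _).le _)
  rw [Pi.add_apply, norm_mul, norm_mul, norm_mul, norm_mul, besselSymbol_eq, besselSymbol_eq,
    Complex.norm_real, Complex.norm_real, Complex.norm_real, Complex.norm_real,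
    Real.norm_of_nonneg hx, Real.norm_of_nonneg (wt_pos _ _).le,
    Real.norm_of_nonneg (wt_pos _ _).le, ← mul_assoc]
  have h := mul_le_mul_of_nonneg_right (xWeight_le hs hθ σ z) (norm_nonneg (H z))
  rw [Real.norm_of_nonneg (by have := (wt_pos (s₀ - s₁) z.snd).le; positivity), Real.norm_eq_abs]
  linarith

/-! ### Bounded intervals -/

/-- Endpoints affect neither integrals nor test functions, so an open interval may be assumed; one
point intervals and the empty set are set apart. -/
theorem interior_eq_empty_or_exists_Ioo {I : Set ℝ} (hI : I.OrdConnected)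
    (hIb : Bornology.IsBounded I) : interior I = ∅ ∨
      ∃ a b, a < b ∧ Set.Ioo a b ⊆ I ∧ interior I = Set.Ioo a b ∧ I =ᵐ[volume] Set.Ioo a b := by
  rcases I.eq_empty_or_nonempty with rfl | hne
  · exact Or.inl interior_empty
  have hlow := hIb.bddBelow
  have hup := hIb.bddAbove
  have h1 : Set.Ioo (sInf I) (sSup I) ⊆ I :=
    IsConnected.Ioo_csInf_csSup_subset ⟨hne, hI.isPreconnected⟩ hlow hup
  have h2 : I ⊆ Set.Icc (sInf I) (sSup I) := subset_Icc_csInf_csSup hlow hup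
  have h3 : interior I = Set.Ioo (sInf I) (sSup I) := by
    refine Set.Subset.antisymm ?_ (interior_maximal h1 isOpen_Ioo)
    rw [← interior_Icc]
    exact interior_mono h2
  by_cases hab : sInf I < sSup I
  · refine Or.inr ⟨_, _, hab, h1, h3, ?_⟩
    have h4 : I ≤ᵐ[volume] Set.Icc (sInf I) (sSup I) := Filter.Eventually.of_forall h2
    have h5 : Set.Ioo (sInf I) (sSup I) ≤ᵐ[volume] I := Filter.Eventually.of_forall h1
    exact Filter.EventuallyLE.antisymm (Filter.EventuallyLE.trans h4 Ioo_ae_eq_Icc.symm.le) h5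
  · left
    rw [h3, Set.Ioo_eq_empty hab]

/-- The only test function is zero, so the zero distribution is an extension. -/
theorem memXOn_of_interior_eq_empty {I : Set ℝ} (hI : interior I = ∅) (σ : ℤˣ) (s b : ℝ)
    (u : ℝ → 𝓢'(Plane, ℂ)) : MemXOn I σ s b u := by
  refine ⟨0, ⟨0, fun χ ↦ ⟨by simp, ?_⟩, by simp⟩, fun Φ hΦ ↦ ?_⟩
  · rw [TemperedDistribution.fourier_apply]
    simp
  · have h0 : Φ = 0 := by
      ext z
      refine image_eq_zero_of_notMem_tsupport fun hz ↦ ?_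
      have h := hΦ.2 hz
      rw [hI] at h
      exact h
    simp [h0, pair]

/-- Solutions of the half-wave equation in `H ^ s₁` with right hand side in `H ^ s₀` belong to the
interpolated `X` spaces. -/
theorem memXOn_of_solvesHalfWave {I : Set ℝ} (hI : I.OrdConnected) (hIb : Bornology.IsBounded I)
    {s₀ s₁ θ : ℝ} {σ : ℤˣ} {u F : ℝ → 𝓢'(Plane, ℂ)} (hs : s₀ ≤ s₁)
    (hu : FourierSobolev I s₁ u) (hF : FourierSobolev I s₀ F) (h : SolvesHalfWave I σ u F)
    (hθ : θ ∈ Set.Icc (0 : ℝ) 1) : MemXOn I σ (θ * s₁ + (1 - θ) * s₀) (1 - θ) u := by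
  rcases interior_eq_empty_or_exists_Ioo hI hIb with h0 | ⟨a, b, hab, hsub, hint, hae⟩
  · exact memXOn_of_interior_eq_empty h0 _ _ _ _
  have hpair : ∀ w Φ, pair I w Φ = pair (Set.Ioo a b) w Φ := fun w Φ ↦ setIntegral_congr_set hae
  have htest : ∀ Φ, IsTest I Φ ↔ IsTest (Set.Ioo a b) Φ := fun Φ ↦ by
    rw [IsTest, IsTest, hint, interior_Ioo]
  have h' : SolvesHalfWave (Set.Ioo a b) σ u F := fun Φ hΦ ↦ by
    rw [← hpair, ← hpair, ← hpair]
    exact h Φ ((htest Φ).2 hΦ)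
  obtain ⟨v, H, hv, hH, he⟩ := exists_extension hab hs (hu.mono_set hsub).weakSobolev
    (hF.mono_set hsub).weakSobolev h'
  exact ⟨v, memX_of_memLp hs hθ hv hH, fun Φ hΦ ↦ by rw [he Φ ((htest Φ).1 hΦ), hpair]⟩

end CSH

theorem proposition3p4 (I : Set ℝ) (hI : I.OrdConnected) (hIb : Bornology.IsBounded I)
    (V : Polynomial ℝ)
    (A : Fin 3 → ℤˣ → ℝ → 𝓢'(CSH.Plane, ℂ)) (φ : ℤˣ → ℝ → 𝓢'(CSH.Plane, ℂ))
    (hφ : ∀ σ, CSH.ContinuousSobolev I 1 (φ σ))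
    (hA : ∀ μ σ, CSH.ContinuousSobolev I (1 / 2) (A μ σ))
    (hsol : CSH.SolvesCSH I V A φ)
    (θ : ℝ) (hθ : θ ∈ Set.Icc (0 : ℝ) 1) (δ : ℝ) (hδ : 0 < δ) :
    (∀ σ, CSH.MemXOn I σ (θ + (1 - θ) / 2) (1 - θ) (φ σ)) ∧
    (∀ μ σ, CSH.MemXOn I σ (θ / 2 - δ * (1 - θ)) (1 - θ) (A μ σ)) := by
  have hφ' := fun σ ↦ (hφ σ).fourierSobolev
  have hA' := fun μ σ ↦ (hA μ σ).fourierSobolev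
  refine ⟨fun σ ↦ ?_, fun μ σ ↦ ?_⟩
  -- `⟨∇⟩⁻¹` lifts `N` from `H ^ (-1/2)` to `H ^ (1/2)`: here `s₁ = 1` and `s₀ = 1/2`.
  · have hF := ((CSH.fourierSobolev_nonlinN V hA' hφ').bessel (r := 1 / 2) (-1)
      (by norm_num)).smul (CSH.sgn σ / 2)
    have h := CSH.memXOn_of_solvesHalfWave hI hIb (by norm_num) (hφ' σ) hF (hsol.2 σ) hθ
    have e : θ * 1 + (1 - θ) * (1 / 2) = θ + (1 - θ) / 2 := by ring
    rwa [e] at h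
  -- `⟨∇⟩⁻¹` lifts `M` from `H ^ (-1-δ)` to `H ^ (-δ)`: here `s₁ = 1/2` and `s₀ = -δ`.
  · have hF := ((CSH.fourierSobolev_nonlinM hA' hφ' hδ μ).bessel (r := -δ) (-1)
      (by ring)).smul (CSH.sgn σ / 2)
    have h := CSH.memXOn_of_solvesHalfWave hI hIb (by linarith) (hA' μ σ) hF (hsol.1 μ σ) hθ
    have e : θ * (1 / 2) + (1 - θ) * (-δ) = θ / 2 - δ * (1 - θ) := by ring
    rwa [e] at h
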